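/- Let $n,k\ge 4$ be integers. A family $\mathcal F$ of subsets of $[n]=\{1,\dots,n\}$ is $k$-antichain saturated if $\mathcal F$ contains no antichain of size $k$, but for every $X\subseteq[n]$ with $X\notin\mathcal F$ the family $\mathcal F\cup\{X\}$ contains an antichain of size $k$. Let $\mathrm{sat}^*(n,k)$ be the smallest size of such a family. Let $\ell$ be the smallest integer $j\ge 0$ such that $\binom{j}{\lfloor j/2\rfloor}\ge k-1$. Let $\mathcal C(m,t)$ be the family of the first $m$ sets of size $t$ of positive integers in the colexicographic order, where $A<B$ if $\max(A\triangle B)\in B$. For a finite family $\mathcal A$ of sets of the same size $t\ge 1$, let $\partial\mathcal A$ be its shadow (the sets of size $t-1$ that are contained in a member of $\mathcal A$), and let $\nu(\mathcal A)$ be the maximum size of a matching in the bipartite graph between $\mathcal A$ and $\partial\mathcal A$ in which $X\in\mathcal A$ is adjacent to $Y\in\partial\mathcal A$ if $Y\subseteq X$. Define $c_{\lfloor\ell/2\rfloor}=k-1$ and $c_t=\nu(\mathcal C(c_{t+1},t+1))$ for $0\le t<\lfloor\ell/2\rfloor$. If $n<\ell$, then $\mathrm{sat}^*(n,k)=2^n$.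 If $n\ge\ell$, then $$\mathrm{sat}^*(n,k)\ \ge\ 2\sum_{t=0}^{\lfloor\ell/2\rfloor}c_t+(k-1)\bigl(n-1-2\lfloor\ell/2\rfloor\bigr).$$ Moreover, equality holds when $n\ge 2\ell+1$. -/

import Mathlib

namespace AntichainSat

/-- The family `F` contains an antichain consisting of `k` (distinct) sets. -/
def HasAntichain {n : ℕ} (k : ℕ) (F : Finset (Finset (Fin n))) : Prop :=
  ∃ A : Finset (Finset (Fin n)),
    A ⊆ F ∧ A.card = k ∧ IsAntichain (· ⊆ ·) (A : Set (Finset (Fin n)))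

/-- A family `F` of subsets of an `n`-element set is `k`-antichain saturated if it contains no
antichain of size `k`, but adding any set that is not in `F` creates one. -/
def IsAntichainSaturated {n : ℕ} (k : ℕ) (F : Finset (Finset (Fin n))) : Prop :=
  ¬ HasAntichain k F ∧ ∀ X : Finset (Fin n), X ∉ F → HasAntichain k (insert X F)

/-- `sat*(n, k)`: the smallest size of a `k`-antichain saturated family of subsets of an
`n`-element set. -/
noncomputable def satStar (n k : ℕ) : ℕ :=
  sInf {m : ℕ | ∃ F : Finset (Finset (Fin n)), IsAntichainSaturated k F ∧ F.card = m}

/-- For `k ≥ 1` the minimum defining `sat*(n, k)` is over a nonempty set, so it is attained. -/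
theorem exists_card_eq_satStar (n k : ℕ) (hk : 1 ≤ k) :
    ∃ F : Finset (Finset (Fin n)), IsAntichainSaturated k F ∧ F.card = satStar n k := by
  have hne : {m : ℕ | ∃ F : Finset (Finset (Fin n)),
      IsAntichainSaturated k F ∧ F.card = m}.Nonempty := by
    have hfin : {F : Finset (Finset (Fin n)) | ¬ HasAntichain k F}.Finite := Set.toFinite _
    have h0 : {F : Finset (Finset (Fin n)) | ¬ HasAntichain k F}.Nonempty := by
      refine ⟨∅, ?_⟩
      rintro ⟨A, hA, hc, -⟩
      rw [Finset.subset_empty.mp hA, Finset.card_empty] at hc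
      omega
    obtain ⟨F, hF⟩ := hfin.exists_maximal h0
    refine ⟨F.card, F, ⟨hF.prop, fun X hX => ?_⟩, rfl⟩
    by_contra hcon
    exact hX (hF.le_of_ge hcon (Finset.subset_insert X F) (Finset.mem_insert_self X F))
  exact Nat.sInf_mem hne

/-- `ℓ(k)`: the smallest `j` such that `binom(j, ⌊j/2⌋) ≥ k - 1`. -/
noncomputable def ell (k : ℕ) : ℕ :=
  sInf {j : ℕ | k - 1 ≤ j.choose (j / 2)}

theorem ell_isLeast (k : ℕ) : IsLeast {j : ℕ | k - 1 ≤ j.choose (j / 2)} (ell k) := by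
  have hne : {j : ℕ | k - 1 ≤ j.choose (j / 2)}.Nonempty := by
    refine ⟨k - 1, ?_⟩
    have h := Nat.choose_le_middle 1 (k - 1)
    rwa [Nat.choose_one_right] at h
  exact ⟨Nat.sInf_mem hne, fun _ hj => Nat.sInf_le hj⟩

/-- `𝒞(m, t)`: the first `m` sets of size `t` in the colexicographic order. The ground set is
`{0, 1, 2, …}`, and the first `m` sets (for `t ≥ 1`) all lie inside `{0, …, m + t - 1}`. A set
belongs to the segment if fewer than `m` sets of size `t` precede it. -/
def colexSeg (m t : ℕ) : Finset (Finset ℕ) :=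
  (Finset.powersetCard t (Finset.range (m + t))).filter fun A =>
    ((Finset.powersetCard t (Finset.range (m + t))).filter
      fun B => toColex B < toColex A).card < m

/-- `M`, a finite set of pairs `(X, Y)`, is a matching in the bipartite graph between `B` and
its shadow, where `X ∈ B` is adjacent to `Y ∈ ∂B` if `Y ⊆ X`. -/
def IsShadowMatching (B : Finset (Finset ℕ)) (M : Finset (Finset ℕ × Finset ℕ)) : Prop :=
  (∀ e ∈ M, e.1 ∈ B ∧ e.2 ∈ Finset.shadow B ∧ e.2 ⊆ e.1) ∧
    ∀ e ∈ M, ∀ f ∈ M, e ≠ f → e.1 ≠ f.1 ∧ e.2 ≠ f.2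

instance (B : Finset (Finset ℕ)) (M : Finset (Finset ℕ × Finset ℕ)) :
    Decidable (IsShadowMatching B M) := by
  unfold IsShadowMatching; infer_instance

/-- `ν(B)`: the maximum size of a matching from `B` to its shadow. -/
def nu (B : Finset (Finset ℕ)) : ℕ :=
  ((B ×ˢ Finset.shadow B).powerset.filter (IsShadowMatching B)).sup Finset.card

/-- The numbers `c_t` belonging to `k`: `c_t = ν(𝒞(c_{t+1}, t + 1))` for `t < ⌊ℓ/2⌋`, and
`c_{⌊ℓ/2⌋} = k - 1` (the same value is used for larger `t`, which do not matter). -/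
noncomputable def c (k t : ℕ) : ℕ :=
  if t < ell k / 2 then nu (colexSeg (c k (t + 1)) (t + 1)) else k - 1
termination_by ell k / 2 - t

theorem c_top (k : ℕ) : c k (ell k / 2) = k - 1 := by
  rw [c, if_neg (lt_irrefl _)]

theorem c_of_lt (k t : ℕ) (h : t < ell k / 2) :
    c k t = nu (colexSeg (c k (t + 1)) (t + 1)) := by
  rw [c, if_pos h]

/-- The value `2 ∑_{t ≤ ⌊ℓ/2⌋} c_t + (k - 1) (n - 1 - 2⌊ℓ/2⌋)`, an integer expression: the last
factor is `-1` when `n = ℓ` is even. -/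
noncomputable def satBound (n k : ℕ) : ℤ :=
  2 * ∑ t ∈ Finset.range (ell k / 2 + 1), (c k t : ℤ) +
    ((k : ℤ) - 1) * ((n : ℤ) - 1 - 2 * ((ell k / 2 : ℕ) : ℤ))

end AntichainSat

/-!
# Antichain saturated families

Put `w = k - 1` and let `F` be a `k`-antichain saturated family.

**Flows.** By Dilworth's theorem `F` is covered by `w` chains, which extend to maximal chains of the
cube. Such a system is recorded as a flow (`IsFlow`): `μ x` counts the chains through `x`, `f x y`
those that pass the covering pair `x ⋖ y`. The chains may meet, so `μ` may exceed one, but a flow of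
the same value with `μ ≤ 1` exists (`IsFlow.exists_le_one`). Indeed, take a flow with the least
`∑ μ x ^ 2` and suppose that its maximum `M` exceeds one. On the lowest level where `M` is attained,
each path `x ⋖ z ⋖ y` with `μ z = M` may be sent half through `z` and half through the other
midpoint of `[x, y]`, after the lower and upper ends have been recoupled. By minimality the other
midpoints also have weight `M`. If the coupling has maximal entropy, its ends are independent given
the midpoint, and then the entropy of the midpoint is at least the mean of the entropies of the two
ends (`entropy_concave`). This is impossible, since the midpoints carry the constant mass `M` and
the ends carry at most `M`, the lower ends strictly less.

For a saturated family this gives a flow with `μ = 1` on `F` and `μ = 0` elsewhere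
(`exists_unit_flow`): adding a set `X ∉ F` creates an antichain of size `w + 1`, while the total
weight of an antichain is at most `w`.

**Lower bound.** Let `L` be level `t + 1` of `F`. The flow between the levels `t` and `t + 1` has
weight exactly `#(L \ S) + #(∂ S)` for some `S ⊆ L` (`exists_levelFlow_eq`). This is König's theorem
for the bipartite graph between `L` and its shadow in the whole cube; shadow elements outside `F` do
not help, because adding one of them to `F` would create a larger antichain. Above the middle
`#(∂ S) ≥ #S`, dually below it, and so all `w` chains pass through the middle level. From there on
downwards, the Kruskal–Katona theorem shows that level `t` has at least `c k t` members
(`c_le_card_slice`). The top half is treated by complementation.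

**Upper bound.** Families `B 0, …, B a` with `a = ell k / 2` and `#(B a) = w` are built in a
ground set of size `ell k` (`IsBottom`, `exists_isBottom`), together with vertex covers certifying
`#(B j) ≤ c k j`. With complements of such families in a disjoint ground set they contain no
antichain of size `k`, so they lie in a saturated family. There level `a` has size `w` already, so
every chain that meets a lower level reaches level `a`, and the vertex covers force the levels
`j ≤ a` to be the `B j` (`IsBottom.slice_eq`).
-/

namespace AntichainSat

open Finset
open scoped FinsetFamily

/-! ### An entropy inequality for midpoints -/

section Entropy

variable {V X Y : Type*} [Fintype V] [Fintype X] [DecidableEq X] [DecidableEq Y]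

/-- One half of `entropy_concave`: by `log t ≤ t - 1`, a relative entropy between `σ` and the law
of two midpoints that are drawn independently given the lower end is nonnegative. -/
lemma entropy_half (σ : V → V → ℝ) (p : V → V → X) (q : V → V → Y)
    (hσ : ∀ z z', 0 ≤ σ z z') (hsymm : ∀ z z', σ z z' = σ z' z)
    (hp : ∀ z z', p z z' = p z' z) (s : V → ℝ) (A : V → X → ℝ) (B : V → Y → ℝ) (g : X → ℝ)
    (hA : ∀ z x, A z x = ∑ z', if p z z' = x then σ z z' else 0)
    (hB : ∀ z y, B z y = ∑ z', if q z z' = y then σ z z' else 0)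
    (hg : ∀ x, g x = ∑ z, A z x)
    (hrank : ∀ z z', σ z z' ≠ 0 → σ z z' * s z = A z (p z z') * B z (q z z')) :
    ∑ z, ∑ z', σ z z' * (Real.log (s z) + Real.log (A z' (p z z')) - Real.log (B z (q z z'))
      - Real.log (g (p z z'))) ≤ 0 := by
  have hA0 : ∀ z x, 0 ≤ A z x := fun z x => by
    rw [hA]; exact sum_nonneg fun z' _ => by split_ifs <;> simp [hσ]
  have hg0 : ∀ x, 0 ≤ g x := fun x => by rw [hg]; exact sum_nonneg fun z _ => hA0 z x
  have hσA : ∀ z z', σ z z' ≤ A z (p z z') := fun z z' => by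
    rw [hA]
    refine le_trans ?_ (single_le_sum (f := fun z'' => if p z z'' = p z z' then σ z z'' else 0)
      (fun z'' _ => by split_ifs <;> simp [hσ]) (mem_univ z'))
    simp
  have hσB : ∀ z z', σ z z' ≤ B z (q z z') := fun z z' => by
    rw [hB]
    refine le_trans ?_ (single_le_sum (f := fun z'' => if q z z'' = q z z' then σ z z'' else 0)
      (fun z'' _ => by split_ifs <;> simp [hσ]) (mem_univ z'))
    simp
  have hAg : ∀ z x, A z x ≤ g x := fun z x => by
    rw [hg]; exact single_le_sum (f := fun z => A z x) (fun z _ => hA0 z x) (mem_univ z)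
  have hterm : ∀ z z', σ z z' * (Real.log (s z) + Real.log (A z' (p z z'))
      - Real.log (B z (q z z')) - Real.log (g (p z z')))
      ≤ A z (p z z') * A z' (p z z') / g (p z z') - σ z z' := by
    intro z z'
    rcases eq_or_lt_of_le (hσ z z') with h | h
    · rw [← h]
      simp only [zero_mul, sub_zero]
      exact div_nonneg (mul_nonneg (hA0 _ _) (hA0 _ _)) (hg0 _)
    · have h1 : 0 < A z (p z z') := h.trans_le (hσA z z')
      have h2 : 0 < B z (q z z') := h.trans_le (hσB z z')
      have h3 : 0 < A z' (p z z') := by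
        have := hσA z' z
        rw [hp z' z, ← hsymm z z'] at this
        exact h.trans_le this
      have h4 : 0 < g (p z z') := h1.trans_le (hAg _ _)
      have hr := hrank z z' h.ne'
      have h5 : 0 < s z := by
        by_contra hs
        have : σ z z' * s z ≤ 0 := mul_nonpos_of_nonneg_of_nonpos h.le (not_lt.mp hs)
        have := mul_pos h1 h2
        linarith
      have hlog : Real.log (s z) + Real.log (A z' (p z z'))
          - Real.log (B z (q z z')) - Real.log (g (p z z'))
          = Real.log (s z * A z' (p z z') / (B z (q z z') * g (p z z'))) := by
        rw [Real.log_div (by positivity) (by positivity), Real.log_mul h5.ne' h3.ne',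
          Real.log_mul h2.ne' h4.ne']
        ring
      rw [hlog]
      have hle := Real.log_le_sub_one_of_pos
        (show 0 < s z * A z' (p z z') / (B z (q z z') * g (p z z')) by positivity)
      calc _ ≤ σ z z' * (s z * A z' (p z z') / (B z (q z z') * g (p z z')) - 1) :=
            mul_le_mul_of_nonneg_left hle h.le
        _ = (σ z z' * s z) * A z' (p z z') / (B z (q z z') * g (p z z')) - σ z z' := by ring
        _ = _ := by
          rw [hr]
          field_simp
  have hsum : ∑ z, ∑ z', A z (p z z') * A z' (p z z') / g (p z z') ≤ ∑ z, ∑ z', σ z z' := by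
    calc ∑ z, ∑ z', A z (p z z') * A z' (p z z') / g (p z z')
        ≤ ∑ z, ∑ z', ∑ x, A z x * A z' x / g x := by
          refine sum_le_sum fun z _ => sum_le_sum fun z' _ => ?_
          exact single_le_sum (f := fun x => A z x * A z' x / g x)
            (fun x _ => div_nonneg (mul_nonneg (hA0 _ _) (hA0 _ _)) (hg0 _)) (mem_univ _)
      _ = ∑ x, ∑ z, ∑ z', A z x * A z' x / g x := by
          rw [sum_congr rfl fun z _ => sum_comm, sum_comm]
      _ = ∑ x, g x := by
          refine sum_congr rfl fun x _ => ?_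
          simp_rw [← sum_div, ← mul_sum, ← sum_mul, ← hg]
          exact mul_self_div_self _
      _ = ∑ z, ∑ z', σ z z' := by
          simp_rw [hg]
          rw [sum_comm]
          refine sum_congr rfl fun z _ => ?_
          simp_rw [hA]
          rw [sum_comm]
          simp
  calc _ ≤ ∑ z, ∑ z', (A z (p z z') * A z' (p z z') / g (p z z') - σ z z') :=
        sum_le_sum fun z _ => sum_le_sum fun z' _ => hterm z z'
    _ ≤ 0 := by simp_rw [sum_sub_distrib]; linarith

variable [Fintype Y]

/-- Concavity of entropy along a symmetric local exchange.  Read `σ z z'` as the mass of paths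
through `z` whose other midpoint is `z'`; such a path has lower end `p z z'` and upper end
`q z z'`.  If the two ends are independent given `z`, then the entropy of the midpoint is at least
the mean of the entropies of the two ends. -/
lemma entropy_concave (σ : V → V → ℝ) (p : V → V → X) (q : V → V → Y)
    (hσ : ∀ z z', 0 ≤ σ z z') (hsymm : ∀ z z', σ z z' = σ z' z)
    (hp : ∀ z z', p z z' = p z' z) (hq : ∀ z z', q z z' = q z' z)
    (s : V → ℝ) (A : V → X → ℝ) (B : V → Y → ℝ) (g : X → ℝ) (h : Y → ℝ)
    (hA : ∀ z x, A z x = ∑ z', if p z z' = x then σ z z' else 0)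
    (hB : ∀ z y, B z y = ∑ z', if q z z' = y then σ z z' else 0)
    (hg : ∀ x, g x = ∑ z, A z x) (hh : ∀ y, h y = ∑ z, B z y)
    (hrank : ∀ z z', σ z z' ≠ 0 → σ z z' * s z = A z (p z z') * B z (q z z')) :
    ∑ z, ∑ z', σ z z' * (2 * Real.log (s z)) ≤
      ∑ z, ∑ z', σ z z' * (Real.log (g (p z z')) + Real.log (h (q z z'))) := by
  have h1 := entropy_half σ p q hσ hsymm hp s A B g hA hB hg hrank
  have h2 := entropy_half σ q p hσ hsymm hq s B A h hB hA hh
    fun z z' hz => by rw [hrank z z' hz, mul_comm]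
  have e1 : ∑ z, ∑ z', σ z z' * Real.log (A z' (p z z'))
      = ∑ z, ∑ z', σ z z' * Real.log (A z (p z z')) := by
    rw [sum_comm]
    exact sum_congr rfl fun z _ => sum_congr rfl fun z' _ => by rw [hsymm, hp]
  have e2 : ∑ z, ∑ z', σ z z' * Real.log (B z' (q z z'))
      = ∑ z, ∑ z', σ z z' * Real.log (B z (q z z')) := by
    rw [sum_comm]
    exact sum_congr rfl fun z _ => sum_congr rfl fun z' _ => by rw [hsymm, hq]
  simp only [mul_add, mul_sub, sum_add_distrib, sum_sub_distrib] at h1 h2 ⊢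
  have e3 : ∑ z, ∑ z', σ z z' * (2 * Real.log (s z))
      = 2 * ∑ z, ∑ z', σ z z' * Real.log (s z) := by
    simp_rw [mul_sum]
    exact sum_congr rfl fun z _ => sum_congr rfl fun z' _ => by ring
  linarith

/-- If the midpoints carry total mass `M * #Z` on a set `Z`, then the ends cannot all carry mass
at most `M` with the lower ends strictly below `M`. -/
lemma false_of_mass_lt (σ : V → V → ℝ) (p : V → V → X) (q : V → V → Y)
    (hσ : ∀ z z', 0 ≤ σ z z') (hsymm : ∀ z z', σ z z' = σ z' z)
    (hp : ∀ z z', p z z' = p z' z) (hq : ∀ z z', q z z' = q z' z)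
    (s : V → ℝ) (A : V → X → ℝ) (B : V → Y → ℝ) (g : X → ℝ) (h : Y → ℝ)
    (hs : ∀ z, s z = ∑ z', σ z z')
    (hA : ∀ z x, A z x = ∑ z', if p z z' = x then σ z z' else 0)
    (hB : ∀ z y, B z y = ∑ z', if q z z' = y then σ z z' else 0)
    (hg : ∀ x, g x = ∑ z, A z x) (hh : ∀ y, h y = ∑ z, B z y)
    (hrank : ∀ z z', σ z z' ≠ 0 → σ z z' * s z = A z (p z z') * B z (q z z'))
    (Z : Finset V) (M : ℝ) (hM : 0 < M) (hZ : Z.Nonempty)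
    (hsZ : ∀ z, s z ≠ 0 → z ∈ Z) (htot : ∑ z, s z = M * #Z)
    (hgM : ∀ z z', σ z z' ≠ 0 → g (p z z') < M) (hhM : ∀ z z', σ z z' ≠ 0 → h (q z z') ≤ M) :
    False := by
  classical
  have hmain := entropy_concave σ p q hσ hsymm hp hq s A B g h hA hB hg hh hrank
  have hs0 : ∀ z, 0 ≤ s z := fun z => by rw [hs]; exact sum_nonneg fun z' _ => hσ z z'
  have hpos : ∀ z z', 0 < σ z z' → 0 < g (p z z') ∧ 0 < h (q z z') := by
    intro z z' hzz
    constructor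
    · rw [hg]
      refine sum_pos' (fun z _ => ?_) ⟨z, mem_univ _, ?_⟩
      · rw [hA]; exact sum_nonneg fun z' _ => by split_ifs <;> simp [hσ]
      · rw [hA]
        exact sum_pos' (fun z' _ => by split_ifs <;> simp [hσ]) ⟨z', mem_univ _, by simpa⟩
    · rw [hh]
      refine sum_pos' (fun z _ => ?_) ⟨z, mem_univ _, ?_⟩
      · rw [hB]; exact sum_nonneg fun z' _ => by split_ifs <;> simp [hσ]
      · rw [hB]
        exact sum_pos' (fun z' _ => by split_ifs <;> simp [hσ]) ⟨z', mem_univ _, by simpa⟩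
  -- some pair carries mass
  have hex : ∃ z z', 0 < σ z z' := by
    by_contra hcon
    push Not at hcon
    have h0 : ∑ z, s z = 0 := sum_eq_zero fun z _ => by
      rw [hs]; exact sum_eq_zero fun z' _ => le_antisymm (hcon z z') (hσ z z')
    rw [htot] at h0
    have : (0 : ℝ) < #Z := by exact_mod_cast hZ.card_pos
    have := mul_pos hM this
    linarith
  obtain ⟨z₀, z₁, h01⟩ := hex
  have hterm : ∀ z z', σ z z' * (Real.log (g (p z z')) + Real.log (h (q z z')))
      ≤ σ z z' * (2 * Real.log M) := by
    intro z z'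
    rcases eq_or_lt_of_le (hσ z z') with h0 | h0
    · simp [← h0]
    · have := Real.log_le_log (hpos z z' h0).1 (hgM z z' h0.ne').le
      have := Real.log_le_log (hpos z z' h0).2 (hhM z z' h0.ne')
      exact mul_le_mul_of_nonneg_left (by linarith) h0.le
  have hstrict : σ z₀ z₁ * (Real.log (g (p z₀ z₁)) + Real.log (h (q z₀ z₁)))
      < σ z₀ z₁ * (2 * Real.log M) := by
    have := Real.log_lt_log (hpos z₀ z₁ h01).1 (hgM z₀ z₁ h01.ne')
    have := Real.log_le_log (hpos z₀ z₁ h01).2 (hhM z₀ z₁ h01.ne')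
    exact mul_lt_mul_of_pos_left (by linarith) h01
  have hlt : ∑ z, ∑ z', σ z z' * (Real.log (g (p z z')) + Real.log (h (q z z')))
      < ∑ z, ∑ z', σ z z' * (2 * Real.log M) :=
    sum_lt_sum (fun z _ => sum_le_sum fun z' _ => hterm z z')
      ⟨z₀, mem_univ _, sum_lt_sum (fun z' _ => hterm z₀ z') ⟨z₁, mem_univ _, hstrict⟩⟩
  simp_rw [← sum_mul, ← hs] at hlt hmain
  -- Gibbs' inequality against the uniform mass `M` on `Z`
  have hgibbs : ∀ z, s z * (2 * Real.log M) + 2 * (s z - if z ∈ Z then M else 0)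
      ≤ s z * (2 * Real.log (s z)) := by
    intro z
    rcases eq_or_lt_of_le (hs0 z) with h0 | h0
    · rw [← h0]
      split_ifs <;> simp [hM.le]
    · rw [if_pos (hsZ z h0.ne')]
      have := Real.one_sub_inv_le_log_of_pos (show 0 < s z / M by positivity)
      rw [Real.log_div h0.ne' hM.ne', inv_div] at this
      have h2 := mul_le_mul_of_nonneg_left this h0.le
      have h3 : s z * (1 - M / s z) = s z - M := by field_simp
      rw [h3] at h2
      linarith
  have := sum_le_sum fun z (_ : z ∈ univ) => hgibbs z
  rw [sum_add_distrib, ← mul_sum, sum_sub_distrib, htot] at this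
  simp only [sum_ite_mem, univ_inter, sum_const, nsmul_eq_mul] at this
  have e : M * (#Z : ℝ) - #Z * M = 0 := by ring
  rw [e] at this
  simp only [mul_zero, add_zero] at this
  rw [← sum_mul] at this
  linarith

end Entropy

/-! ### Couplings of maximal entropy -/

section Coupling

variable {X Y : Type*} [Fintype X] [Fintype Y] [DecidableEq X] [DecidableEq Y]

/-- The graph of the concave function `negMulLog` lies below its tangent at `u`. -/
lemma negMulLog_le_tangent {u v : ℝ} (hu : 0 < u) (hv : 0 ≤ v) :
    Real.negMulLog v + (Real.log u + 1) * (v - u) ≤ Real.negMulLog u := by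
  unfold Real.negMulLog
  rcases eq_or_lt_of_le hv with rfl | hv
  · simp; nlinarith
  · have := Real.one_sub_inv_le_log_of_pos (show 0 < v / u by positivity)
    rw [Real.log_div hv.ne' hu.ne', inv_div] at this
    have h2 := mul_le_mul_of_nonneg_left this hv.le
    have h3 : v * (1 - u / v) = v - u := by field_simp
    rw [h3] at h2
    linarith

/-- Among the couplings of two given marginals that live on an allowed relation `R`, one of
maximal entropy exists.  Optimality along `4`-cycles of allowed pairs yields the exchange
inequality, and hence, by symmetry, local independence. -/
lemma exists_coupling (R : X → Y → Prop) (π₀ : X → Y → ℝ) (h0 : ∀ x y, 0 ≤ π₀ x y)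
    (hR : ∀ x y, π₀ x y ≠ 0 → R x y) :
    ∃ π : X → Y → ℝ, (∀ x y, 0 ≤ π x y) ∧ (∀ x y, π x y ≠ 0 → R x y) ∧
      (∀ x, ∑ y, π x y = ∑ y, π₀ x y) ∧ (∀ y, ∑ x, π x y = ∑ x, π₀ x y) ∧
      ∀ x x' y y', R x y' → R x' y → π x y * π x' y' ≤ π x y' * π x' y := by
  classical
  set K : Set (X → Y → ℝ) := {π | (∀ x y, 0 ≤ π x y) ∧ (∀ x y, ¬ R x y → π x y = 0) ∧
      (∀ x, ∑ y, π x y = ∑ y, π₀ x y) ∧ (∀ y, ∑ x, π x y = ∑ x, π₀ x y)} with hK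
  have hclosed : IsClosed K := by
    have e : K = (⋂ x, ⋂ y, {π | 0 ≤ π x y}) ∩ ((⋂ x, ⋂ y, {π | ¬ R x y → π x y = 0}) ∩
        ((⋂ x, {π | ∑ y, π x y = ∑ y, π₀ x y}) ∩ (⋂ y, {π | ∑ x, π x y = ∑ x, π₀ x y}))) := by
      ext π; simp [hK]
    rw [e]
    refine (isClosed_iInter fun x => isClosed_iInter fun y => ?_).inter
      ((isClosed_iInter fun x => isClosed_iInter fun y => ?_).inter
      ((isClosed_iInter fun x => ?_).inter (isClosed_iInter fun y => ?_)))
    · exact isClosed_le (by fun_prop) (by fun_prop)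
    · by_cases h : R x y
      · simp [h]
      · simp only [h, not_false_eq_true, forall_const]
        exact isClosed_eq (by fun_prop) (by fun_prop)
    · exact isClosed_eq (by fun_prop) (by fun_prop)
    · exact isClosed_eq (by fun_prop) (by fun_prop)
  have hcomp : IsCompact K := by
    refine (isCompact_Icc (a := (0 : X → Y → ℝ)) (b := fun x _ => ∑ y, π₀ x y)).of_isClosed_subset
      hclosed ?_
    rintro π ⟨h1, -, h3, -⟩
    refine ⟨fun x y => h1 x y, fun x y => ?_⟩
    change π x y ≤ ∑ y, π₀ x y
    rw [← h3 x]
    exact single_le_sum (f := fun y => π x y) (fun y _ => h1 x y) (mem_univ y)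
  obtain ⟨π, hπ, hmax⟩ := hcomp.exists_isMaxOn
    ⟨π₀, h0, fun x y h => by_contra fun h' => h (hR x y h'), fun _ => rfl, fun _ => rfl⟩
    (f := fun π => ∑ x, ∑ y, Real.negMulLog (π x y))
    (Continuous.continuousOn (by fun_prop))
  obtain ⟨hπ0, hπR, hπr, hπc⟩ := hπ
  refine ⟨π, hπ0, fun x y h => by_contra fun h' => h (hπR x y h'), hπr, hπc, ?_⟩
  intro x x' y y' h1 h2
  by_contra! hlt
  have hxx : x ≠ x' := by rintro rfl; linarith [mul_comm (π x y) (π x y')]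
  have hyy : y ≠ y' := by rintro rfl; linarith [mul_comm (π x y) (π x' y)]
  have hpp : 0 < π x y * π x' y' := (mul_nonneg (hπ0 _ _) (hπ0 _ _)).trans_lt hlt
  have ha : 0 < π x y := (hπ0 x y).lt_of_ne fun h => by rw [← h, zero_mul] at hpp; exact hpp.false
  have hd : 0 < π x' y' :=
    (hπ0 x' y').lt_of_ne fun h => by rw [← h, mul_zero] at hpp; exact hpp.false
  -- a small shift of mass along the `4`-cycle keeps the strict inequality
  obtain ⟨ε, hε, hεa, hεd, hεlt⟩ : ∃ ε : ℝ, 0 < ε ∧ ε < π x y ∧ ε < π x' y' ∧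
      (π x y' + ε) * (π x' y + ε) < (π x y - ε) * (π x' y' - ε) := by
    have hc : Filter.Tendsto (fun ε : ℝ => (π x y - ε) * (π x' y' - ε)
        - (π x y' + ε) * (π x' y + ε)) (nhdsWithin 0 (Set.Ioi 0))
        (nhds (π x y * π x' y' - π x y' * π x' y)) := by
      refine Filter.Tendsto.mono_left ?_ nhdsWithin_le_nhds
      have : Continuous (fun ε : ℝ => (π x y - ε) * (π x' y' - ε)
        - (π x y' + ε) * (π x' y + ε)) := by fun_prop
      simpa using this.tendsto 0
    have h3 := hc.eventually (lt_mem_nhds (sub_pos.2 hlt))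
    have h4 : ∀ᶠ ε : ℝ in nhdsWithin 0 (Set.Ioi 0), ε ∈ Set.Ioo 0 (min (π x y) (π x' y')) :=
      Ioo_mem_nhdsGT (lt_min ha hd)
    obtain ⟨ε, h5, h6⟩ := (h3.and h4).exists
    exact ⟨ε, h6.1, h6.2.trans_le (min_le_left _ _), h6.2.trans_le (min_le_right _ _),
      sub_pos.1 h5⟩
  set α : X → ℝ := fun u => (if u = x then 1 else 0) - (if u = x' then 1 else 0) with hα
  set β : Y → ℝ := fun v => (if v = y' then 1 else 0) - (if v = y then 1 else 0) with hβ
  have hα0 : ∑ u, α u = 0 := by simp [hα]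
  have hβ0 : ∑ v, β v = 0 := by simp [hβ]
  have hαx : α x = 1 := by simp [hα, hxx]
  have hαx' : α x' = -1 := by simp [hα, hxx.symm]
  have hβy : β y = -1 := by simp [hβ, hyy]
  have hβy' : β y' = 1 := by simp [hβ, hyy.symm]
  set π' : X → Y → ℝ := fun u v => π u v + ε * (α u * β v) with hπ'
  have hcell : ∀ u v, α u * β v ≠ 0 → 0 < π' u v ∧ R u v := by
    intro u v huv
    have hu : u = x ∨ u = x' := by
      by_contra! h; apply huv; simp [hα, h.1, h.2]
    have hv : v = y ∨ v = y' := by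
      by_contra! h; apply huv; simp [hβ, h.1, h.2]
    rcases hu with rfl | rfl <;> rcases hv with rfl | rfl
    · refine ⟨?_, by_contra fun h => ha.ne' (hπR _ _ h)⟩
      simp only [hπ', hαx, hβy]; linarith
    · refine ⟨?_, h1⟩
      simp only [hπ', hαx, hβy']; linarith [hπ0 u v]
    · refine ⟨?_, h2⟩
      simp only [hπ', hαx', hβy]; linarith [hπ0 u v]
    · refine ⟨?_, by_contra fun h => hd.ne' (hπR _ _ h)⟩
      simp only [hπ', hαx', hβy']; linarith
  have hmem : π' ∈ K := by
    refine ⟨fun u v => ?_, fun u v h => ?_, fun u => ?_, fun v => ?_⟩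
    · by_cases huv : α u * β v = 0
      · simp [hπ', huv, hπ0]
      · exact (hcell u v huv).1.le
    · have huv : α u * β v = 0 := by_contra fun h' => h (hcell u v h').2
      simp [hπ', huv, hπR u v h]
    · simp_rw [hπ', sum_add_distrib, ← mul_sum, hβ0, hπr]; simp
    · simp_rw [hπ', sum_add_distrib, ← mul_sum, ← sum_mul, hα0, hπc]; simp
  have hle : ∑ u, ∑ v, Real.negMulLog (π' u v) ≤ ∑ u, ∑ v, Real.negMulLog (π u v) := hmax hmem
  have hterm : ∀ u v, Real.negMulLog (π u v) - ε * (α u * β v) * (Real.log (π' u v) + 1)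
      ≤ Real.negMulLog (π' u v) := by
    intro u v
    by_cases huv : α u * β v = 0
    · simp [hπ', huv]
    · have := negMulLog_le_tangent (hcell u v huv).1 (hπ0 u v)
      have e : π' u v = π u v + ε * (α u * β v) := rfl
      have e2 : π u v - π' u v = - (ε * (α u * β v)) := by rw [e]; ring
      rw [e2] at this
      linarith
  have hsum := sum_le_sum fun u (_ : u ∈ univ) => sum_le_sum fun v (_ : v ∈ univ) => hterm u v
  simp_rw [sum_sub_distrib] at hsum
  have hS : ∑ u, ∑ v, ε * (α u * β v) * (Real.log (π' u v) + 1)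
      = ε * (Real.log (π' x y') + Real.log (π' x' y) - Real.log (π' x y)
        - Real.log (π' x' y')) := by
    have e1 : ∀ u v, ε * (α u * β v) * (Real.log (π' u v) + 1)
        = ε * (α u * (β v * (Real.log (π' u v) + 1))) := fun u v => by ring
    simp_rw [e1, ← mul_sum]
    congr 1
    have e2 : ∀ u, ∑ v, β v * (Real.log (π' u v) + 1)
        = Real.log (π' u y') - Real.log (π' u y) := fun u => by
      simp [hβ, sub_mul, sum_sub_distrib]
    simp_rw [e2]
    simp only [hα, sub_mul, sum_sub_distrib, ite_mul, one_mul, zero_mul, sum_ite_eq', mem_univ,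
      if_true]
    ring
  rw [hS] at hsum
  have p1 : π' x y = π x y - ε := by simp only [hπ', hαx, hβy]; ring
  have p2 : π' x' y' = π x' y' - ε := by simp only [hπ', hαx', hβy']; ring
  have p3 : π' x y' = π x y' + ε := by simp only [hπ', hαx, hβy']; ring
  have p4 : π' x' y = π x' y + ε := by simp only [hπ', hαx', hβy]; ring
  rw [p1, p2, p3, p4] at hsum
  have q1 : 0 < π x y' + ε := by linarith [hπ0 x y']
  have q2 : 0 < π x' y + ε := by linarith [hπ0 x' y]
  have q3 : 0 < π x y - ε := by linarith
  have q4 : 0 < π x' y' - ε := by linarith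
  have hlog := Real.log_lt_log (mul_pos q1 q2) hεlt
  rw [Real.log_mul q1.ne' q2.ne', Real.log_mul q3.ne' q4.ne'] at hlog
  have : ε * (Real.log (π x y' + ε) + Real.log (π x' y + ε) - Real.log (π x y - ε)
        - Real.log (π x' y' - ε)) < 0 := mul_neg_of_pos_of_neg hε (by linarith)
  linarith

end Coupling

/-! ### Midpoints of intervals of length two -/

section Midpoints

variable {α : Type*} [DecidableEq α]

lemma covBy_iff_card {x y : Finset α} : x ⋖ y ↔ x ⊆ y ∧ #y = #x + 1 := by
  rw [covBy_iff_card_sdiff_eq_one]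
  constructor
  · rintro ⟨h, h1⟩
    rw [card_sdiff_of_subset h] at h1
    have := card_le_card h
    exact ⟨h, by omega⟩
  · rintro ⟨h, h1⟩
    refine ⟨h, ?_⟩
    rw [card_sdiff_of_subset h]
    omega

instance decidableCovBy (x y : Finset α) : Decidable (x ⋖ y) :=
  decidable_of_iff _ covBy_iff_card.symm

lemma card_midpoints [Fintype α] {x y : Finset α} (hxy : x ⊆ y) (hc : #y = #x + 2) :
    #{z : Finset α | x ⋖ z ∧ z ⋖ y} = 2 := by
  have h2 : #(y \ x) = 2 := by rw [card_sdiff_of_subset hxy]; omega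
  have hinj : Set.InjOn (fun a => insert a x) (y \ x : Finset α) := by
    intro a ha b hb hab
    have ha' : a ∉ x := (mem_sdiff.1 (mem_coe.1 ha)).2
    have : a ∈ insert b x := by rw [← show insert a x = insert b x from hab]; simp
    simpa [ha'] using this
  have : ({z : Finset α | x ⋖ z ∧ z ⋖ y} : Finset (Finset α)) = (y \ x).image
      (fun a => insert a x) := by
    ext z
    simp only [mem_filter, mem_univ, true_and, mem_image, mem_sdiff]
    constructor
    · rintro ⟨h1, h3⟩
      obtain ⟨a, ha, rfl⟩ := covBy_iff_exists_insert.1 h1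
      exact ⟨a, ⟨(covBy_iff_card.1 h3).1 (mem_insert_self _ _), ha⟩, rfl⟩
    · rintro ⟨a, ⟨ha, ha'⟩, rfl⟩
      refine ⟨covBy_insert ha', covBy_iff_card.2 ⟨insert_subset ha hxy, ?_⟩⟩
      rw [card_insert_of_notMem ha', hc]
  rw [this, card_image_of_injOn hinj, h2]

/-- Summing over the upper ends `y` above `z` is the same as summing over the alternative
midpoints `z'` that share the lower end `x` with `z`. -/
lemma sum_upper_eq [Fintype α] (G : Finset α → Finset α → ℝ)
    (hG : ∀ x y, G x y ≠ 0 → x ⊆ y ∧ #y = #x + 2) (z x : Finset α) :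
    (∑ y, if x ⋖ z ∧ z ⋖ y then G x y else 0) =
      ∑ z', if z ∩ z' = x then (if #z = #z' then G (z ∩ z') (z ∪ z') else 0) else 0 := by
  symm
  refine sum_bij_ne_zero (fun z' _ _ => z ∪ z') (fun _ _ _ => mem_univ _) ?_ ?_ ?_
  · intro a _ ha b _ hb hab
    have h1 : z ∩ a = x := by by_contra h; simp [h] at ha
    have h2 : z ∩ b = x := by by_contra h; simp [h] at hb
    have h3 : z ⊓ a = z ⊓ b := h1.trans h2.symm
    exact eq_of_inf_eq_sup_eq (a := z) (by rwa [inf_comm a, inf_comm b])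
      (by rw [sup_comm a, sup_comm b]; exact hab)
  · intro y _ hy
    have h1 : x ⋖ z ∧ z ⋖ y := by by_contra h; simp [h] at hy
    have c1 := covBy_iff_card.1 h1.1
    have c2 := covBy_iff_card.1 h1.2
    have hint : z ∩ (x ∪ (y \ z)) = x := by
      ext e; simp only [mem_inter, mem_union, mem_sdiff]
      have := @c1.1 e
      tauto
    have huni : z ∪ (x ∪ (y \ z)) = y := by
      ext e; simp only [mem_union, mem_sdiff]
      have := @c1.1 e
      have := @c2.1 e
      tauto
    have hcard : #z = #(x ∪ (y \ z)) := by
      rw [card_union_of_disjoint, card_sdiff_of_subset c2.1]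
      · omega
      · exact disjoint_sdiff.mono_left c1.1
    refine ⟨x ∪ (y \ z), mem_univ _, ?_, huni⟩
    rw [if_pos hint, if_pos hcard, hint, huni]
    simpa [h1] using hy
  · intro z' _ hz'
    have h1 : z ∩ z' = x := by by_contra h; simp [h] at hz'
    have h2 : #z = #z' := by by_contra h; simp [h] at hz'
    rw [if_pos h1, if_pos h2, h1, if_pos]
    have h3 : G x (z ∪ z') ≠ 0 := by simpa [h1, h2] using hz'
    obtain ⟨-, h4⟩ := hG _ _ h3
    have h5 := card_union_add_card_inter z z'
    rw [h1] at h5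
    rw [covBy_iff_card, covBy_iff_card]
    refine ⟨⟨?_, by omega⟩, subset_union_left, by omega⟩
    rw [← h1]; exact inter_subset_left

/-- The version of `sum_upper_eq` for the lower ends. -/
lemma sum_lower_eq [Fintype α] (G : Finset α → Finset α → ℝ)
    (hG : ∀ x y, G x y ≠ 0 → x ⊆ y ∧ #y = #x + 2) (z y : Finset α) :
    (∑ x, if x ⋖ z ∧ z ⋖ y then G x y else 0) =
      ∑ z', if z ∪ z' = y then (if #z = #z' then G (z ∩ z') (z ∪ z') else 0) else 0 := by
  symm
  refine sum_bij_ne_zero (fun z' _ _ => z ∩ z') (fun _ _ _ => mem_univ _) ?_ ?_ ?_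
  · intro a _ ha b _ hb hab
    have h1 : z ∪ a = y := by by_contra h; simp [h] at ha
    have h2 : z ∪ b = y := by by_contra h; simp [h] at hb
    have h3 : z ⊔ a = z ⊔ b := h1.trans h2.symm
    exact eq_of_inf_eq_sup_eq (a := z) (by rw [inf_comm a, inf_comm b]; exact hab)
      (by rwa [sup_comm a, sup_comm b])
  · intro x _ hx
    have h1 : x ⋖ z ∧ z ⋖ y := by by_contra h; simp [h] at hx
    have c1 := covBy_iff_card.1 h1.1
    have c2 := covBy_iff_card.1 h1.2
    have hint : z ∩ (x ∪ (y \ z)) = x := by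
      ext e; simp only [mem_inter, mem_union, mem_sdiff]
      have := @c1.1 e
      tauto
    have huni : z ∪ (x ∪ (y \ z)) = y := by
      ext e; simp only [mem_union, mem_sdiff]
      have := @c1.1 e
      have := @c2.1 e
      tauto
    have hcard : #z = #(x ∪ (y \ z)) := by
      rw [card_union_of_disjoint, card_sdiff_of_subset c2.1]
      · omega
      · exact disjoint_sdiff.mono_left c1.1
    refine ⟨x ∪ (y \ z), mem_univ _, ?_, hint⟩
    rw [if_pos huni, if_pos hcard, hint, huni]
    simpa [h1] using hx
  · intro z' _ hz'
    have h1 : z ∪ z' = y := by by_contra h; simp [h] at hz'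
    have h2 : #z = #z' := by by_contra h; simp [h] at hz'
    rw [if_pos h1, if_pos h2, h1, if_pos]
    have h3 : G (z ∩ z') y ≠ 0 := by simpa [h1, h2] using hz'
    obtain ⟨-, h4⟩ := hG _ _ h3
    have h5 := card_union_add_card_inter z z'
    rw [h1] at h5
    rw [covBy_iff_card, covBy_iff_card]
    refine ⟨⟨inter_subset_left, by omega⟩, ?_, by omega⟩
    rw [← h1]; exact subset_union_left

/-- If mass moves from level `j - 1` to level `j + 1` along a locally independent coupling `π`,
half of it through each of the two midpoints, then it cannot all pass through a set `Z` of
midpoints with average mass `M` when the ends have mass at most `M`, strictly less below. -/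
lemma false_of_coupling [Fintype α] (π : Finset α → Finset α → ℝ) (h0 : ∀ x y, 0 ≤ π x y)
    (j : ℕ) (hR : ∀ x y, π x y ≠ 0 → x ⊆ y ∧ #y = #x + 2 ∧ #x + 1 = j)
    (hex : ∀ x x' y y', (x ⊆ y' ∧ #y' = #x + 2 ∧ #x + 1 = j) →
      (x' ⊆ y ∧ #y = #x' + 2 ∧ #x' + 1 = j) → π x y * π x' y' ≤ π x y' * π x' y)
    (Z : Finset (Finset α)) (M : ℝ) (hM : 0 < M) (hZ : Z.Nonempty)
    (hsZ : ∀ z, (∑ x, ∑ y, if x ⋖ z ∧ z ⋖ y then π x y / 2 else 0) ≠ 0 → z ∈ Z)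
    (htot : ∑ x, ∑ y, π x y = M * #Z)
    (hg : ∀ x y, π x y ≠ 0 → ∑ y', π x y' < M) (hh : ∀ y, ∑ x, π x y ≤ M) : False := by
  set G : Finset α → Finset α → ℝ := fun x y => π x y / 2 with hGdef
  have hG : ∀ x y, G x y ≠ 0 → x ⊆ y ∧ #y = #x + 2 := fun x y h => by
    have : π x y ≠ 0 := by rintro h'; simp [hGdef, h'] at h
    exact ⟨(hR x y this).1, (hR x y this).2.1⟩
  set σ : Finset α → Finset α → ℝ :=
    fun z z' => if #z = #z' then G (z ∩ z') (z ∪ z') else 0 with hσ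
  set A : Finset α → Finset α → ℝ := fun z x => ∑ y, if x ⋖ z ∧ z ⋖ y then G x y else 0 with hA
  set B : Finset α → Finset α → ℝ := fun z y => ∑ x, if x ⋖ z ∧ z ⋖ y then G x y else 0 with hB
  set s : Finset α → ℝ := fun z => ∑ x, ∑ y, if x ⋖ z ∧ z ⋖ y then G x y else 0 with hs
  have hA' : ∀ z x, A z x = ∑ z', if z ∩ z' = x then σ z z' else 0 := sum_upper_eq G hG
  have hB' : ∀ z y, B z y = ∑ z', if z ∪ z' = y then σ z z' else 0 := sum_lower_eq G hG
  have hsA : ∀ z, s z = ∑ x, A z x := fun z => rfl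
  have hs' : ∀ z, s z = ∑ z', σ z z' := fun z => by
    rw [hsA]
    simp_rw [hA']
    rw [sum_comm]
    simp
  have hmid : ∀ x y, (∑ z : Finset α, if x ⋖ z ∧ z ⋖ y then G x y else 0) = π x y := by
    intro x y
    by_cases h : π x y = 0
    · simp [hGdef, h]
    · obtain ⟨h1, h2, -⟩ := hR x y h
      rw [← sum_filter, sum_const, card_midpoints h1 h2]
      simp [hGdef]; ring
  have hgA : ∀ x, ∑ y, π x y = ∑ z, A z x := fun x => by
    simp_rw [hA]
    rw [sum_comm]
    exact sum_congr rfl fun y _ => (hmid x y).symm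
  have hhB : ∀ y, ∑ x, π x y = ∑ z, B z y := fun y => by
    simp_rw [hB]
    rw [sum_comm]
    exact sum_congr rfl fun x _ => (hmid x y).symm
  have hσ0 : ∀ z z', σ z z' ≠ 0 → π (z ∩ z') (z ∪ z') ≠ 0 ∧ z ∩ z' ⋖ z ∧ z ⋖ z ∪ z' := by
    intro z z' h
    have h2 : #z = #z' := by by_contra h'; simp [hσ, h'] at h
    have h3 : π (z ∩ z') (z ∪ z') ≠ 0 := by
      intro h'; simp [hσ, hGdef, h'] at h
    obtain ⟨h4, h5, -⟩ := hR _ _ h3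
    have h6 := card_union_add_card_inter z z'
    refine ⟨h3, ?_, ?_⟩ <;> rw [covBy_iff_card]
    · exact ⟨inter_subset_left, by omega⟩
    · exact ⟨subset_union_left, by omega⟩
  refine false_of_mass_lt σ (fun z z' => z ∩ z') (fun z z' => z ∪ z') ?_ ?_
    (fun z z' => inter_comm _ _) (fun z z' => union_comm _ _) s A B
    (fun x => ∑ y, π x y) (fun y => ∑ x, π x y) hs' hA' hB' hgA hhB ?_ Z M hM hZ hsZ ?_ ?_ ?_
  · intro z z'
    simp only [hσ, hGdef]
    split_ifs
    · have := h0 (z ∩ z') (z ∪ z'); positivity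
    · exact le_rfl
  · intro z z'
    simp only [hσ, eq_comm (a := #z), inter_comm z, union_comm z]
  · intro z z' hzz
    obtain ⟨h1, h2, h3⟩ := hσ0 z z' hzz
    have hz : σ z z' = G (z ∩ z') (z ∪ z') := by
      simp only [hσ]; rw [if_pos]; by_contra h; simp [hσ, h] at hzz
    obtain ⟨-, -, hj⟩ := hR _ _ h1
    have hzj : #z = j := by rw [(covBy_iff_card.1 h2).2, hj]
    -- the exchange inequality used in both directions
    have key : ∀ x y, x ⋖ z → z ⋖ y → G (z ∩ z') (z ∪ z') * G x y
        = G (z ∩ z') y * G x (z ∪ z') := by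
      intro x y hx hy
      have a1 := covBy_iff_card.1 h2
      have a2 := covBy_iff_card.1 h3
      have a3 := covBy_iff_card.1 hx
      have a4 := covBy_iff_card.1 hy
      have r1 : (z ∩ z') ⊆ y ∧ #y = #(z ∩ z') + 2 ∧ #(z ∩ z') + 1 = j :=
        ⟨a1.1.trans a4.1, by omega, by omega⟩
      have r2 : x ⊆ (z ∪ z') ∧ #(z ∪ z') = #x + 2 ∧ #x + 1 = j :=
        ⟨a3.1.trans a2.1, by omega, by omega⟩
      have r3 : x ⊆ y ∧ #y = #x + 2 ∧ #x + 1 = j := ⟨a3.1.trans a4.1, by omega, by omega⟩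
      have r4 := hR _ _ h1
      have e1 := hex _ _ _ _ r1 r2
      have e2 := hex _ _ _ _ r4 r3
      have := le_antisymm e1 e2
      simp only [hGdef]
      linarith
    rw [hz]
    simp only [hs, hA, hB, mul_sum, sum_mul]
    refine sum_congr rfl fun x _ => sum_congr rfl fun y _ => ?_
    simp only [h2, h3, true_and, and_true]
    by_cases hx : x ⋖ z <;> by_cases hy : z ⋖ y <;> simp only [hx, hy, and_true, and_false,
      if_true, if_false, mul_zero, zero_mul]
    exact key x y hx hy
  · rw [← htot]
    simp_rw [hsA]
    rw [sum_comm]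
    exact sum_congr rfl fun x _ => (hgA x).symm
  · intro z z' h
    exact hg _ _ (hσ0 z z' h).1
  · intro z z' h
    exact hh _

end Midpoints

/-! ### Systems of chains as flows -/

section Flow

variable {α : Type*} [Fintype α]

/-- A fractional system of skipless chains of total weight at most `w` covering `F`: the vertex `x`
is used with weight `μ x`, the covering pair `x ⋖ y` with weight `f x y`.  At a vertex, chains may
start (`in < μ`) or end (`out < μ`), so the total number of chains is `∑ μ - ∑ ∑ f`.  Vertices may
be used with weight larger than one. -/
structure IsFlow (F : Finset (Finset α)) (w : ℝ) (μ : Finset α → ℝ)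
    (f : Finset α → Finset α → ℝ) : Prop where
  nonneg : ∀ x y, 0 ≤ f x y
  supp : ∀ x y, f x y ≠ 0 → x ⋖ y
  out_le : ∀ x, ∑ y, f x y ≤ μ x
  in_le : ∀ y, ∑ x, f x y ≤ μ y
  one_le : ∀ a ∈ F, 1 ≤ μ a
  value_le : ∑ x, μ x - ∑ x, ∑ y, f x y ≤ w

variable {F : Finset (Finset α)} {w : ℝ} {μ : Finset α → ℝ} {f : Finset α → Finset α → ℝ}

lemma IsFlow.mass_nonneg (h : IsFlow F w μ f) (x : Finset α) : 0 ≤ μ x :=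
  (sum_nonneg fun y _ => h.nonneg x y).trans (h.out_le x)

variable [DecidableEq α]

lemma sum_compl_eq (g : Finset α → ℝ) : ∑ x : Finset α, g xᶜ = ∑ x, g x :=
  Equiv.sum_comp (compl_involutive (α := Finset α)).toPerm g

/-- Complementation reverses a flow. -/
lemma IsFlow.compl (h : IsFlow F w μ f) :
    IsFlow (F.image (·ᶜ)) w (fun x => μ xᶜ) (fun x y => f yᶜ xᶜ) where
  nonneg x y := h.nonneg _ _
  supp x y hxy := by
    have h1 := covBy_iff_card.1 (h.supp _ _ hxy)
    rw [card_compl, card_compl] at h1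
    have h2 := card_le_univ x
    have h3 := card_le_univ y
    have h4 := compl_subset_compl.1 h1.1
    have h5 := card_le_card h4
    exact covBy_iff_card.2 ⟨h4, by omega⟩
  out_le x := by rw [sum_compl_eq fun y => f y xᶜ]; exact h.in_le _
  in_le y := by rw [sum_compl_eq fun x => f yᶜ x]; exact h.out_le _
  one_le a ha := by
    obtain ⟨b, hb, rfl⟩ := mem_image.1 ha
    simpa using h.one_le b hb
  value_le := by
    rw [sum_compl_eq μ]
    have : ∑ x : Finset α, ∑ y : Finset α, f yᶜ xᶜ = ∑ x, ∑ y, f x y := by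
      rw [sum_compl_eq fun x => ∑ y : Finset α, f yᶜ x, sum_comm, sum_compl_eq fun y => ∑ x, f y x]
    rw [this]
    exact h.value_le

/-- By compactness there is a flow with the least sum of squares of the vertex weights. -/
lemma IsFlow.exists_min (h : IsFlow F w μ f) :
    ∃ μ' f', IsFlow F w μ' f' ∧
      ∀ μ'' f'', IsFlow F w μ'' f'' → ∑ x, μ' x ^ 2 ≤ ∑ x, μ'' x ^ 2 := by
  set S := ∑ x, μ x ^ 2 with hS
  set K : Set ((Finset α → ℝ) × (Finset α → Finset α → ℝ)) :=
    {p | IsFlow F w p.1 p.2 ∧ ∑ x, p.1 x ^ 2 ≤ S} with hK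
  have hclosed : IsClosed K := by
    have e : K = (⋂ x, ⋂ y, {p | 0 ≤ p.2 x y}) ∩ ((⋂ x, ⋂ y, {p | ¬ x ⋖ y → p.2 x y = 0}) ∩
        ((⋂ x, {p | ∑ y, p.2 x y ≤ p.1 x}) ∩ ((⋂ y, {p | ∑ x, p.2 x y ≤ p.1 y}) ∩
        ((⋂ a ∈ F, {p | 1 ≤ p.1 a}) ∩ ({p | ∑ x, p.1 x - ∑ x, ∑ y, p.2 x y ≤ w} ∩
          {p | ∑ x, p.1 x ^ 2 ≤ S}))))) := by
      ext p
      simp only [hK, Set.mem_ofPred_eq, Set.mem_inter_iff, Set.mem_iInter]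
      constructor
      · rintro ⟨⟨h1, h2, h3, h4, h5, h6⟩, h7⟩
        exact ⟨h1, fun x y hxy => by_contra fun h' => hxy (h2 x y h'), h3, h4, h5, h6, h7⟩
      · rintro ⟨h1, h2, h3, h4, h5, h6, h7⟩
        exact ⟨⟨h1, fun x y hxy => by_contra fun h' => hxy (h2 x y h'), h3, h4, h5, h6⟩, h7⟩
    rw [e]
    refine (isClosed_iInter fun x => isClosed_iInter fun y => ?_).inter
      ((isClosed_iInter fun x => isClosed_iInter fun y => ?_).inter
      ((isClosed_iInter fun x => ?_).inter ((isClosed_iInter fun y => ?_).inter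
      ((isClosed_biInter fun a _ => ?_).inter (IsClosed.inter ?_ ?_)))))
    · exact isClosed_le (by fun_prop) (by fun_prop)
    · by_cases hxy : x ⋖ y
      · simp [hxy]
      · simp only [hxy, not_false_eq_true, forall_const]
        exact isClosed_eq (by fun_prop) (by fun_prop)
    all_goals exact isClosed_le (by fun_prop) (by fun_prop)
  have hcomp : IsCompact K := by
    refine (isCompact_Icc (a := (0 : (Finset α → ℝ) × (Finset α → Finset α → ℝ)))
      (b := (fun _ => 1 + S, fun _ _ => 1 + S))).of_isClosed_subset hclosed ?_
    rintro ⟨p, q⟩ ⟨hp, hp2⟩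
    have hbound : ∀ x, p x ≤ 1 + S := by
      intro x
      have h1 : p x ^ 2 ≤ S := (single_le_sum (f := fun x => p x ^ 2)
        (fun x _ => sq_nonneg _) (mem_univ x)).trans hp2
      nlinarith [sq_nonneg (p x - 1), sq_nonneg (p x)]
    refine ⟨⟨fun x => hp.mass_nonneg x, fun x y => hp.nonneg x y⟩, fun x => hbound x, fun x y => ?_⟩
    refine le_trans ?_ (hbound x)
    exact (single_le_sum (f := fun y => q x y) (fun y _ => hp.nonneg x y) (mem_univ y)).trans
      (hp.out_le x)
  obtain ⟨⟨p, q⟩, ⟨hp, hp2⟩, hmin⟩ := hcomp.exists_isMinOn ⟨(μ, f), h, le_rfl⟩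
    (f := fun p => ∑ x, p.1 x ^ 2) (Continuous.continuousOn (by fun_prop))
  refine ⟨p, q, hp, fun μ'' f'' h'' => ?_⟩
  rcases le_total (∑ x, μ'' x ^ 2) S with hle | hle
  · exact hmin (a := (μ'', f'')) ⟨h'', hle⟩
  · exact hp2.trans hle

/-- In a flow with the least sum of squares no chain starts at a vertex of weight above one:
the part of such a chain inside that vertex could be cut off. -/
lemma IsFlow.in_eq_of_min (h : IsFlow F w μ f)
    (hmin : ∀ μ' f', IsFlow F w μ' f' → ∑ x, μ x ^ 2 ≤ ∑ x, μ' x ^ 2) {z : Finset α}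
    (hz : 1 < μ z) : ∑ x, f x z = μ z := by
  refine le_antisymm (h.in_le z) ?_
  by_contra! hlt
  set ε := min (μ z - ∑ x, f x z) (μ z - 1) with hε
  have hε0 : 0 < ε := lt_min (by linarith) (by linarith)
  have hε1 : ε ≤ μ z - ∑ x, f x z := min_le_left _ _
  have hε2 : ε ≤ μ z - 1 := min_le_right _ _
  have hz0 : 0 < μ z := by linarith
  set θ := ε / μ z with hθ
  have hθ0 : 0 ≤ θ := by positivity
  have hθ1 : θ ≤ 1 := by rw [hθ, div_le_one hz0]; linarith
  have hθz : θ * μ z = ε := by rw [hθ]; field_simp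
  set μ' : Finset α → ℝ := fun x => μ x - if x = z then ε else 0 with hμ'
  set f' : Finset α → Finset α → ℝ := fun x y => f x y - if x = z then θ * f x y else 0 with hf'
  have hf'le : ∀ x y, f' x y ≤ f x y := fun x y => by
    simp only [hf']
    split_ifs
    · linarith [mul_nonneg hθ0 (h.nonneg x y)]
    · linarith
  have hout : ∑ y, f z y ≤ μ z := h.out_le z
  have hsumf : ∑ x, ∑ y, f' x y = ∑ x, ∑ y, f x y - θ * ∑ y, f z y := by
    simp only [hf', sum_sub_distrib]
    congr 1
    rw [sum_eq_single z (fun x _ hx => by simp [hx]) (by simp), mul_sum]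
    simp
  have hflow : IsFlow F w μ' f' := by
    refine ⟨fun x y => ?_, fun x y hxy => ?_, fun x => ?_, fun y => ?_, fun a ha => ?_, ?_⟩
    · simp only [hf']
      split_ifs
      · nlinarith [h.nonneg x y]
      · simpa using h.nonneg x y
    · refine h.supp x y fun h0 => hxy ?_
      simp [hf', h0]
    · by_cases hx : x = z
      · subst hx
        simp only [hf', hμ', if_true, sum_sub_distrib, ← mul_sum]
        nlinarith
      · simpa [hf', hμ', hx] using h.out_le x
    · by_cases hy : y = z
      · subst hy
        refine (sum_le_sum fun x _ => hf'le x y).trans ?_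
        simp only [hμ', if_true]
        linarith
      · refine (sum_le_sum fun x _ => hf'le x y).trans ?_
        simpa [hμ', hy] using h.in_le y
    · by_cases hy : a = z
      · subst hy; simp only [hμ', if_true]; linarith
      · simpa [hμ', hy] using h.one_le a ha
    · rw [hsumf]
      simp only [hμ', sum_sub_distrib, sum_ite_eq', mem_univ, if_true]
      have := h.value_le
      have : θ * ∑ y, f z y ≤ ε := by rw [← hθz]; exact mul_le_mul_of_nonneg_left hout hθ0
      linarith
  have h1 := hmin μ' f' hflow
  have h2 : ∑ x, μ' x ^ 2 < ∑ x, μ x ^ 2 := by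
    refine sum_lt_sum (fun x _ => ?_) ⟨z, mem_univ _, ?_⟩
    · by_cases hx : x = z
      · subst hx; simp only [hμ', if_true]; nlinarith
      · simp [hμ', hx]
    · simp only [hμ', if_true]; nlinarith
  linarith

/-- Dually, no chain ends at a vertex of weight above one. -/
lemma IsFlow.out_eq_of_min (h : IsFlow F w μ f)
    (hmin : ∀ μ' f', IsFlow F w μ' f' → ∑ x, μ x ^ 2 ≤ ∑ x, μ' x ^ 2) {z : Finset α}
    (hz : 1 < μ z) : ∑ x, f z x = μ z := by
  have hmin' : ∀ μ' f', IsFlow (F.image (·ᶜ)) w μ' f' →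
      ∑ x : Finset α, μ xᶜ ^ 2 ≤ ∑ x, μ' x ^ 2 := by
    intro μ' f' h'
    have h2 := h'.compl
    rw [image_image, (compl_involutive (α := Finset α)).comp_self, image_id] at h2
    have h3 := hmin _ _ h2
    rwa [sum_compl_eq fun x => μ' x ^ 2, ← sum_compl_eq fun x => μ x ^ 2] at h3
  have := h.compl.in_eq_of_min hmin' (z := zᶜ) (by simpa using hz)
  simpa [sum_compl_eq fun x => f z x] using this

/-- **Balanced flows.**  Fractional chain covers can be rerouted so that no vertex has weight above
one.  In a flow with the least sum of squares, moving half of the mass at the heaviest vertices to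
the other midpoints does not help, so these are heavy as well; by concavity of entropy the vertices
of the level below cannot then all be lighter. -/
theorem IsFlow.exists_le_one (h₀ : IsFlow F w μ f) :
    ∃ μ' f', IsFlow F w μ' f' ∧ ∀ x, μ' x ≤ 1 := by
  obtain ⟨μ, f, h, hmin⟩ := h₀.exists_min
  refine ⟨μ, f, h, ?_⟩
  by_contra! hbig
  obtain ⟨z₀, hz₀⟩ := hbig
  obtain ⟨z₁, hz₁⟩ := Finite.exists_max μ
  set M := μ z₁ with hM
  have hM1 : 1 < M := hz₀.trans_le (hz₁ z₀)
  have hM0 : 0 < M := by linarith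
  -- the lowest level on which the maximum is attained
  obtain ⟨z₂, hz₂, hz₂min⟩ := exists_min_image ({z | μ z = M} : Finset (Finset α)) card
    ⟨z₁, by simp [hM]⟩
  simp only [mem_filter, mem_univ, true_and] at hz₂ hz₂min
  set j := #z₂ with hj
  set Z : Finset (Finset α) := {z | #z = j ∧ μ z = M} with hZ
  have memZ : ∀ {z}, z ∈ Z ↔ #z = j ∧ μ z = M := by simp [hZ]
  have hZne : Z.Nonempty := ⟨z₂, memZ.2 ⟨rfl, hz₂⟩⟩
  have hin : ∀ z ∈ Z, ∑ x, f x z = M := fun z hz => by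
    rw [← (memZ.1 hz).2]
    exact h.in_eq_of_min hmin (by rw [(memZ.1 hz).2]; exact hM1)
  have hout : ∀ z ∈ Z, ∑ y, f z y = M := fun z hz => by
    rw [← (memZ.1 hz).2]
    exact h.out_eq_of_min hmin (by rw [(memZ.1 hz).2]; exact hM1)
  -- the coupling of lower and upper ends of the flow through `Z`
  set π₀ : Finset α → Finset α → ℝ := fun x y => ∑ z ∈ Z, f x z * f z y / M with hπ₀
  set R : Finset α → Finset α → Prop := fun x y => x ⊆ y ∧ #y = #x + 2 ∧ #x + 1 = j with hRdef
  have hπ₀0 : ∀ x y, 0 ≤ π₀ x y := fun x y => sum_nonneg fun z _ =>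
    div_nonneg (mul_nonneg (h.nonneg _ _) (h.nonneg _ _)) hM0.le
  have hπ₀R : ∀ x y, π₀ x y ≠ 0 → R x y := by
    intro x y hxy
    obtain ⟨z, hz, hne⟩ := exists_ne_zero_of_sum_ne_zero hxy
    have h1 := covBy_iff_card.1 (h.supp x z fun h' => hne (by simp [h']))
    have h2 := covBy_iff_card.1 (h.supp z y fun h' => hne (by simp [h']))
    have h3 := (memZ.1 hz).1
    exact ⟨h1.1.trans h2.1, by omega, by omega⟩
  have hrow : ∀ x, ∑ y, π₀ x y = ∑ z ∈ Z, f x z := fun x => by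
    simp only [hπ₀]
    rw [sum_comm]
    refine sum_congr rfl fun z hz => ?_
    rw [← sum_div, ← mul_sum, hout z hz, mul_div_cancel_right₀ _ hM0.ne']
  have hcol : ∀ y, ∑ x, π₀ x y = ∑ z ∈ Z, f z y := fun y => by
    simp only [hπ₀]
    rw [sum_comm]
    refine sum_congr rfl fun z hz => ?_
    rw [← sum_div, ← sum_mul, hin z hz, mul_div_cancel_left₀ _ hM0.ne']
  obtain ⟨π, hπ0, hπR, hπr, hπc, hπex⟩ := exists_coupling R π₀ hπ₀0 hπ₀R
  have hrow' : ∀ x, ∑ y, π x y = ∑ z ∈ Z, f x z := fun x => (hπr x).trans (hrow x)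
  have hcol' : ∀ y, ∑ x, π x y = ∑ z ∈ Z, f z y := fun y => (hπc y).trans (hcol y)
  have htot : ∑ x, ∑ y, π x y = M * #Z := by
    simp_rw [hrow']
    rw [sum_comm, sum_congr rfl hin, sum_const, nsmul_eq_mul, mul_comm]
  set A : Finset α → Finset α → ℝ :=
    fun v u => ∑ y, if u ⋖ v ∧ v ⋖ y then π u y / 2 else 0 with hA
  set B : Finset α → Finset α → ℝ :=
    fun u v => ∑ x, if x ⋖ u ∧ u ⋖ v then π x v / 2 else 0 with hB
  set s : Finset α → ℝ := fun u => ∑ x, ∑ y, if x ⋖ u ∧ u ⋖ y then π x y / 2 else 0 with hs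
  have hite0 : ∀ x u y, 0 ≤ if x ⋖ u ∧ u ⋖ y then π x y / 2 else 0 := fun x u y => by
    split_ifs
    · have := hπ0 x y; positivity
    · exact le_rfl
  have hA0 : ∀ v u, 0 ≤ A v u := fun v u => sum_nonneg fun y _ => hite0 _ _ _
  have hB0 : ∀ v u, 0 ≤ B v u := fun v u => sum_nonneg fun y _ => hite0 _ _ _
  have hs0 : ∀ u, 0 ≤ s u := fun u => sum_nonneg fun x _ => sum_nonneg fun y _ => hite0 _ _ _
  have hmid : ∀ x y, (∑ z : Finset α, if x ⋖ z ∧ z ⋖ y then π x y / 2 else 0) = π x y := by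
    intro x y
    by_cases hxy : π x y = 0
    · simp [hxy]
    · obtain ⟨h1, h2, -⟩ := hπR x y hxy
      rw [← sum_filter, sum_const, card_midpoints h1 h2]
      simp; ring
  have hAout : ∀ u, ∑ v, A v u = ∑ z ∈ Z, f u z := fun u => by
    simp only [hA]
    rw [sum_comm, ← hrow' u]
    exact sum_congr rfl fun y _ => hmid u y
  have hBin : ∀ v, ∑ u, B u v = ∑ z ∈ Z, f z v := fun v => by
    simp only [hB]
    rw [sum_comm, ← hcol' v]
    exact sum_congr rfl fun x _ => hmid x v
  have hAin : ∀ v, ∑ u, A v u = s v := fun v => rfl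
  have hBout : ∀ u, ∑ v, B u v = s u := fun u => by
    simp only [hB, hs]
    rw [sum_comm]
  have hstot : ∑ u, s u = M * #Z := by
    simp_rw [← hAin]
    rw [sum_comm, ← htot]
    simp_rw [hAout, hrow']
  -- the direction of rerouting
  set δ : Finset α → Finset α → ℝ := fun u v =>
    A v u - (if v ∈ Z then f u v else 0) + (B u v - if u ∈ Z then f u v else 0) with hδ
  set δμ : Finset α → ℝ := fun u => s u - if u ∈ Z then M else 0 with hδμ
  have hδout : ∀ u, ∑ v, δ u v = δμ u := fun u => by
    simp only [hδ, hδμ, sum_add_distrib, sum_sub_distrib, hAout, hBout, sum_ite_mem, univ_inter]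
    by_cases hu : u ∈ Z
    · simp [hu, hout u hu]
    · simp [hu]
  have hδin : ∀ v, ∑ u, δ u v = δμ v := fun v => by
    simp only [hδ, hδμ, sum_add_distrib, sum_sub_distrib, hAin, hBin, sum_ite_mem, univ_inter]
    by_cases hv : v ∈ Z
    · simp [hv, hin v hv]
    · simp [hv]
  have hflow : ∀ ε : ℝ, 0 ≤ ε → M * ε ≤ M - 1 →
      IsFlow F w (fun u => μ u + ε * δμ u) (fun u v => f u v + ε * δ u v) := by
    intro ε hε hεM
    have hε1 : ε ≤ 1 := by
      by_contra! hcon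
      nlinarith
    refine ⟨fun u v => ?_, fun u v huv => ?_, fun u => ?_, fun v => ?_, fun a ha => ?_, ?_⟩
    · have h1 : 0 ≤ ε * (A v u + B u v) := mul_nonneg hε (add_nonneg (hA0 _ _) (hB0 _ _))
      have h2 : (if v ∈ Z then f u v else 0) + (if u ∈ Z then f u v else 0) ≤ f u v := by
        by_cases hf0 : f u v = 0
        · simp [hf0]
        · have := covBy_iff_card.1 (h.supp u v hf0)
          have := h.nonneg u v
          by_cases hu : u ∈ Z
          · have hv : v ∉ Z := fun hv => by
              have := (memZ.1 hu).1
              have := (memZ.1 hv).1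
              omega
            simp [hu, hv]
          · by_cases hv : v ∈ Z <;> simp [hu, hv, this]
      have h3 : ε * ((if v ∈ Z then f u v else 0) + (if u ∈ Z then f u v else 0)) ≤ f u v :=
        (mul_le_mul_of_nonneg_left h2 hε).trans (mul_le_of_le_one_left (h.nonneg _ _) hε1)
      simp only [hδ]
      linarith
    · by_contra hcov
      have hf0 : f u v = 0 := by_contra fun h' => hcov (h.supp u v h')
      refine huv ?_
      simp [hδ, hA, hB, hf0, hcov]
    · rw [sum_add_distrib, ← mul_sum, hδout]
      linarith [h.out_le u]
    · rw [sum_add_distrib, ← mul_sum, hδin]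
      linarith [h.in_le v]
    · have h1 := h.one_le a ha
      have h2 : 0 ≤ ε * s a := mul_nonneg hε (hs0 a)
      by_cases haZ : a ∈ Z
      · simp only [hδμ, haZ, if_true, (memZ.1 haZ).2]
        linarith
      · simp only [hδμ, haZ, if_false]
        linarith
    · simp_rw [sum_add_distrib, ← mul_sum, hδout]
      linarith [h.value_le]
  -- first order optimality
  have hopt : 0 ≤ ∑ u, μ u * δμ u := by
    by_contra! hneg
    set P := ∑ u, μ u * δμ u with hP
    set Q := ∑ u, δμ u ^ 2 with hQ
    have hQ0 : 0 ≤ Q := sum_nonneg fun u _ => sq_nonneg _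
    set ε := min ((M - 1) / M) (-P / (Q + 1)) with hε
    have hε0 : 0 < ε := lt_min (div_pos (by linarith) hM0) (div_pos (by linarith) (by linarith))
    have h1 : M * ε ≤ M - 1 := by
      have : ε ≤ (M - 1) / M := min_le_left _ _
      rw [le_div_iff₀ hM0] at this
      linarith
    have h2 : ε * (Q + 1) ≤ -P := by
      have : ε ≤ -P / (Q + 1) := min_le_right _ _
      rwa [le_div_iff₀ (by linarith)] at this
    have h3 := hmin _ _ (hflow ε hε0.le h1)
    have h4 : ∑ u, (μ u + ε * δμ u) ^ 2 = ∑ u, μ u ^ 2 + ε * (2 * P + ε * Q) := by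
      simp only [hP, hQ, mul_sum, ← sum_add_distrib]
      exact sum_congr rfl fun u _ => by ring
    rw [h4] at h3
    have h5 : 0 ≤ ε * (2 * P + ε * Q) := by linarith
    have h6 := nonneg_of_mul_nonneg_right h5 hε0
    nlinarith
  -- hence the rerouted paths again meet only vertices of maximal weight
  have hsZ : ∀ u, s u ≠ 0 → u ∈ Z := by
    have h1 : ∑ u, μ u * δμ u = ∑ u, (μ u - M) * s u := by
      simp only [hδμ, mul_sub, sub_mul, sum_sub_distrib, ← mul_sum, hstot]
      congr 1
      simp only [mul_ite, mul_zero, sum_ite_mem, univ_inter]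
      rw [sum_congr rfl fun z hz => by rw [(memZ.1 hz).2], sum_const, nsmul_eq_mul]
      ring
    rw [h1] at hopt
    have h2 : ∀ u ∈ univ, (μ u - M) * s u ≤ 0 := fun u _ =>
      mul_nonpos_of_nonpos_of_nonneg (by linarith [hz₁ u]) (hs0 u)
    have h3 := (sum_eq_zero_iff_of_nonpos h2).1 (le_antisymm (sum_nonpos h2) hopt)
    intro u hu
    have h4 := h3 u (mem_univ u)
    have h5 : μ u = M := by
      rcases mul_eq_zero.1 h4 with h5 | h5
      · linarith
      · exact absurd h5 hu
    refine memZ.2 ⟨?_, h5⟩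
    obtain ⟨x, -, hx⟩ := exists_ne_zero_of_sum_ne_zero hu
    obtain ⟨y, -, hy⟩ := exists_ne_zero_of_sum_ne_zero hx
    have hxy : x ⋖ u ∧ u ⋖ y := by by_contra h'; simp [h'] at hy
    have hπ : π x y ≠ 0 := fun h' => by simp [h'] at hy
    have := (hπR x y hπ).2.2
    have := (covBy_iff_card.1 hxy.1).2
    omega
  refine false_of_coupling π hπ0 j hπR hπex Z M hM0 hZne hsZ htot ?_ ?_
  · intro x y hxy
    rw [hrow' x]
    have h1 : ∑ z ∈ Z, f x z ≤ μ x :=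
      (sum_le_sum_of_subset_of_nonneg (subset_univ _) fun z _ _ => h.nonneg x z).trans (h.out_le x)
    refine h1.trans_lt (lt_of_le_of_ne (hz₁ x) fun hx => ?_)
    have := hz₂min x hx
    have := (hπR x y hxy).2.2
    omega
  · intro y
    rw [hcol' y]
    exact ((sum_le_sum_of_subset_of_nonneg (subset_univ _) fun z _ _ => h.nonneg z y).trans
      (h.in_le y)).trans (hz₁ y)

end Flow

/-! ### Dilworth's theorem and the existence of flows -/

/-- **Dilworth's theorem** (Galvin's proof): if every antichain in `P` has at most `w` elements,
then `P` is coloured with `w` colours so that each colour class is a chain. -/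
theorem exists_chain_coloring {β : Type*} [PartialOrder β] [DecidableEq β] (P : Finset β) (w : ℕ)
    (h : ∀ A ⊆ P, IsAntichain (· ≤ ·) (A : Set β) → #A ≤ w) :
    ∃ c : β → ℕ, (∀ x ∈ P, c x < w) ∧ ∀ x ∈ P, ∀ y ∈ P, c x = c y → x ≤ y ∨ y ≤ x := by
  induction hn : #P using Nat.strong_induction_on generalizing P w with
  | _ n ih =>
  subst hn
  rcases P.eq_empty_or_nonempty with rfl | hne
  · exact ⟨fun _ => 0, by simp, by simp⟩
  obtain ⟨a, ha⟩ := P.exists_maximal hne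
  have haP : a ∈ P := ha.prop
  have hw : 1 ≤ w := by
    have := h {a} (singleton_subset_iff.2 haP) (by simp)
    simpa using this
  have hPa : #(P.erase a) < #P := card_erase_lt_of_mem haP
  by_cases hbig : ∃ A ⊆ P.erase a, IsAntichain (· ≤ ·) (A : Set β) ∧ #A = w
  · obtain ⟨A₀, hA₀, hA₀anti, hA₀c⟩ := hbig
    obtain ⟨c, hc, hchain⟩ := ih _ hPa (P.erase a) w
      (fun A hA hanti => h A (hA.trans (erase_subset _ _)) hanti) rfl
    -- an antichain of size `w` meets every colour class
    have hmeet : ∀ A ⊆ P.erase a, IsAntichain (· ≤ ·) (A : Set β) → #A = w →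
        ∀ i < w, ∃ y ∈ A, c y = i := by
      intro A hA hanti hAc i hi
      have hinj : Set.InjOn c (A : Set β) := by
        intro x hx y hy hxy
        rcases hchain x (hA hx) y (hA hy) hxy with h1 | h1
        · exact hanti.eq hx hy h1
        · exact (hanti.eq hy hx h1).symm
      have himg : A.image c = range w := by
        refine eq_of_subset_of_card_le (fun j hj => ?_) ?_
        · obtain ⟨y, hy, rfl⟩ := mem_image.1 hj
          exact mem_range.2 (hc y (hA hy))
        · rw [card_image_of_injOn hinj, hAc, card_range]
      have : i ∈ A.image c := by rw [himg]; exact mem_range.2 hi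
      simpa using this
    have hx : ∀ i, ∃ x, i < w → (x ∈ P.erase a ∧ c x = i ∧
        (∃ A ⊆ P.erase a, IsAntichain (· ≤ ·) (A : Set β) ∧ #A = w ∧ x ∈ A) ∧
        ∀ A ⊆ P.erase a, IsAntichain (· ≤ ·) (A : Set β) → #A = w → ∀ y ∈ A, c y = i → y ≤ x) := by
      intro i
      by_cases hi : i < w
      · classical
        set S : Finset β := {x ∈ P.erase a | c x = i ∧
          ∃ A ⊆ P.erase a, IsAntichain (· ≤ ·) (A : Set β) ∧ #A = w ∧ x ∈ A} with hS
        obtain ⟨y₀, hy₀, hy₀i⟩ := hmeet A₀ hA₀ hA₀anti hA₀c i hi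
        obtain ⟨x, hxS⟩ := S.exists_maximal
          ⟨y₀, mem_filter.2 ⟨hA₀ hy₀, hy₀i, A₀, hA₀, hA₀anti, hA₀c, hy₀⟩⟩
        obtain ⟨h1, h2, h3⟩ := mem_filter.1 hxS.prop
        refine ⟨x, fun _ => ⟨h1, h2, h3, fun A hA hanti hAc y hy hyi => ?_⟩⟩
        rcases hchain x h1 y (hA hy) (h2.trans hyi.symm) with h4 | h4
        · exact hxS.le_of_ge (mem_filter.2 ⟨hA hy, hyi, A, hA, hanti, hAc, hy⟩) h4
        · exact h4
      · exact ⟨a, fun h' => absurd h' hi⟩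
    -- `x i` is the largest vertex of colour `i` that lies in an antichain of size `w`
    choose x hx using hx
    have hxanti : ∀ i < w, ∀ j < w, x i ≤ x j → i = j := by
      intro i hi j hj hle
      obtain ⟨-, hcj, ⟨A, hA, hanti, hAc, hxA⟩, -⟩ := hx j hj
      obtain ⟨y, hy, hyi⟩ := hmeet A hA hanti hAc i hi
      have h1 := (hx i hi).2.2.2 A hA hanti hAc y hy hyi
      have h2 := hanti.eq hy hxA (h1.trans hle)
      rw [← hyi, h2, hcj]
    obtain ⟨i, hi, hia⟩ : ∃ i < w, x i ≤ a := by
      by_contra! hcon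
      have hxinj : Set.InjOn x (range w : Finset ℕ) := fun i hi j hj hij =>
        hxanti i (by simpa using hi) j (by simpa using hj) hij.le
      have hanti : IsAntichain (· ≤ ·) ((insert a ((range w).image x) : Finset β) : Set β) := by
        rw [coe_insert, isAntichain_insert]
        constructor
        · intro u hu v hv huv hle
          obtain ⟨i, hi, rfl⟩ := mem_image.1 (mem_coe.1 hu)
          obtain ⟨j, hj, rfl⟩ := mem_image.1 (mem_coe.1 hv)
          exact huv (congrArg x (hxanti i (mem_range.1 hi) j (mem_range.1 hj) hle))
        · intro u hu hau
          obtain ⟨i, hi, rfl⟩ := mem_image.1 (mem_coe.1 hu)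
          have hi' := mem_range.1 hi
          refine ⟨fun hle => ?_, hcon i hi'⟩
          have hxP := mem_of_mem_erase (hx i hi').1
          exact hcon i hi' (ha.le_of_ge hxP hle)
      have h1 := h _ (insert_subset haP (image_subset_iff.2 fun i hi =>
        mem_of_mem_erase (hx i (mem_range.1 hi)).1)) hanti
      rw [card_insert_of_notMem, card_image_of_injOn hxinj, card_range] at h1
      · omega
      · intro hmem
        obtain ⟨i, hi, hia⟩ := mem_image.1 hmem
        exact (mem_erase.1 (hx i (mem_range.1 hi)).1).1 hia
    classical
    -- the chain `K` meets every antichain of size `w`, so it can be split off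
    set K : Finset β := {z ∈ P | z = a ∨ (c z = i ∧ z ≤ x i)} with hK
    have haK : a ∈ K := by simp [hK, haP]
    obtain ⟨c', hc', hchain'⟩ := ih #(P \ K)
      (card_lt_card ⟨sdiff_subset, fun hsub => (mem_sdiff.1 (hsub haP)).2 haK⟩) (P \ K) (w - 1)
      (fun A hA hanti => by
        by_contra! hlt
        obtain ⟨A', hA', hA'c⟩ := exists_subset_card_eq (show w ≤ #A by omega)
        have hA'P : A' ⊆ P.erase a := fun z hz => by
          have := mem_sdiff.1 (hA (hA' hz))
          exact mem_erase.2 ⟨fun h' => this.2 (h' ▸ haK), this.1⟩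
        have hanti' : IsAntichain (· ≤ ·) (A' : Set β) := hanti.subset (by exact_mod_cast hA')
        obtain ⟨y, hy, hyi⟩ := hmeet A' hA'P hanti' hA'c i hi
        have h1 := (hx i hi).2.2.2 A' hA'P hanti' hA'c y hy hyi
        have h2 := mem_sdiff.1 (hA (hA' hy))
        exact h2.2 (mem_filter.2 ⟨h2.1, Or.inr ⟨hyi, h1⟩⟩)) rfl
    refine ⟨fun z => if z ∈ K then w - 1 else c' z, fun z hz => ?_, fun y hy z hz hyz => ?_⟩
    · dsimp only
      split_ifs with hzK
      · omega
      · have := hc' z (mem_sdiff.2 ⟨hz, hzK⟩)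
        omega
    · dsimp only at hyz
      by_cases hyK : y ∈ K <;> by_cases hzK : z ∈ K
      · have h1 := (mem_filter.1 hyK).2
        have h2 := (mem_filter.1 hzK).2
        rcases h1 with rfl | ⟨h1, h1'⟩ <;> rcases h2 with rfl | ⟨h2, h2'⟩
        · exact Or.inl le_rfl
        · exact Or.inr (h2'.trans hia)
        · exact Or.inl (h1'.trans hia)
        · by_cases hya : y = a
          · subst hya; exact Or.inr (h2'.trans hia)
          · by_cases hza : z = a
            · subst hza; exact Or.inl (h1'.trans hia)
            · exact hchain y (mem_erase.2 ⟨hya, hy⟩) z (mem_erase.2 ⟨hza, hz⟩) (h1.trans h2.symm)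
      · have := hc' z (mem_sdiff.2 ⟨hz, hzK⟩)
        simp only [hyK, hzK, if_true, if_false] at hyz
        omega
      · have := hc' y (mem_sdiff.2 ⟨hy, hyK⟩)
        simp only [hyK, hzK, if_true, if_false] at hyz
        omega
      · simp only [hyK, hzK, if_false] at hyz
        exact hchain' y (mem_sdiff.2 ⟨hy, hyK⟩) z (mem_sdiff.2 ⟨hz, hzK⟩) hyz
  · obtain ⟨c, hc, hchain⟩ := ih _ hPa (P.erase a) (w - 1) (fun A hA hanti => by
      have h1 := h A (hA.trans (erase_subset _ _)) hanti
      have h2 : #A ≠ w := fun h' => hbig ⟨A, hA, hanti, h'⟩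
      omega) rfl
    refine ⟨fun z => if z = a then w - 1 else c z, fun z hz => ?_, fun y hy z hz hyz => ?_⟩
    · dsimp only
      split_ifs with hza
      · omega
      · have := hc z (mem_erase.2 ⟨hza, hz⟩)
        omega
    · dsimp only at hyz
      by_cases hya : y = a <;> by_cases hza : z = a
      · exact Or.inl (hya.trans hza.symm).le
      · have := hc z (mem_erase.2 ⟨hza, hz⟩)
        simp only [hya, hza, if_true, if_false] at hyz
        omega
      · have := hc y (mem_erase.2 ⟨hya, hy⟩)
        simp only [hya, hza, if_true, if_false] at hyz
        omega
      · simp only [hya, hza, if_false] at hyz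
        exact hchain y (mem_erase.2 ⟨hya, hy⟩) z (mem_erase.2 ⟨hza, hz⟩) hyz

section Existence

variable {α : Type*} [Fintype α]

lemma isFlow_empty : IsFlow (∅ : Finset (Finset α)) 0 (fun _ => 0) (fun _ _ => 0) := by
  constructor <;> simp

variable [DecidableEq α]

/-- A chain of subsets extends to a maximal chain, listed by cardinality. -/
lemma exists_maximal_chain (C : Finset (Finset α))
    (hC : ∀ x ∈ C, ∀ y ∈ C, x ⊆ y ∨ y ⊆ x) :
    ∃ s : ℕ → Finset α, (∀ t ≤ Fintype.card α, #(s t) = t) ∧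
      (∀ t < Fintype.card α, s t ⊆ s (t + 1)) ∧ ∀ x ∈ C, s #x = x := by
  set Good : Finset α → Prop := fun u => ∀ x ∈ C, x ⊆ u ∨ u ⊆ x with hGood
  have hstep : ∀ u, ∃ v, Good u → #u < Fintype.card α → Good v ∧ u ⊆ v ∧ #v = #u + 1 := by
    intro u
    by_cases hu : Good u ∧ #u < Fintype.card α
    · obtain ⟨hu, hcard⟩ := hu
      -- a new element inside the least member of `C` that strictly contains `u`
      obtain ⟨e, heu, he⟩ : ∃ e ∉ u, ∀ x ∈ C, u ⊂ x → e ∈ x := by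
        rcases ({x ∈ C | u ⊂ x} : Finset (Finset α)).eq_empty_or_nonempty with h0 | hne
        · obtain ⟨e, he⟩ : ∃ e, e ∉ u := by
            by_contra! hcon
            rw [eq_univ_iff_forall.2 hcon, card_univ] at hcard
            exact hcard.false
          refine ⟨e, he, fun x hx hux => ?_⟩
          have : x ∈ ({x ∈ C | u ⊂ x} : Finset (Finset α)) := mem_filter.2 ⟨hx, hux⟩
          simp [h0] at this
        · obtain ⟨x, hx⟩ := exists_minimal hne
          obtain ⟨hxC, hux⟩ := mem_filter.1 hx.prop
          obtain ⟨e, hex, heu⟩ := exists_of_ssubset hux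
          refine ⟨e, heu, fun y hy huy => ?_⟩
          rcases hC x hxC y hy with h1 | h1
          · exact h1 hex
          · exact hx.le_of_le (mem_filter.2 ⟨hy, huy⟩) h1 hex
      refine ⟨insert e u, fun _ _ => ⟨fun x hx => ?_, subset_insert _ _, card_insert_of_notMem heu⟩⟩
      rcases hu x hx with h1 | h1
      · exact Or.inl (h1.trans (subset_insert _ _))
      · rcases eq_or_ssubset_of_subset h1 with rfl | h2
        · exact Or.inl (subset_insert _ _)
        · exact Or.inr (insert_subset (he x hx h2) h1)
    · exact ⟨u, fun h1 h2 => absurd ⟨h1, h2⟩ hu⟩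
  choose next hnext using hstep
  set s : ℕ → Finset α := fun t => next^[t] ∅ with hs
  have hsucc : ∀ t, s (t + 1) = next (s t) := fun t => Function.iterate_succ_apply' _ _ _
  have key : ∀ t ≤ Fintype.card α, Good (s t) ∧ #(s t) = t := by
    intro t
    induction t with
    | zero => intro _; exact ⟨fun x _ => Or.inr (empty_subset _), rfl⟩
    | succ t ih =>
      intro ht
      obtain ⟨h1, h2⟩ := ih (by omega)
      obtain ⟨h3, -, h5⟩ := hnext (s t) h1 (by omega)
      rw [hsucc]
      exact ⟨h3, by omega⟩
  refine ⟨s, fun t ht => (key t ht).2, fun t ht => ?_, fun x hx => ?_⟩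
  · obtain ⟨h1, h2⟩ := key t ht.le
    rw [hsucc]
    exact (hnext (s t) h1 (by omega)).2.1
  · obtain ⟨h1, h2⟩ := key #x (card_le_univ x)
    rcases h1 x hx with h3 | h3
    · exact (eq_of_subset_of_card_le h3 h2.le).symm
    · exact eq_of_subset_of_card_le h3 h2.ge

lemma IsFlow.add {F G : Finset (Finset α)} {v w : ℝ} {μ ν : Finset α → ℝ}
    {f g : Finset α → Finset α → ℝ} (hF : IsFlow F v μ f) (hG : IsFlow G w ν g) :
    IsFlow (F ∪ G) (v + w) (fun x => μ x + ν x) (fun x y => f x y + g x y) where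
  nonneg x y := add_nonneg (hF.nonneg x y) (hG.nonneg x y)
  supp x y hxy := by
    by_contra hcov
    refine hxy ?_
    rw [by_contra fun h => hcov (hF.supp x y h), by_contra fun h => hcov (hG.supp x y h), add_zero]
  out_le x := by rw [sum_add_distrib]; exact add_le_add (hF.out_le x) (hG.out_le x)
  in_le x := by rw [sum_add_distrib]; exact add_le_add (hF.in_le x) (hG.in_le x)
  one_le a ha := by
    rcases mem_union.1 ha with h | h
    · linarith [hF.one_le a h, hG.mass_nonneg a]
    · linarith [hG.one_le a h, hF.mass_nonneg a]
  value_le := by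
    simp_rw [sum_add_distrib]
    linarith [hF.value_le, hG.value_le]

/-- A chain in `F` extends to a maximal chain of the cube, which is a flow of value one. -/
lemma exists_isFlow_chain (C : Finset (Finset α)) (hC : ∀ x ∈ C, ∀ y ∈ C, x ⊆ y ∨ y ⊆ x) :
    ∃ μ f, IsFlow C 1 μ f := by
  obtain ⟨s, hs1, hs2, hs3⟩ := exists_maximal_chain C hC
  set μ : Finset α → ℝ := fun x => if s #x = x then 1 else 0 with hμ
  set f : Finset α → Finset α → ℝ := fun x y => if x ⋖ y ∧ s #x = x ∧ s #y = y then 1 else 0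
    with hf
  have hμ0 : ∀ x, 0 ≤ μ x := fun x => by simp only [hμ]; split_ifs <;> norm_num
  refine ⟨μ, f, ⟨fun x y => ?_, fun x y hxy => ?_, fun x => ?_, fun y => ?_, fun a ha => ?_, ?_⟩⟩
  · simp only [hf]; split_ifs <;> norm_num
  · by_contra h; simp [hf, h] at hxy
  · by_cases hx : s #x = x
    · rw [sum_eq_single (s (#x + 1))]
      · simp only [hf, hμ, hx, if_true]
        split_ifs <;> norm_num
      · intro y _ hy
        simp only [hf]
        rw [if_neg]
        rintro ⟨h1, -, h3⟩
        rw [(covBy_iff_card.1 h1).2] at h3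
        exact hy h3.symm
      · simp
    · simp [hf, hμ, hx]
  · by_cases hy : s #y = y
    · rw [sum_eq_single (s (#y - 1))]
      · simp only [hf, hμ, hy, if_true]
        split_ifs <;> norm_num
      · intro x _ hx
        simp only [hf]
        rw [if_neg]
        rintro ⟨h1, h2, -⟩
        rw [(covBy_iff_card.1 h1).2, Nat.add_sub_cancel] at hx
        exact hx h2.symm
      · simp
    · simp [hf, hμ, hy]
  · simp [hμ, hs3 a ha]
  · rw [sum_comm, ← sum_sub_distrib, sum_eq_add_sum_sdiff_singleton_of_mem (mem_univ (∅ : Finset α))]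
    have h1 : ∑ y ∈ univ \ {(∅ : Finset α)}, (μ y - ∑ x, f x y) ≤ 0 := by
      refine sum_nonpos fun y hy => ?_
      have hy0 : y ≠ ∅ := by simpa using hy
      have hpos : 0 < #y := card_pos.2 (nonempty_iff_ne_empty.2 hy0)
      have hle := card_le_univ y
      by_cases hsy : s #y = y
      · have h2 : f (s (#y - 1)) y ≤ ∑ x, f x y := single_le_sum (f := fun x => f x y)
          (fun x _ => by simp only [hf]; split_ifs <;> norm_num) (mem_univ _)
        have h3 := hs1 (#y - 1) (by omega)
        have h4 := hs2 (#y - 1) (by omega)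
        rw [Nat.sub_add_cancel hpos, hsy] at h4
        have h5 : f (s (#y - 1)) y = 1 := by
          simp only [hf]
          rw [if_pos ⟨covBy_iff_card.2 ⟨h4, by omega⟩, by rw [h3], hsy⟩]
        simp only [hμ, hsy, if_true]
        linarith
      · have : 0 ≤ ∑ x, f x y := sum_nonneg fun x _ => by simp only [hf]; split_ifs <;> norm_num
        simp only [hμ, hsy, if_false]
        linarith
    have h2 : 0 ≤ ∑ x, f x ∅ := sum_nonneg fun x _ => by simp only [hf]; split_ifs <;> norm_num
    have h3 : μ ∅ ≤ 1 := by simp only [hμ]; split_ifs <;> norm_num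
    linarith

/-- A family without antichains of more than `w` members has a flow of value at most `w`. -/
lemma exists_isFlow (F : Finset (Finset α)) (w : ℕ)
    (h : ∀ A ⊆ F, IsAntichain (· ⊆ ·) (A : Set (Finset α)) → #A ≤ w) :
    ∃ μ f, IsFlow F w μ f := by
  obtain ⟨c, hc, hchain⟩ := exists_chain_coloring F w h
  clear h
  induction w generalizing F with
  | zero =>
    have : F = ∅ := eq_empty_of_forall_notMem fun x hx => absurd (hc x hx) (by omega)
    subst this
    exact ⟨_, _, by simpa using isFlow_empty⟩
  | succ w ih =>
    obtain ⟨μ, f, h1⟩ := ih {x ∈ F | c x < w} (fun x hx => (mem_filter.1 hx).2)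
      (fun x hx y hy => hchain x (mem_filter.1 hx).1 y (mem_filter.1 hy).1)
    obtain ⟨ν, g, h2⟩ := exists_isFlow_chain {x ∈ F | c x = w} (fun x hx y hy =>
      hchain x (mem_filter.1 hx).1 y (mem_filter.1 hy).1
        ((mem_filter.1 hx).2.trans (mem_filter.1 hy).2.symm))
    have h3 := h1.add h2
    rw [← filter_or] at h3
    have h4 : {x ∈ F | c x < w ∨ c x = w} = F := filter_true_of_mem fun x hx => by
      have := hc x hx; omega
    rw [h4] at h3
    exact ⟨_, _, by exact_mod_cast h3⟩

end Existence

/-! ### Hall's theorem and flows between levels -/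

section Preliminaries

/-- The deficiency version of Hall's theorem. -/
lemma exists_partial_matching {ι β : Type*} [DecidableEq ι] [DecidableEq β] [Nonempty β]
    (A : Finset ι) (N : ι → Finset β) (d : ℕ) (h : ∀ S ⊆ A, d ≤ #(A \ S) + #(S.biUnion N)) :
    ∃ A' ⊆ A, d ≤ #A' ∧ ∃ φ : ι → β, Set.InjOn φ (A' : Set ι) ∧ ∀ a ∈ A', φ a ∈ N a := by
  have hdA : d ≤ #A := by simpa using h ∅ (empty_subset _)
  -- Hall's theorem after adding `#A - d` vertices joined to everything
  set T : A → Finset (β ⊕ Fin (#A - d)) := fun a => (N a).disjSum univ with hT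
  have hall : ∀ s : Finset A, #s ≤ #(s.biUnion T) := by
    intro s
    rcases s.eq_empty_or_nonempty with rfl | ⟨a₁, ha₁⟩
    · simp
    set S : Finset ι := s.map (Function.Embedding.subtype _) with hS
    have hSA : S ⊆ A := fun x hx => by
      obtain ⟨y, -, rfl⟩ := mem_map.1 hx
      exact y.2
    have hScard : #S = #s := card_map _
    have hsub : (S.biUnion N).disjSum univ ⊆ s.biUnion T := by
      intro x hx
      rcases x with x | x
      · have hx' := inl_mem_disjSum.1 hx
        obtain ⟨a, ha, hax⟩ := mem_biUnion.1 hx'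
        obtain ⟨b, hb, rfl⟩ := mem_map.1 ha
        exact mem_biUnion.2 ⟨b, hb, inl_mem_disjSum.2 hax⟩
      · exact mem_biUnion.2 ⟨a₁, ha₁, inr_mem_disjSum.2 (mem_univ _)⟩
    have h1 := card_le_card hsub
    rw [card_disjSum, card_univ, Fintype.card_fin] at h1
    have h2 := h S hSA
    rw [card_sdiff_of_subset hSA] at h2
    have h3 := card_le_card hSA
    omega
  obtain ⟨f, hfinj, hf⟩ := (all_card_le_biUnion_card_iff_exists_injective T).1 hall
  set b₀ : β := Classical.arbitrary β
  set φ : ι → β := fun a => if h : a ∈ A then Sum.elim id (fun _ => b₀) (f ⟨a, h⟩) else b₀ with hφ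
  set A₁ : Finset A := {a | (f a).isLeft} with hA₁
  set A₂ : Finset A := {a | ¬ (f a).isLeft} with hA₂
  have hcard : #A₁ + #A₂ = #A := by
    rw [hA₁, hA₂, card_filter_add_card_filter_not, card_univ, Fintype.card_coe]
  have hA₂le : #A₂ ≤ #A - d := by
    have : #(A₂.image f) ≤ #((∅ : Finset β).disjSum (univ : Finset (Fin (#A - d)))) := by
      refine card_le_card fun x hx => ?_
      obtain ⟨a, ha, rfl⟩ := mem_image.1 hx
      have ha2 := (mem_filter.1 ha).2
      rcases hfa : f a with y | y
      · simp [hfa] at ha2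
      · simp
    rw [card_image_of_injective _ hfinj] at this
    simpa using this
  have hval : ∀ a ∈ A₁, f a = Sum.inl (φ a) := by
    intro a ha
    have ha2 := (mem_filter.1 ha).2
    rcases hfa : f a with y | y
    · simp [hφ, hfa]
    · simp [hfa] at ha2
  refine ⟨A₁.map (Function.Embedding.subtype _), ?_, ?_, φ, ?_, ?_⟩
  · intro x hx
    obtain ⟨y, -, rfl⟩ := mem_map.1 hx
    exact y.2
  · rw [card_map]; omega
  · intro x hx y hy hxy
    obtain ⟨a, ha, rfl⟩ := mem_map.1 (mem_coe.1 hx)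
    obtain ⟨b, hb, rfl⟩ := mem_map.1 (mem_coe.1 hy)
    have : f a = f b := by
      rw [hval a ha, hval b hb]
      exact congrArg Sum.inl hxy
    rw [hfinj this]
  · intro x hx
    obtain ⟨a, ha, rfl⟩ := mem_map.1 hx
    have h1 := hf a
    rw [hval a ha] at h1
    exact inl_mem_disjSum.1 h1

variable {α : Type*} [DecidableEq α] {F : Finset (Finset α)}

/-- The indicator function of a family, as a vertex weight. -/
noncomputable def ind (F : Finset (Finset α)) : Finset α → ℝ := fun x => if x ∈ F then 1 else 0

lemma ind_of_mem {x : Finset α} (hx : x ∈ F) : ind F x = 1 := if_pos hx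

lemma ind_of_notMem {x : Finset α} (hx : x ∉ F) : ind F x = 0 := if_neg hx

lemma mem_shadow_iff_covBy {S : Finset (Finset α)} {x : Finset α} :
    x ∈ ∂ S ↔ ∃ y ∈ S, x ⋖ y := by
  rw [mem_shadow_iff_exists_mem_card_add_one]
  simp only [covBy_iff_card]

end Preliminaries

section Levels

variable {α : Type*} [Fintype α] [DecidableEq α]

/-- The members of an antichain are used by different chains, so their total weight is at most the
value of the flow. -/
lemma IsFlow.sum_antichain_le {F : Finset (Finset α)} {w : ℝ} {μ : Finset α → ℝ}
    {f : Finset α → Finset α → ℝ} (h : IsFlow F w μ f) (U : Finset (Finset α))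
    (hU : IsAntichain (· ⊆ ·) (U : Set (Finset α))) : ∑ u ∈ U, μ u ≤ w := by
  classical
  set D : Finset (Finset α) := {x | ∃ u ∈ U, x ⊂ u} with hD
  have hDU : ∀ u ∈ U, u ∉ D := by
    intro u hu huD
    obtain ⟨v, hv, huv⟩ := (mem_filter.1 huD).2
    exact huv.ne (hU.eq hu hv huv.subset)
  have hf : ∑ x, ∑ y, f x y ≤ ∑ x, if x ∈ U then 0 else μ x := by
    calc ∑ x, ∑ y, f x y
        = ∑ x, ((if x ∈ D then ∑ y, f x y else 0) + ∑ y, if x ∈ D then 0 else f x y) := by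
          refine sum_congr rfl fun x _ => ?_
          split_ifs <;> simp
      _ = ∑ x, (if x ∈ D then ∑ y, f x y else 0) + ∑ y, ∑ x, if x ∈ D then 0 else f x y := by
          rw [sum_add_distrib]
          congr 1
          exact sum_comm
      _ = ∑ x, ((if x ∈ D then ∑ y, f x y else 0) + ∑ y, if y ∈ D then 0 else f y x) := by
          rw [← sum_add_distrib]
      _ ≤ ∑ x, if x ∈ U then 0 else μ x := by
          refine sum_le_sum fun x _ => ?_
          have hup : x ∈ D ∨ x ∈ U → ∑ y, (if y ∈ D then 0 else f y x) = 0 := by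
            intro hx
            refine sum_eq_zero fun y _ => ?_
            by_cases hy : y ∈ D
            · simp [hy]
            · simp only [hy, if_false]
              by_contra hne
              have hyx := (h.supp y x hne).1
              rcases hx with hx | hx
              · obtain ⟨u, hu, hxu⟩ := (mem_filter.1 hx).2
                exact hy (mem_filter.2 ⟨mem_univ _, u, hu, lt_trans hyx hxu⟩)
              · exact hy (mem_filter.2 ⟨mem_univ _, x, hx, hyx⟩)
          by_cases hxU : x ∈ U
          · simp [hxU, hDU x hxU, hup (Or.inr hxU)]
          · by_cases hxD : x ∈ D
            · simpa [hxU, hxD, hup (Or.inl hxD)] using h.out_le x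
            · simp only [hxD, hxU, if_false, zero_add]
              refine le_trans (sum_le_sum fun y _ => ?_) (h.in_le x)
              split_ifs
              · exact h.nonneg y x
              · exact le_rfl
  have hμ : ∑ x, μ x = ∑ u ∈ U, μ u + ∑ x, if x ∈ U then 0 else μ x := by
    rw [← sum_filter_add_sum_filter_not univ (· ∈ U) μ]
    congr 1
    · simp
    · rw [sum_filter]
      exact sum_congr rfl fun x _ => by by_cases hx : x ∈ U <;> simp [hx]
  linarith [h.value_le]

lemma IsFlow.card_antichain_le {F : Finset (Finset α)} {w : ℝ} {μ : Finset α → ℝ}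
    {f : Finset α → Finset α → ℝ} (h : IsFlow F w μ f) {U : Finset (Finset α)} (hUF : U ⊆ F)
    (hU : IsAntichain (· ⊆ ·) (U : Set (Finset α))) : (#U : ℝ) ≤ w := by
  refine le_trans ?_ (h.sum_antichain_le U hU)
  rw [card_eq_sum_ones]
  push_cast
  exact sum_le_sum fun u hu => h.one_le u (hUF hu)

variable {F : Finset (Finset α)} {w : ℝ} {f : Finset α → Finset α → ℝ}

/-- The weight of the flow `f` between the levels `t` and `t + 1`. -/
noncomputable def levelFlow (f : Finset α → Finset α → ℝ) (t : ℕ) : ℝ :=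
  ∑ x, if #x = t then ∑ y, f x y else 0

lemma sum_ind : ∑ x, ind F x = #F := by simp [ind]

lemma IsFlow.mem_left (h : IsFlow F w (ind F) f) {x y : Finset α} (hxy : f x y ≠ 0) : x ∈ F := by
  by_contra hx
  have h1 := h.out_le x
  rw [ind_of_notMem hx] at h1
  exact hxy (le_antisymm ((single_le_sum (f := fun y => f x y) (fun y _ => h.nonneg x y)
    (mem_univ y)).trans h1) (h.nonneg x y))

lemma IsFlow.levelFlow_eq_in {μ : Finset α → ℝ} (h : IsFlow F w μ f) (t : ℕ) :
    levelFlow f t = ∑ y, if #y = t + 1 then ∑ x, f x y else 0 := by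
  have e1 : levelFlow f t = ∑ x, ∑ y, if #x = t then f x y else 0 := by
    unfold levelFlow
    exact sum_congr rfl fun x _ => by split_ifs <;> simp
  have e2 : (∑ y : Finset α, if #y = t + 1 then ∑ x, f x y else 0) =
      ∑ y, ∑ x, if #y = t + 1 then f x y else 0 :=
    sum_congr rfl fun x _ => by split_ifs <;> simp
  rw [e1, e2, sum_comm]
  refine sum_congr rfl fun y _ => sum_congr rfl fun x _ => ?_
  by_cases hxy : f x y = 0
  · simp [hxy]
  · have := (covBy_iff_card.1 (h.supp x y hxy)).2
    have e3 : #x = t ↔ #y = t + 1 := by omega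
    simp only [e3]

lemma IsFlow.levelFlow_le_card (h : IsFlow F w (ind F) f) (t : ℕ) :
    levelFlow f t ≤ #(F # t) := by
  rw [← sum_ind, levelFlow]
  refine sum_le_sum fun x _ => ?_
  split_ifs with hx
  · refine (h.out_le x).trans (le_of_eq ?_)
    unfold ind
    simp [mem_slice, hx]
  · unfold ind; split_ifs <;> norm_num

lemma IsFlow.levelFlow_le_card_succ (h : IsFlow F w (ind F) f) (t : ℕ) :
    levelFlow f t ≤ #(F # (t + 1)) := by
  rw [← sum_ind, h.levelFlow_eq_in]
  refine sum_le_sum fun x _ => ?_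
  split_ifs with hx
  · refine (h.in_le x).trans (le_of_eq ?_)
    unfold ind
    simp [mem_slice, hx]
  · unfold ind; split_ifs <;> norm_num

/-- Every set of vertices that meets all edges between two levels bounds the flow. -/
lemma IsFlow.levelFlow_le_cover (h : IsFlow F w (ind F) f) (t : ℕ) (S : Finset (Finset α)) :
    levelFlow f t ≤ #((F # (t + 1)) \ S) + #(∂ S ∩ F) := by
  rw [h.levelFlow_eq_in]
  have hterm : ∀ y : Finset α, (if #y = t + 1 then ∑ x, f x y else 0) ≤
      (if y ∈ (F # (t + 1)) \ S then (1 : ℝ) else 0) +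
        ∑ x, if x ∈ ∂ S ∩ F then f x y else 0 := by
    intro y
    have hnn : 0 ≤ ∑ x, if x ∈ ∂ S ∩ F then f x y else 0 :=
      sum_nonneg fun x _ => by split_ifs <;> simp [h.nonneg]
    by_cases hyF : y ∈ F
    · by_cases hy : #y = t + 1
      · by_cases hyS : y ∈ S
        · have e : ∑ x, f x y = ∑ x, if x ∈ ∂ S ∩ F then f x y else 0 := by
            refine sum_congr rfl fun x _ => ?_
            by_cases hxy : f x y = 0
            · simp [hxy]
            · rw [if_pos (mem_inter.2 ⟨mem_shadow_iff_covBy.2 ⟨y, hyS, h.supp x y hxy⟩,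
                h.mem_left hxy⟩)]
          simp [hy, hyS, e]
        · have h1 := h.in_le y
          rw [ind_of_mem hyF] at h1
          rw [if_pos hy, if_pos (by simp [mem_slice, hyF, hy, hyS])]
          linarith
      · rw [if_neg hy]
        split_ifs <;> linarith
    · have h1 := h.in_le y
      rw [ind_of_notMem hyF] at h1
      split_ifs <;> linarith
  refine (sum_le_sum fun y _ => hterm y).trans ?_
  rw [sum_add_distrib, sum_comm]
  refine add_le_add (by simp [-mem_sdiff]) ?_
  have : (#(∂ S ∩ F) : ℝ) = ∑ x, if x ∈ ∂ S ∩ F then (1 : ℝ) else 0 := by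
    simp [-mem_inter]
  rw [this]
  refine sum_le_sum fun x _ => ?_
  split_ifs with hx
  · have h1 := h.out_le x
    rwa [ind_of_mem (mem_inter.1 hx).2] at h1
  · simp

end Levels

/-! ### The levels of a saturated family -/

section Shadow

variable {α : Type*} [DecidableEq α]

lemma shadow_union (S T : Finset (Finset α)) : ∂ (S ∪ T) = ∂ S ∪ ∂ T := by
  ext x
  simp only [mem_union, mem_shadow_iff_exists_mem_card_add_one, or_and_right, exists_or]

lemma shadow_inter_subset (S T : Finset (Finset α)) : ∂ (S ∩ T) ⊆ ∂ S ∩ ∂ T :=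
  subset_inter (shadow_monotone inter_subset_left) (shadow_monotone inter_subset_right)

end Shadow

section Replace

variable {α : Type*} [Fintype α] [DecidableEq α] {F : Finset (Finset α)} {w : ℝ}
  {f : Finset α → Finset α → ℝ}

/-- Rerouting a flow between the levels `t` and `t + 1` along a matching. -/
lemma IsFlow.replace_level (h : IsFlow F w (ind F) f) {t : ℕ} {G A : Finset (Finset α)}
    (hFG : F ⊆ G) (hA : A ⊆ F # (t + 1)) {φ : Finset α → Finset α}
    (hinj : Set.InjOn φ (A : Set (Finset α))) (hφ : ∀ a ∈ A, φ a ∈ G ∧ φ a ⋖ a) :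
    IsFlow G (#G - (∑ x, ∑ y, f x y - levelFlow f t + #A)) (ind G)
      (fun x y => if #x = t then (if y ∈ A ∧ φ y = x then 1 else 0) else f x y) := by
  have hcard : ∀ a ∈ A, #a = t + 1 ∧ #(φ a) = t := by
    intro a ha
    have h1 := (mem_slice.1 (hA ha)).2
    have h2 := (covBy_iff_card.1 (hφ a ha).2).2
    exact ⟨h1, by omega⟩
  have hind : ∀ x, ind F x ≤ ind G x := by
    intro x
    unfold ind
    by_cases hx : x ∈ F
    · simp [hx, hFG hx]
    · simp only [hx, if_false]
      split_ifs <;> norm_num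
  refine ⟨?_, ?_, ?_, ?_, ?_, ?_⟩
  · intro x y
    split_ifs
    · exact zero_le_one
    · exact le_rfl
    · exact h.nonneg x y
  · intro x y hxy
    split_ifs at hxy with h1 h2
    · rw [← h2.2]
      exact (hφ y h2.1).2
    · exact absurd rfl hxy
    · exact h.supp x y hxy
  · intro x
    by_cases hx : #x = t
    · simp only [hx, if_true]
      rw [sum_boole]
      by_cases hxG : x ∈ G
      · rw [ind_of_mem hxG]
        have : #{y : Finset α | y ∈ A ∧ φ y = x} ≤ 1 := by
          rw [card_le_one]
          intro a ha b hb
          rw [mem_filter] at ha hb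
          exact hinj (mem_coe.2 ha.2.1) (mem_coe.2 hb.2.1) (ha.2.2.trans hb.2.2.symm)
        exact_mod_cast this
      · rw [ind_of_notMem hxG, filter_false_of_mem]
        · simp
        · rintro y - ⟨hy, rfl⟩
          exact hxG (hφ y hy).1
    · simp only [hx, if_false]
      exact (h.out_le x).trans (hind x)
  · intro y
    by_cases hy : #y = t + 1
    · have e : ∑ x : Finset α, (if #x = t then (if y ∈ A ∧ φ y = x then (1 : ℝ) else 0) else f x y)
          = ∑ x, if y ∈ A ∧ φ y = x then 1 else 0 := by
        refine sum_congr rfl fun x _ => ?_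
        by_cases hx : #x = t
        · simp [hx]
        · rw [if_neg hx, if_neg]
          · by_contra hxy
            have := (covBy_iff_card.1 (h.supp x y hxy)).2
            omega
          · rintro ⟨hyA, rfl⟩
            exact hx (hcard y hyA).2
      rw [e]
      by_cases hyA : y ∈ A
      · rw [ind_of_mem (hFG (mem_slice.1 (hA hyA)).1)]
        simp [hyA]
      · simp only [hyA, false_and, if_false, sum_const_zero]
        unfold ind
        split_ifs <;> norm_num
    · refine le_trans (sum_le_sum fun x _ => ?_) ((h.in_le y).trans (hind y))
      have hyA : y ∉ A := fun hyA => hy (hcard y hyA).1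
      simp only [hyA, false_and, if_false]
      split_ifs
      · exact h.nonneg x y
      · exact le_rfl
  · intro a ha
    rw [ind_of_mem ha]
  · rw [sum_ind]
    have e1 : ∑ x : Finset α, ∑ y : Finset α,
        (if #x = t then (if y ∈ A ∧ φ y = x then (1 : ℝ) else 0) else f x y) =
        #A + ∑ x : Finset α, if #x = t then 0 else ∑ y, f x y := by
      have e2 : (#A : ℝ) = ∑ x : Finset α, ∑ y : Finset α,
          if y ∈ A ∧ φ y = x then (1 : ℝ) else 0 := by
        rw [sum_comm, card_eq_sum_ones]
        push_cast
        rw [← sum_filter_add_sum_filter_not univ (· ∈ A)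
          (fun y => ∑ x, if y ∈ A ∧ φ y = x then (1 : ℝ) else 0)]
        rw [sum_eq_zero (s := filter (fun x => x ∉ A) univ)
          (f := fun y => ∑ x, if y ∈ A ∧ φ y = x then (1 : ℝ) else 0)]
        · rw [filter_mem_eq_inter, univ_inter, add_zero]
          refine sum_congr rfl fun y hy => ?_
          simp [hy]
        · intro y hy
          simp [(mem_filter.1 hy).2]
      rw [e2, ← sum_add_distrib]
      refine sum_congr rfl fun x _ => ?_
      by_cases hx : #x = t
      · simp [hx]
      · simp only [hx, if_false]
        rw [eq_comm, add_eq_right]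
        refine sum_eq_zero fun y _ => ?_
        rw [if_neg]
        rintro ⟨hyA, rfl⟩
        exact hx (hcard y hyA).2
    have e3 : ∑ x, ∑ y, f x y = levelFlow f t + ∑ x : Finset α, if #x = t then 0 else ∑ y, f x y := by
      unfold levelFlow
      rw [← sum_add_distrib]
      refine sum_congr rfl fun x _ => ?_
      split_ifs <;> simp
    rw [e1, e3]
    exact le_of_eq (by ring)

/-- If `e` sets are added to `F` and the result has an antichain of size at least `w + e`, then
a matching between two levels cannot be larger than the weight of a flow of value `w`. -/
lemma IsFlow.card_matching_le (h : IsFlow F w (ind F) f) {t : ℕ} {G A U : Finset (Finset α)}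
    (hFG : F ⊆ G) (hA : A ⊆ F # (t + 1)) {φ : Finset α → Finset α}
    (hinj : Set.InjOn φ (A : Set (Finset α))) (hφ : ∀ a ∈ A, φ a ∈ G ∧ φ a ⋖ a)
    (hUG : U ⊆ G) (hU : IsAntichain (· ⊆ ·) (U : Set (Finset α)))
    (hcard : (#G : ℝ) + w ≤ #F + #U) : (#A : ℝ) ≤ levelFlow f t := by
  have h1 := (h.replace_level hFG hA hinj hφ).card_antichain_le hUG hU
  have h2 := h.value_le
  rw [sum_ind] at h2
  linarith

end Replace

section Saturated

variable {n w : ℕ} {F : Finset (Finset (Fin n))} {f : Finset (Fin n) → Finset (Fin n) → ℝ}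

lemma card_le_of_not_hasAntichain (h : ¬ HasAntichain (w + 1) F) {A : Finset (Finset (Fin n))}
    (hAF : A ⊆ F) (hA : IsAntichain (· ⊆ ·) (A : Set (Finset (Fin n)))) : #A ≤ w := by
  by_contra hlt
  obtain ⟨B, hBA, hB⟩ := exists_subset_card_eq (Nat.succ_le_of_lt (not_le.1 hlt))
  exact h ⟨B, hBA.trans hAF, hB, hA.subset (coe_subset.2 hBA)⟩

/-- A saturated family is the union of `w` pairwise disjoint skipless chains, fractionally. A set
outside the family has weight zero because adding it creates an antichain of size `w + 1`. -/
theorem exists_unit_flow (hF : IsAntichainSaturated (w + 1) F) :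
    ∃ f, IsFlow F (w : ℝ) (ind F) f := by
  obtain ⟨μ₀, f₀, h₀⟩ := exists_isFlow F w fun A hAF hA => card_le_of_not_hasAntichain hF.1 hAF hA
  obtain ⟨μ, f, h, hle⟩ := h₀.exists_le_one
  have hμ : μ = ind F := by
    funext x
    by_cases hx : x ∈ F
    · rw [ind_of_mem hx]
      exact le_antisymm (hle x) (h.one_le x hx)
    · rw [ind_of_notMem hx]
      refine le_antisymm ?_ (h.mass_nonneg x)
      obtain ⟨A, hA, hcard, hanti⟩ := hF.2 x hx
      have hxA : x ∈ A := by
        by_contra hxA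
        exact hF.1 ⟨A, fun y hy => (mem_insert.1 (hA hy)).resolve_left
          (by rintro rfl; exact hxA hy), hcard, hanti⟩
      have h1 := h.sum_antichain_le A hanti
      rw [← add_sum_erase A μ hxA] at h1
      have h2 : (w : ℝ) ≤ ∑ y ∈ A.erase x, μ y := by
        have h3 : #(A.erase x) = w := by rw [card_erase_of_mem hxA, hcard]; rfl
        calc (w : ℝ) = ∑ y ∈ A.erase x, 1 := by simp [h3]
          _ ≤ _ := sum_le_sum fun y hy => h.one_le y
            ((mem_insert.1 (hA (mem_of_mem_erase hy))).resolve_left (ne_of_mem_erase hy))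
      linarith
  exact ⟨f, hμ ▸ h⟩

/-- In a saturated family the weight of the flow between two levels is the size of a vertex cover
of the whole bipartite graph between the upper level and its shadow in the cube, not only of the
part inside the family. -/
theorem exists_levelFlow_eq (hF : IsAntichainSaturated (w + 1) F) (hw : HasAntichain w F)
    (h : IsFlow F (w : ℝ) (ind F) f) (t : ℕ) :
    ∃ S ⊆ F # (t + 1), levelFlow f t = #((F # (t + 1)) \ S) + #(∂ S) := by
  set L := F # (t + 1) with hL
  set val : Finset (Finset (Fin n)) → ℕ := fun S => #(L \ S) + #(∂ S ∩ F) with hval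
  -- a minimum vertex cover whose upper part leaves out as much as possible
  obtain ⟨S₁, hS₁, hmin₁⟩ := exists_min_image L.powerset val ⟨∅, by simp⟩
  obtain ⟨S₀, hS₀, hmin₀⟩ := exists_min_image {S ∈ L.powerset | val S = val S₁} card
    ⟨S₁, by simp [mem_powerset.1 hS₁]⟩
  rw [mem_filter, mem_powerset] at hS₀
  have hval₀ : ∀ S ⊆ L, val S₀ ≤ val S := fun S hS => by
    rw [hS₀.2]; exact hmin₁ S (mem_powerset.2 hS)
  have hcard₀ : ∀ S ⊆ L, val S = val S₀ → #S₀ ≤ #S := fun S hS hS' =>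
    hmin₀ S (mem_filter.2 ⟨mem_powerset.2 hS, hS'.trans hS₀.2⟩)
  -- Hall's theorem, with a bound from the antichains in `G`
  have hall : ∀ G, F ⊆ G → ∀ U ⊆ G, IsAntichain (· ⊆ ·) (U : Set (Finset (Fin n))) →
      #G + w ≤ #F + #U → ∀ d : ℕ, (∀ S ⊆ L, d ≤ #(L \ S) + #(∂ S ∩ G)) →
      (d : ℝ) ≤ levelFlow f t := by
    intro G hFG U hUG hU hcard d hd
    obtain ⟨A, hAL, hdA, φ, hinj, hφ⟩ := exists_partial_matching L
      (fun a => {x ∈ G | x ⋖ a}) d (by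
        intro S hS
        refine (hd S hS).trans (Nat.add_le_add_left (card_le_card ?_) _)
        intro x hx
        obtain ⟨hx1, hx2⟩ := mem_inter.1 hx
        obtain ⟨y, hy, hxy⟩ := mem_shadow_iff_covBy.1 hx1
        exact mem_biUnion.2 ⟨y, hy, mem_filter.2 ⟨hx2, hxy⟩⟩)
    have h1 := h.card_matching_le hFG hAL hinj (fun a ha => mem_filter.1 (hφ a ha)) hUG hU
      (by exact_mod_cast hcard)
    exact le_trans (by exact_mod_cast hdA) h1
  obtain ⟨U, hUF, hUw, hU⟩ := hw
  have heq : levelFlow f t = val S₀ := by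
    refine le_antisymm ?_ (hall F subset_rfl U hUF hU (by omega) _ hval₀)
    have := h.levelFlow_le_cover t S₀
    simp only [hval]
    push_cast
    exact this
  refine ⟨S₀, hS₀.1, ?_⟩
  have hsub : ∂ S₀ ⊆ F := by
    intro z hz
    by_contra hzF
    obtain ⟨U', hU'F, hU'w, hU'⟩ := hF.2 z hzF
    have hex : ¬ ∀ S ⊆ L, val S₀ + 1 ≤ #(L \ S) + #(∂ S ∩ insert z F) := by
      intro hd
      have := hall (insert z F) (subset_insert _ _) U' hU'F hU'
        (by rw [card_insert_of_notMem hzF]; omega) _ hd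
      rw [heq] at this
      push_cast at this
      linarith
    push Not at hex
    obtain ⟨S, hSL, hS⟩ := hex
    have hSF : ∂ S ∩ F ⊆ ∂ S ∩ insert z F := inter_subset_inter subset_rfl (subset_insert _ _)
    have hzS : z ∉ ∂ S := by
      intro hzS
      have h1 : insert z (∂ S ∩ F) ⊆ ∂ S ∩ insert z F := by
        refine insert_subset (mem_inter.2 ⟨hzS, mem_insert_self _ _⟩) hSF
      have h2 := card_le_card h1
      rw [card_insert_of_notMem fun h' => hzF (mem_inter.1 h').2] at h2
      have h3 := hval₀ S hSL
      simp only [hval] at h3 hS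
      omega
    have hSval : val S = val S₀ := by
      refine le_antisymm ?_ (hval₀ S hSL)
      have := card_le_card hSF
      simp only [hval] at hS ⊢
      omega
    -- the function `val` is submodular
    have hsubmod : val (S₀ ∩ S) + val (S₀ ∪ S) ≤ val S₀ + val S := by
      have e1 : #(L \ (S₀ ∩ S)) + #(L \ (S₀ ∪ S)) = #(L \ S₀) + #(L \ S) := by
        rw [Finset.sdiff_inter_distrib_right, Finset.sdiff_union_distrib, card_union_add_card_inter]
      have e2 : #(∂ (S₀ ∩ S) ∩ F) + #(∂ (S₀ ∪ S) ∩ F) ≤ #(∂ S₀ ∩ F) + #(∂ S ∩ F) := by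
        have i1 : ∂ (S₀ ∪ S) ∩ F = (∂ S₀ ∩ F) ∪ (∂ S ∩ F) := by
          rw [shadow_union, union_inter_distrib_right]
        have i2 : ∂ (S₀ ∩ S) ∩ F ⊆ (∂ S₀ ∩ F) ∩ (∂ S ∩ F) := by
          rw [← inter_inter_distrib_right]
          exact inter_subset_inter_right (shadow_inter_subset _ _)
        rw [i1, ← card_union_add_card_inter (∂ S₀ ∩ F), add_comm]
        exact Nat.add_le_add_left (card_le_card i2) _
      simp only [hval]
      omega
    have h1 := hval₀ (S₀ ∩ S) (inter_subset_left.trans hS₀.1)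
    have h2 := hval₀ (S₀ ∪ S) (union_subset hS₀.1 hSL)
    have h3 : S₀ ∩ S = S₀ := eq_of_subset_of_card_le inter_subset_left
      (hcard₀ _ (inter_subset_left.trans hS₀.1) (by omega))
    exact hzS (shadow_monotone (inter_eq_left.1 h3) hz)
  rw [heq]
  simp only [hval]
  rw [inter_eq_left.2 hsub]
  push_cast
  rfl

end Saturated

/-! ### Colexicographic segments -/

section Rank

variable {β : Type*} [LinearOrder β]

/-- In a finite set `P`, exactly `m` elements have fewer than `m` elements of `P` before them. -/
lemma card_filter_rank_lt (P : Finset β) {m : ℕ} (hm : m ≤ #P) :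
    #{a ∈ P | #{b ∈ P | b < a} < m} = m := by
  set r : β → ℕ := fun a => #{b ∈ P | b < a} with hr
  have hlt : ∀ a ∈ P, ∀ b ∈ P, a < b → r a < r b := by
    intro a ha b hb hab
    refine card_lt_card ⟨fun c hc => ?_, fun h => ?_⟩
    · rw [mem_filter] at hc ⊢
      exact ⟨hc.1, hc.2.trans hab⟩
    · exact lt_irrefl a (mem_filter.1 (h (mem_filter.2 ⟨ha, hab⟩))).2
  have hinj : Set.InjOn r (P : Set β) := by
    intro a ha b hb hab
    rcases lt_trichotomy a b with h | h | h
    · exact absurd hab (hlt a ha b hb h).ne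
    · exact h
    · exact absurd hab (hlt b hb a ha h).ne'
  have himg : P.image r = range #P := by
    refine eq_of_subset_of_card_le (fun x hx => ?_) ?_
    · obtain ⟨a, ha, rfl⟩ := mem_image.1 hx
      exact mem_range.2 (card_lt_card ⟨filter_subset _ _, fun h =>
        lt_irrefl a (mem_filter.1 (h ha)).2⟩)
    · rw [card_image_of_injOn hinj, card_range]
  have h1 : ({a ∈ P | r a < m}).image r = range m := by
    ext x
    simp only [mem_image, mem_filter, mem_range]
    constructor
    · rintro ⟨a, ⟨-, h⟩, rfl⟩
      exact h
    · intro hx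
      have : x ∈ P.image r := by rw [himg]; exact mem_range.2 (by omega)
      obtain ⟨a, ha, rfl⟩ := mem_image.1 this
      exact ⟨a, ⟨ha, hx⟩, rfl⟩
  rw [← card_image_of_injOn (hinj.mono (coe_subset.2 (filter_subset _ _))), h1, card_range]

end Rank

section Colex

open Colex

lemma le_choose_add {N m s : ℕ} (h : m ≤ N.choose s) : m ≤ (m + s).choose s := by
  rcases s with _ | s
  · simpa using h
  · rcases m with _ | m
    · exact Nat.zero_le _
    · have h1 := Nat.choose_le_choose (s + 1) (show m + 1 + s ≤ m + 1 + (s + 1) by omega)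
      have h2 : m + 1 ≤ (m + 1 + s).choose (s + 1) := by
        rw [← Nat.choose_symm_of_eq_add (show m + 1 + s = m + (s + 1) by ring)]
        clear h h1
        induction m with
        | zero => simp
        | succ m ih =>
          rw [show m + 1 + 1 + s = (m + 1 + s) + 1 by ring, Nat.choose_succ_succ']
          have : 0 < (m + 1 + s).choose (m + 1) := Nat.choose_pos (by omega)
          omega
      omega

lemma colexSeg_subset (m s : ℕ) : colexSeg m s ⊆ powersetCard s (range (m + s)) :=
  filter_subset _ _

lemma sized_colexSeg (m s : ℕ) : (colexSeg m s : Set (Finset ℕ)).Sized s :=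
  fun _ hA => (mem_powersetCard.1 (colexSeg_subset m s hA)).2

lemma mem_powersetCard_range_of_lt {N s : ℕ} {A B : Finset ℕ}
    (hA : A ∈ powersetCard s (range N)) (hBA : toColex B < toColex A) (hB : #B = s) :
    B ∈ powersetCard s (range N) := by
  rw [mem_powersetCard] at hA ⊢
  exact ⟨fun b hb => mem_range.2 (forall_lt_mono hBA.le (fun a ha => mem_range.1 (hA.1 ha)) b hb),
    hB⟩

lemma isInitSeg_powersetCard_range (N s : ℕ) : IsInitSeg (powersetCard s (range N)) s :=
  ⟨fun _ hA => (mem_powersetCard.1 hA).2,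
    fun _ _ hA hBA => mem_powersetCard_range_of_lt hA hBA.1 hBA.2⟩

lemma isInitSeg_colexSeg (m s : ℕ) : IsInitSeg (colexSeg m s) s := by
  refine ⟨sized_colexSeg m s, ?_⟩
  rintro A B hA ⟨hBA, hB⟩
  obtain ⟨hA1, hA2⟩ := mem_filter.1 hA
  refine mem_filter.2 ⟨mem_powersetCard_range_of_lt hA1 hBA hB, lt_of_le_of_lt (card_le_card ?_) hA2⟩
  intro C hC
  rw [mem_filter] at hC ⊢
  exact ⟨hC.1, hC.2.trans hBA⟩

lemma card_colexSeg {N m s : ℕ} (h : m ≤ N.choose s) : #(colexSeg m s) = m := by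
  have h1 := card_filter_rank_lt (β := Colex (Finset ℕ))
    ((powersetCard s (range (m + s))).map toColex.toEmbedding) (m := m)
    (by rw [card_map, card_powersetCard, card_range]; exact le_choose_add h)
  rw [filter_map, card_map] at h1
  rw [colexSeg]
  convert h1 using 3
  rw [Function.comp_apply, filter_map, card_map]
  rfl

lemma isInitSeg_subset_of_card_le {𝒜 ℬ : Finset (Finset ℕ)} {s : ℕ} (h𝒜 : IsInitSeg 𝒜 s)
    (hℬ : IsInitSeg ℬ s) (h : #𝒜 ≤ #ℬ) : 𝒜 ⊆ ℬ := by
  rcases h𝒜.total hℬ with h1 | h1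
  · exact h1
  · exact (eq_of_subset_of_card_le h1 h).ge

lemma colexSeg_subset_range {N m s : ℕ} (h : m ≤ N.choose s) :
    colexSeg m s ⊆ powersetCard s (range N) :=
  isInitSeg_subset_of_card_le (isInitSeg_colexSeg m s) (isInitSeg_powersetCard_range N s)
    (by rw [card_colexSeg h, card_powersetCard, card_range]; exact h)

lemma colexSeg_mono {N m m' s : ℕ} (h : m ≤ m') (h' : m' ≤ N.choose s) :
    colexSeg m s ⊆ colexSeg m' s :=
  isInitSeg_subset_of_card_le (isInitSeg_colexSeg m s) (isInitSeg_colexSeg m' s)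
    (by rw [card_colexSeg h', card_colexSeg (h.trans h')]; exact h)

/-- The Kruskal–Katona theorem for colexicographic segments. -/
lemma card_shadow_colexSeg_le {n m s : ℕ} {𝒮 : Finset (Finset (Fin n))}
    (h𝒮 : (𝒮 : Set (Finset (Fin n))).Sized s) (hm : m ≤ #𝒮) :
    #(∂ (colexSeg m s)) ≤ #(∂ 𝒮) := by
  have hmn : m ≤ n.choose s := hm.trans (by simpa using h𝒮.card_le)
  set e : Finset (Fin n) → Finset ℕ := fun A => A.image Fin.val with he
  have heinj : Function.Injective e := image_injective Fin.val_injective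
  set 𝒞 : Finset (Finset (Fin n)) := {A | e A ∈ colexSeg m s} with h𝒞
  have hecard : ∀ A, #(e A) = #A := fun A => card_image_of_injective _ Fin.val_injective
  have himg : 𝒞.image e = colexSeg m s := by
    ext A
    simp only [mem_image, h𝒞, mem_filter, mem_univ, true_and]
    constructor
    · rintro ⟨B, hB, rfl⟩
      exact hB
    · intro hA
      have h1 := (mem_powersetCard.1 (colexSeg_subset_range hmn hA)).1
      have h2 : e ({i | (i : ℕ) ∈ A}) = A := by
        ext x
        simp only [he, mem_image, mem_filter, mem_univ, true_and]
        constructor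
        · rintro ⟨i, hi, rfl⟩
          exact hi
        · intro hx
          exact ⟨⟨x, mem_range.1 (h1 hx)⟩, hx, rfl⟩
      exact ⟨_, by rw [h2]; exact hA, h2⟩
  have hcard : #𝒞 = m := by
    rw [← card_image_of_injective _ heinj, himg, card_colexSeg hmn]
  have hinit : IsInitSeg 𝒞 s := by
    refine ⟨fun A hA => ?_, ?_⟩
    · rw [← hecard]
      exact sized_colexSeg m s (mem_filter.1 hA).2
    · rintro A B hA ⟨hBA, hB⟩
      refine mem_filter.2 ⟨mem_univ _, (isInitSeg_colexSeg m s).2 (mem_filter.1 hA).2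
        ⟨(toColex_image_lt_toColex_image Fin.val_strictMono).2 hBA, by rw [hecard, hB]⟩⟩
  refine le_trans ?_ (kruskal_katona h𝒮 (by omega) hinit)
  rw [← card_image_of_injective _ heinj, ← himg]
  refine card_le_card fun X hX => ?_
  obtain ⟨Y, hY, y, hy, rfl⟩ := mem_shadow_iff.1 hX
  obtain ⟨A, hA, rfl⟩ := mem_image.1 hY
  obtain ⟨a, ha, rfl⟩ := mem_image.1 hy
  refine mem_image.2 ⟨A.erase a, erase_mem_shadow hA ha, ?_⟩
  simp only [he]
  rw [image_erase Fin.val_injective]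

end Colex

/-! ### Shadows and shadow matchings -/

section DoubleCounting

variable {α : Type*} [DecidableEq α]

/-- Above the middle of the cube over `U`, shadows are not smaller than the families. -/
lemma card_le_card_shadow {S : Finset (Finset α)} {U : Finset α} {s : ℕ}
    (hS : S ⊆ powersetCard s U) (hU : #U + 1 ≤ 2 * s) : #S ≤ #(∂ S) := by
  have h := card_mul_le_card_mul (fun x y : Finset α => y ⊆ x) (s := S) (t := ∂ S) (m := s) (n := s)
    (by
      intro x hx
      have hxs := (mem_powersetCard.1 (hS hx)).2
      have : powersetCard (s - 1) x ⊆ bipartiteAbove (fun x y : Finset α => y ⊆ x) (∂ S) x := by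
        intro y hy
        rw [mem_powersetCard] at hy
        rw [mem_bipartiteAbove]
        exact ⟨mem_shadow_iff_exists_mem_card_add_one.2 ⟨x, hx, hy.1, by omega⟩, hy.1⟩
      have h1 := card_le_card this
      rw [card_powersetCard, hxs, ← Nat.choose_symm (by omega), show s - (s - 1) = 1 by omega,
        Nat.choose_one_right] at h1
      exact h1)
    (by
      intro y hy
      obtain ⟨x, hx, hyx, hc⟩ := mem_shadow_iff_exists_mem_card_add_one.1 hy
      have hx' := mem_powersetCard.1 (hS hx)
      have : bipartiteBelow (fun x y : Finset α => y ⊆ x) S y ⊆ (U \ y).image (insert · y) := by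
        intro z hz
        rw [mem_bipartiteBelow] at hz
        have hz' := mem_powersetCard.1 (hS hz.1)
        obtain ⟨a, ha⟩ := card_eq_one.1 (show #(z \ y) = 1 by
          rw [card_sdiff_of_subset hz.2]; omega)
        have haz : a ∈ z \ y := by rw [ha]; exact mem_singleton_self a
        rw [mem_sdiff] at haz
        refine mem_image.2 ⟨a, mem_sdiff.2 ⟨hz'.1 haz.1, haz.2⟩, ?_⟩
        rw [insert_eq, ← ha, sdiff_union_of_subset hz.2]
      have h1 := (card_le_card this).trans card_image_le
      rw [card_sdiff_of_subset (hyx.trans hx'.1)] at h1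
      omega)
  exact Nat.le_of_mul_le_mul_right h (by omega)

/-- Below the middle of the cube over `U`, upper shadows are not smaller than the families. -/
lemma card_le_card_upper {T : Finset (Finset α)} {U : Finset α} {j : ℕ}
    (hT : T ⊆ powersetCard j U) (hU : 2 * j + 1 ≤ #U) :
    #T ≤ #{y ∈ powersetCard (j + 1) U | ∃ x ∈ T, x ⊆ y} := by
  have h := card_mul_le_card_mul (fun x y : Finset α => x ⊆ y) (s := T)
    (t := {y ∈ powersetCard (j + 1) U | ∃ x ∈ T, x ⊆ y}) (m := j + 1) (n := j + 1)
    (by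
      intro x hx
      have hx' := mem_powersetCard.1 (hT hx)
      have : (U \ x).image (insert · x) ⊆ bipartiteAbove (fun x y : Finset α => x ⊆ y)
          {y ∈ powersetCard (j + 1) U | ∃ x ∈ T, x ⊆ y} x := by
        intro y hy
        obtain ⟨a, ha, rfl⟩ := mem_image.1 hy
        rw [mem_sdiff] at ha
        rw [mem_bipartiteAbove, mem_filter, mem_powersetCard]
        exact ⟨⟨⟨insert_subset ha.1 hx'.1, by rw [card_insert_of_notMem ha.2, hx'.2]⟩,
          x, hx, subset_insert _ _⟩, subset_insert _ _⟩
      have h1 := card_le_card this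
      rw [card_image_of_injOn, card_sdiff_of_subset hx'.1] at h1
      · omega
      · intro a ha b hb hab
        have ha' := (mem_sdiff.1 (mem_coe.1 ha)).2
        have : a ∈ insert b x := by
          have : a ∈ insert a x := mem_insert_self a x
          rwa [show insert a x = insert b x from hab] at this
        exact (mem_insert.1 this).resolve_right ha')
    (by
      intro y hy
      have hy' := mem_powersetCard.1 (mem_filter.1 hy).1
      have : bipartiteBelow (fun x y : Finset α => x ⊆ y) T y ⊆ powersetCard j y := by
        intro z hz
        rw [mem_bipartiteBelow] at hz
        exact mem_powersetCard.2 ⟨hz.2, (mem_powersetCard.1 (hT hz.1)).2⟩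
      have h1 := card_le_card this
      rwa [card_powersetCard, hy'.2, Nat.choose_succ_self_right] at h1)
  exact Nat.le_of_mul_le_mul_right h (by omega)

end DoubleCounting

section Nu

/-- A vertex cover bounds the size of the matchings. -/
lemma nu_le {B : Finset (Finset ℕ)} {s : ℕ} (hB : (B : Set (Finset ℕ)).Sized s)
    (T : Finset (Finset ℕ)) : nu B ≤ #(B \ T) + #(∂ T) := by
  refine Finset.sup_le fun M hM => ?_
  obtain ⟨hM1, hM2⟩ := (mem_filter.1 hM).2
  rw [← card_filter_add_card_filter_not (s := M) (fun e => e.1 ∉ T)]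
  refine add_le_add ?_ ?_
  · rw [← card_image_of_injOn (f := Prod.fst)]
    · refine card_le_card fun x hx => ?_
      obtain ⟨e, he, rfl⟩ := mem_image.1 hx
      rw [mem_filter] at he
      exact mem_sdiff.2 ⟨(hM1 e he.1).1, he.2⟩
    · intro e he f hf hef
      by_contra hne
      exact (hM2 e (mem_filter.1 he).1 f (mem_filter.1 hf).1 hne).1 hef
  · rw [← card_image_of_injOn (f := Prod.snd)]
    · refine card_le_card fun x hx => ?_
      obtain ⟨e, he, rfl⟩ := mem_image.1 hx
      rw [mem_filter, not_not] at he
      obtain ⟨h1, h2, h3⟩ := hM1 e he.1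
      obtain ⟨z, hz, hz1, hz2⟩ := mem_shadow_iff_exists_mem_card_add_one.1 h2
      exact mem_shadow_iff_exists_mem_card_add_one.2
        ⟨e.1, he.2, h3, by rw [hB h1, ← hB hz, hz2]⟩
    · intro e he f hf hef
      by_contra hne
      exact (hM2 e (mem_filter.1 he).1 f (mem_filter.1 hf).1 hne).2 hef

lemma nu_mono {B B' : Finset (Finset ℕ)} (h : B ⊆ B') : nu B ≤ nu B' := by
  refine Finset.sup_le fun M hM => ?_
  rw [mem_filter, mem_powerset] at hM
  refine le_sup (f := card) (mem_filter.2 ⟨mem_powerset.2 (hM.1.trans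
    (product_subset_product h (shadow_mono h))), fun e he => ?_, hM.2.2⟩)
  exact ⟨h (hM.2.1 e he).1, shadow_mono h (hM.2.1 e he).2.1, (hM.2.1 e he).2.2⟩

/-- König's theorem for the bipartite graph between a family and its shadow. -/
lemma le_nu {B : Finset (Finset ℕ)} {d : ℕ} (h : ∀ S ⊆ B, d ≤ #(B \ S) + #(∂ S)) :
    d ≤ nu B := by
  obtain ⟨A, hAB, hdA, φ, hinj, hφ⟩ := exists_partial_matching B (fun a => ∂ {a}) d (by
    intro S hS
    refine (h S hS).trans (Nat.add_le_add_left (card_le_card ?_) _)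
    intro x hx
    obtain ⟨a, ha, b, hb, rfl⟩ := mem_shadow_iff.1 hx
    exact mem_biUnion.2 ⟨a, ha, erase_mem_shadow (mem_singleton_self a) hb⟩)
  have hcard : #(A.image fun a => (a, φ a)) = #A :=
    card_image_of_injective _ fun a b hab => (Prod.ext_iff.1 hab).1
  rw [← hcard] at hdA
  have hsh : ∀ a ∈ A, φ a ∈ ∂ B ∧ φ a ⊆ a := by
    intro a ha
    have h1 := hφ a ha
    refine ⟨shadow_mono (singleton_subset_iff.2 (hAB ha)) h1, ?_⟩
    obtain ⟨b, hb, hb'⟩ := exists_subset_of_mem_shadow h1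
    rwa [mem_singleton.1 hb] at hb'
  refine hdA.trans (le_sup (f := card) (mem_filter.2 ⟨mem_powerset.2 ?_, ?_, ?_⟩))
  · intro e he
    obtain ⟨a, ha, rfl⟩ := mem_image.1 he
    exact mem_product.2 ⟨hAB ha, (hsh a ha).1⟩
  · intro e he
    obtain ⟨a, ha, rfl⟩ := mem_image.1 he
    exact ⟨hAB ha, hsh a ha⟩
  · intro e he f hf hef
    obtain ⟨a, ha, rfl⟩ := mem_image.1 he
    obtain ⟨b, hb, rfl⟩ := mem_image.1 hf
    have hab : a ≠ b := by rintro rfl; exact hef rfl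
    exact ⟨hab, fun h' => hab (hinj ha hb h')⟩

lemma nu_colexSeg_mono {N m m' s : ℕ} (h : m ≤ m') (h' : m' ≤ N.choose s) :
    nu (colexSeg m s) ≤ nu (colexSeg m' s) :=
  nu_mono (colexSeg_mono h h')

/-- Colexicographic segments have the smallest shadow matchings among families of their size. -/
lemma nu_colexSeg_le {n m s e : ℕ} {𝒮 : Finset (Finset (Fin n))}
    (h𝒮 : (𝒮 : Set (Finset (Fin n))).Sized s) (hm : m ≤ n.choose s) (hme : m ≤ e + #𝒮) :
    nu (colexSeg m s) ≤ e + #(∂ 𝒮) := by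
  refine (nu_le (sized_colexSeg m s) (colexSeg (m - e) s)).trans (add_le_add ?_
    (card_shadow_colexSeg_le h𝒮 (by omega)))
  rw [card_sdiff_of_subset (colexSeg_mono (Nat.sub_le m e) hm), card_colexSeg hm,
    card_colexSeg ((Nat.sub_le m e).trans hm)]
  omega

/-- Colexicographic segments inside a `2 * s - 1`-set are matched completely into their shadows. -/
lemma le_nu_colexSeg {m s : ℕ} (hs : 1 ≤ s) (h : m ≤ (2 * s - 1).choose s) :
    m ≤ nu (colexSeg m s) := by
  refine le_nu fun S hS => ?_
  have h1 := card_le_card_shadow (hS.trans (colexSeg_subset_range h))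
    (by rw [card_range]; omega)
  have h2 := card_le_card hS
  rw [card_sdiff_of_subset hS, card_colexSeg h] at *
  omega

/-- The members of a colexicographic segment with largest possible element `N` form, after removal
of `N`, a colexicographic segment. -/
lemma colexSeg_eq_union {N m s : ℕ} (h1 : N.choose (s + 1) ≤ m)
    (h2 : m ≤ (N + 1).choose (s + 1)) :
    colexSeg m (s + 1) = powersetCard (s + 1) (range N) ∪
      (colexSeg (m - N.choose (s + 1)) s).image (insert N) := by
  have h3 : m - N.choose (s + 1) ≤ N.choose s := by
    rw [Nat.choose_succ_succ'] at h2; omega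
  have hC := colexSeg_subset_range h3
  have hN : ∀ X ∈ colexSeg (m - N.choose (s + 1)) s, N ∉ X := fun X hX hNX =>
    absurd (mem_range.1 ((mem_powersetCard.1 (hC hX)).1 hNX)) (lt_irrefl N)
  have hinit : Colex.IsInitSeg (powersetCard (s + 1) (range N) ∪
      (colexSeg (m - N.choose (s + 1)) s).image (insert N)) (s + 1) := by
    refine ⟨fun A hA => ?_, ?_⟩
    · rcases mem_union.1 hA with hA | hA
      · exact (mem_powersetCard.1 hA).2
      · obtain ⟨X, hX, rfl⟩ := mem_image.1 hA
        rw [card_insert_of_notMem (hN X hX), sized_colexSeg _ _ hX]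
    · rintro A B hA ⟨hBA, hB⟩
      rcases mem_union.1 hA with hA | hA
      · exact mem_union_left _ (mem_powersetCard_range_of_lt hA hBA hB)
      · obtain ⟨X, hX, rfl⟩ := mem_image.1 hA
        have hX' := mem_powersetCard.1 (hC hX)
        have hBN : ∀ b ∈ B, b < N + 1 := Colex.forall_lt_mono hBA.le (by
          intro b hb
          rcases mem_insert.1 hb with rfl | hb
          · exact Nat.lt_succ_self _
          · exact (mem_range.1 (hX'.1 hb)).trans (Nat.lt_succ_self _))
        by_cases hNB : N ∈ B
        · refine mem_union_right _ (mem_image.2 ⟨B.erase N, ?_, insert_erase hNB⟩)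
          refine (isInitSeg_colexSeg _ s).2 hX ⟨?_, by rw [card_erase_of_mem hNB, hB]; rfl⟩
          have h4 : toColex (B \ {N}) < toColex (insert N X \ {N}) :=
            (Colex.toColex_sdiff_lt_toColex_sdiff (singleton_subset_iff.2 hNB)
              (singleton_subset_iff.2 (mem_insert_self N X))).2 hBA
          rwa [sdiff_singleton_eq_erase, sdiff_singleton_eq_erase, erase_insert (hN X hX)] at h4
        · refine mem_union_left _ (mem_powersetCard.2 ⟨fun b hb => mem_range.2 ?_, hB⟩)
          have h4 := hBN b hb
          have h5 : b ≠ N := by rintro rfl; exact hNB hb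
          omega
  have hcard : #(powersetCard (s + 1) (range N) ∪
      (colexSeg (m - N.choose (s + 1)) s).image (insert N)) = m := by
    rw [card_union_of_disjoint, card_powersetCard, card_range, card_image_of_injOn,
      card_colexSeg h3]
    · omega
    · intro X hX Y hY hXY
      rw [← erase_insert (hN X hX), ← erase_insert (hN Y hY)]
      exact congrArg (fun Z : Finset ℕ => Z.erase N) hXY
    · rw [disjoint_left]
      intro A hA hA'
      obtain ⟨X, hX, rfl⟩ := mem_image.1 hA'
      exact lt_irrefl N (mem_range.1 ((mem_powersetCard.1 hA).1 (mem_insert_self N X)))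
  have h4 : #(colexSeg m (s + 1)) = m := card_colexSeg h2
  exact subset_antisymm
    (isInitSeg_subset_of_card_le (isInitSeg_colexSeg _ _) hinit (by rw [h4, hcard]))
    (isInitSeg_subset_of_card_le hinit (isInitSeg_colexSeg _ _) (by rw [h4, hcard]))

/-- A recursion for the shadow matchings of long colexicographic segments. -/
lemma choose_add_nu_le {N m s : ℕ} (h1 : N.choose (s + 1) ≤ m) (h2 : m ≤ (N + 1).choose (s + 1))
    (hN : 2 * s + 1 ≤ N) :
    N.choose s + nu (colexSeg (m - N.choose (s + 1)) s) ≤ nu (colexSeg m (s + 1)) := by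
  have h3 : m - N.choose (s + 1) ≤ N.choose s := by
    rw [Nat.choose_succ_succ'] at h2; omega
  set P := powersetCard (s + 1) (range N) with hP
  set C := colexSeg (m - N.choose (s + 1)) s with hC
  have hCN : ∀ X ∈ C, N ∉ X := fun X hX hNX =>
    absurd (mem_range.1 ((mem_powersetCard.1 (colexSeg_subset_range h3 hX)).1 hNX)) (lt_irrefl N)
  have hPN : ∀ X ∈ P, N ∉ X := fun X hX hNX =>
    absurd (mem_range.1 ((mem_powersetCard.1 hX).1 hNX)) (lt_irrefl N)
  rw [colexSeg_eq_union h1 h2]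
  refine le_nu fun S hS => ?_
  set S₁ := {X ∈ S | N ∉ X} with hS₁
  set S₂ := ({X ∈ S | N ∈ X}).image (·.erase N) with hS₂
  have hS₁P : S₁ ⊆ P := by
    intro X hX
    obtain ⟨hX1, hX2⟩ := mem_filter.1 hX
    rcases mem_union.1 (hS hX1) with h | h
    · exact h
    · obtain ⟨Y, -, rfl⟩ := mem_image.1 h
      exact absurd (mem_insert_self N Y) hX2
  have hS₂C : S₂ ⊆ C := by
    intro X hX
    obtain ⟨Y, hY, rfl⟩ := mem_image.1 hX
    obtain ⟨hY1, hY2⟩ := mem_filter.1 hY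
    rcases mem_union.1 (hS hY1) with h | h
    · exact absurd hY2 (hPN Y h)
    · obtain ⟨Z, hZ, rfl⟩ := mem_image.1 h
      rwa [erase_insert (hCN Z hZ)]
  have hinsS : ∀ X ∈ S₂, insert N X ∈ S := by
    intro X hX
    obtain ⟨Y, hY, rfl⟩ := mem_image.1 hX
    obtain ⟨hY1, hY2⟩ := mem_filter.1 hY
    rwa [insert_erase hY2]
  -- the part of the segment in `range N`
  have hA : N.choose s ≤ #(P \ S₁) + #(∂ S₁) := by
    set T := powersetCard s (range N) \ ∂ S₁ with hT
    have h4 := card_le_card_upper (T := T) (U := range N) (j := s) sdiff_subset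
      (by rw [card_range]; exact hN)
    have h5 : {y ∈ powersetCard (s + 1) (range N) | ∃ x ∈ T, x ⊆ y} ⊆ P \ S₁ := by
      intro y hy
      obtain ⟨hy1, x, hx, hxy⟩ := mem_filter.1 hy
      refine mem_sdiff.2 ⟨hy1, fun hyS => (mem_sdiff.1 hx).2 ?_⟩
      refine mem_shadow_iff_exists_mem_card_add_one.2 ⟨y, hyS, hxy, ?_⟩
      rw [(mem_powersetCard.1 hy1).2, (mem_powersetCard.1 (mem_sdiff.1 hx).1).2]
    have h6 := card_le_card h5
    have h7 : #(powersetCard s (range N)) ≤ #T + #(∂ S₁) := by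
      have : #(powersetCard s (range N)) - #(∂ S₁) ≤ #T := le_card_sdiff _ _
      omega
    rw [card_powersetCard, card_range] at h7
    omega
  -- the part of the segment containing `N`
  have hB : nu C ≤ #(C \ S₂) + #(∂ S₂) := nu_le (sized_colexSeg _ s) S₂
  have hC1 : #(P \ S₁) + #(C \ S₂) ≤ #((P ∪ C.image (insert N)) \ S) := by
    have hinj : Set.InjOn (insert N) ((C \ S₂ : Finset (Finset ℕ)) : Set (Finset ℕ)) := by
      intro X hX Y hY hXY
      rw [← erase_insert (hCN X (mem_sdiff.1 hX).1), ← erase_insert (hCN Y (mem_sdiff.1 hY).1)]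
      exact congrArg (fun Z : Finset ℕ => Z.erase N) hXY
    rw [← card_image_of_injOn hinj, ← card_union_of_disjoint]
    · refine card_le_card fun X hX => ?_
      rcases mem_union.1 hX with hX | hX
      · rw [mem_sdiff] at hX ⊢
        exact ⟨mem_union_left _ hX.1, fun h => hX.2 (mem_filter.2 ⟨h, hPN X hX.1⟩)⟩
      · obtain ⟨Y, hY, rfl⟩ := mem_image.1 hX
        rw [mem_sdiff] at hY ⊢
        refine ⟨mem_union_right _ (mem_image_of_mem _ hY.1), fun h => hY.2 ?_⟩
        exact mem_image.2 ⟨_, mem_filter.2 ⟨h, mem_insert_self N Y⟩, erase_insert (hCN Y hY.1)⟩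
    · rw [disjoint_left]
      intro A hA hA'
      obtain ⟨X, hX, rfl⟩ := mem_image.1 hA'
      exact hPN _ (mem_sdiff.1 hA).1 (mem_insert_self N X)
  have hC2 : #(∂ S₁) + #(∂ S₂) ≤ #(∂ S) := by
    have hN1 : ∀ X ∈ ∂ S₁, N ∉ X := fun X hX h => by
      obtain ⟨Y, hY, hXY⟩ := exists_subset_of_mem_shadow hX
      exact hPN Y (hS₁P hY) (hXY h)
    have hN2 : ∀ X ∈ ∂ S₂, N ∉ X := fun X hX h => by
      obtain ⟨Y, hY, hXY⟩ := exists_subset_of_mem_shadow hX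
      exact hCN Y (hS₂C hY) (hXY h)
    have hinj : Set.InjOn (insert N) ((∂ S₂ : Finset (Finset ℕ)) : Set (Finset ℕ)) := by
      intro X hX Y hY hXY
      rw [← erase_insert (hN2 X hX), ← erase_insert (hN2 Y hY)]
      exact congrArg (fun Z : Finset ℕ => Z.erase N) hXY
    rw [← card_image_of_injOn hinj, ← card_union_of_disjoint]
    · refine card_le_card fun X hX => ?_
      rcases mem_union.1 hX with hX | hX
      · exact shadow_mono (filter_subset _ _) hX
      · obtain ⟨Y, hY, rfl⟩ := mem_image.1 hX
        obtain ⟨a, ha, haY⟩ := mem_shadow_iff_insert_mem.1 hY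
        have haN : a ≠ N := by
          rintro rfl
          exact hCN _ (hS₂C haY) (mem_insert_self _ _)
        refine mem_shadow_iff_insert_mem.2 ⟨a, by simp [haN, ha], ?_⟩
        rw [insert_comm]
        exact hinsS _ haY
    · rw [disjoint_left]
      intro A hA hA'
      obtain ⟨X, hX, rfl⟩ := mem_image.1 hA'
      exact hN1 _ hA (mem_insert_self N X)
  refine (add_le_add hA hB).trans (le_trans ?_ (add_le_add hC1 hC2))
  omega

end Nu

/-! ### The lower bound -/

section Compl

variable {n k : ℕ} {F : Finset (Finset (Fin n))} {f : Finset (Fin n) → Finset (Fin n) → ℝ}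

lemma image_compl_compl (F : Finset (Finset (Fin n))) : (F.image (·ᶜ)).image (·ᶜ) = F := by
  ext X
  simp

lemma mem_image_compl {X : Finset (Fin n)} : X ∈ F.image (·ᶜ) ↔ Xᶜ ∈ F := by
  rw [mem_image]
  constructor
  · rintro ⟨Y, hY, rfl⟩
    simpa using hY
  · intro h
    exact ⟨_, h, compl_compl X⟩

lemma HasAntichain.compl (h : HasAntichain k F) : HasAntichain k (F.image (·ᶜ)) := by
  obtain ⟨A, hA, hc, hanti⟩ := h
  refine ⟨A.image (·ᶜ), image_subset_image hA, ?_, ?_⟩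
  · rw [card_image_of_injective _ compl_injective, hc]
  · intro X hX Y hY hne hXY
    rw [mem_coe, mem_image_compl] at hX hY
    exact hanti hY hX (fun h => hne (compl_injective h.symm)) (compl_subset_compl.2 hXY)

lemma IsAntichainSaturated.compl (h : IsAntichainSaturated k F) :
    IsAntichainSaturated k (F.image (·ᶜ)) := by
  refine ⟨fun h' => h.1 ?_, fun X hX => ?_⟩
  · simpa only [image_compl_compl] using h'.compl
  · rw [mem_image_compl] at hX
    have := (h.2 _ hX).compl
    rwa [image_insert, compl_compl] at this

lemma IsFlow.compl_ind {w : ℝ} (h : IsFlow F w (ind F) f) :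
    IsFlow (F.image (·ᶜ)) w (ind (F.image (·ᶜ))) (fun x y => f yᶜ xᶜ) := by
  have e : ind (F.image (·ᶜ)) = fun x => ind F xᶜ := by
    funext x
    unfold ind
    simp only [mem_image_compl]
  rw [e]
  exact h.compl

lemma card_slice_compl {t s : ℕ} (hts : t + s = n) : #((F.image (·ᶜ)) # t) = #(F # s) := by
  rw [← card_image_of_injective (F # s) compl_injective]
  congr 1
  ext X
  simp only [mem_slice, mem_image_compl (F := F), mem_image_compl (F := F # s), card_compl,
    Fintype.card_fin]
  have := card_le_univ X
  rw [Fintype.card_fin] at this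
  refine and_congr_right fun _ => ?_
  omega

lemma IsFlow.levelFlow_compl {w : ℝ} {μ : Finset (Fin n) → ℝ} (h : IsFlow F w μ f) {t s : ℕ}
    (hts : t + s + 1 = n) : levelFlow (fun x y => f yᶜ xᶜ) t = levelFlow f s := by
  rw [h.levelFlow_eq_in, levelFlow, ← sum_compl_eq]
  refine sum_congr rfl fun x _ => ?_
  have := card_le_univ x
  rw [card_compl, compl_compl, sum_compl_eq fun y => f y x]
  rw [Fintype.card_fin] at *
  have e : n - #x = t ↔ #x = s + 1 := by omega
  simp only [e]

end Compl

section Lower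

variable {n w : ℕ} {F : Finset (Finset (Fin n))} {f : Finset (Fin n) → Finset (Fin n) → ℝ}

lemma sum_levelFlow : ∑ t ∈ range (n + 1), levelFlow f t = ∑ x, ∑ y, f x y := by
  unfold levelFlow
  rw [sum_comm]
  refine sum_congr rfl fun x _ => ?_
  have := card_le_univ x
  rw [Fintype.card_fin] at this
  rw [sum_ite_eq, if_pos (mem_range.2 (by omega))]

lemma sum_card_slice_range (F : Finset (Finset (Fin n))) :
    ∑ t ∈ range (n + 1), #(F # t) = #F := by
  have := sum_card_slice F
  rwa [Fintype.card_fin, ← Nat.range_succ_eq_Iic] at this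

lemma slice_subset_powersetCard (F : Finset (Finset (Fin n))) (t : ℕ) :
    F # t ⊆ powersetCard t univ :=
  fun _ hX => mem_powersetCard.2 ⟨subset_univ _, (mem_slice.1 hX).2⟩

lemma card_slice_succ_le_levelFlow (hF : IsAntichainSaturated (w + 1) F) (hw : HasAntichain w F)
    (h : IsFlow F (w : ℝ) (ind F) f) {t : ℕ} (ht : n < 2 * (t + 1)) :
    (#(F # (t + 1)) : ℝ) ≤ levelFlow f t := by
  obtain ⟨S, hS, heq⟩ := exists_levelFlow_eq hF hw h t
  have h1 := card_le_card_shadow (hS.trans (slice_subset_powersetCard F (t + 1)))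
    (by rw [card_univ, Fintype.card_fin]; omega)
  have h2 := card_sdiff_add_card_eq_card hS
  rw [heq, ← h2]
  push_cast
  have : (#S : ℝ) ≤ #(∂ S) := by exact_mod_cast h1
  linarith

lemma card_slice_le_levelFlow (hF : IsAntichainSaturated (w + 1) F) (hw : HasAntichain w F)
    (h : IsFlow F (w : ℝ) (ind F) f) {t : ℕ} (ht : 2 * t < n) :
    (#(F # t) : ℝ) ≤ levelFlow f t := by
  have h1 := card_slice_succ_le_levelFlow hF.compl hw.compl h.compl_ind (t := n - t - 1) (by omega)
  rwa [h.levelFlow_compl (s := t) (by omega), card_slice_compl (s := t) (by omega)] at h1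

/-- The value of a flow on the family `F`, level by level, as seen from the level `m`. -/
lemma card_sub_sum_levelFlow (F : Finset (Finset (Fin n)))
    (f : Finset (Fin n) → Finset (Fin n) → ℝ) {m r : ℕ} (hr : n = m + r) :
    (#F : ℝ) - ∑ t ∈ range (n + 1), levelFlow f t =
      ∑ t ∈ range m, (#(F # t) - levelFlow f t : ℝ) + #(F # m) -
        ∑ t ∈ range r, (levelFlow f (m + t) - #(F # (m + t + 1)) : ℝ) - levelFlow f n := by
  have e1 : (#F : ℝ) = ∑ t ∈ range m, (#(F # t) : ℝ) +
      (∑ t ∈ range r, (#(F # (m + t + 1)) : ℝ) + #(F # m)) := by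
    rw [← sum_card_slice_range F]
    push_cast
    rw [show n + 1 = m + (r + 1) by omega, sum_range_add, sum_range_succ']
    simp only [add_assoc, add_zero]
  have e2 : ∑ t ∈ range (n + 1), levelFlow f t = ∑ t ∈ range m, levelFlow f t +
      (∑ t ∈ range r, levelFlow f (m + t) + levelFlow f n) := by
    rw [show n + 1 = m + (r + 1) by omega, sum_range_add, sum_range_succ, ← hr]
  rw [e1, e2, sum_sub_distrib, sum_sub_distrib]
  ring

/-- The middle level of a saturated family is as large as possible: all chains pass through it. -/
lemma le_card_slice_middle (hF : IsAntichainSaturated (w + 1) F) (hw : HasAntichain w F) :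
    w ≤ #(F # (n / 2)) := by
  obtain ⟨f, h⟩ := exists_unit_flow hF
  obtain ⟨r, hr⟩ := Nat.exists_eq_add_of_le (Nat.div_le_self n 2)
  have e3 : ∑ t ∈ range (n / 2), (#(F # t) - levelFlow f t : ℝ) ≤ 0 :=
    sum_nonpos fun t ht => sub_nonpos.2
      (card_slice_le_levelFlow hF hw h (by have := mem_range.1 ht; omega))
  have e4 : 0 ≤ ∑ t ∈ range r, (levelFlow f (n / 2 + t) - #(F # (n / 2 + t + 1)) : ℝ) :=
    sum_nonneg fun t _ => sub_nonneg.2 (card_slice_succ_le_levelFlow hF hw h (by omega))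
  have e5 : 0 ≤ levelFlow f n := sum_nonneg fun x _ => by
    split_ifs
    · exact sum_nonneg fun y _ => h.nonneg x y
    · exact le_rfl
  obtain ⟨U, hUF, hUw, hU⟩ := hw
  have h' : IsFlow F (#F - ∑ x, ∑ y, f x y) (ind F) f :=
    ⟨h.nonneg, h.supp, h.out_le, h.in_le, h.one_le, by rw [sum_ind]⟩
  have e6 := h'.card_antichain_le hUF hU
  rw [hUw, ← sum_levelFlow, card_sub_sum_levelFlow F f hr] at e6
  have : (w : ℝ) ≤ #(F # (n / 2)) := by linarith
  exact_mod_cast this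

end Lower

section C

lemma choose_middle_mono {m n : ℕ} (h : m ≤ n) : m.choose (m / 2) ≤ n.choose (n / 2) :=
  (Nat.choose_le_choose _ h).trans (Nat.choose_le_middle _ _)

lemma le_choose_of_ell_le {k n : ℕ} (h : ell k ≤ n) : k - 1 ≤ n.choose (n / 2) :=
  le_trans (ell_isLeast k).1 (choose_middle_mono h)

lemma c_of_le {k t : ℕ} (h : ell k / 2 ≤ t) : c k t = k - 1 := by
  rw [c, if_neg (not_lt.2 h)]

lemma le_choose_of_half_le {k t : ℕ} (h : ell k / 2 ≤ t) :
    k - 1 ≤ (2 * (t + 1) - 1).choose (t + 1) := by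
  have h1 := le_choose_of_ell_le (k := k) (n := 2 * t + 1) (by omega)
  rwa [show (2 * t + 1) / 2 = t by omega, ← Nat.choose_symm_of_eq_add
    (show 2 * t + 1 = (t + 1) + t by ring)] at h1

/-- Above `ell k / 2` the sequence `c k` is constant, and the inequality persists because segments of
this length are matched completely. -/
lemma c_le_nu (k t : ℕ) : c k t ≤ nu (colexSeg (c k (t + 1)) (t + 1)) := by
  by_cases h : t < ell k / 2
  · exact (c_of_lt k t h).le
  · rw [c_of_le (not_lt.1 h), c_of_le (show ell k / 2 ≤ t + 1 by omega)]
    exact le_nu_colexSeg (by omega) (le_choose_of_half_le (not_lt.1 h))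

variable {n w : ℕ} {F : Finset (Finset (Fin n))}

/-- The levels of a saturated family below the middle. -/
lemma c_le_card_slice (hn : ell (w + 1) ≤ n) (hF : IsAntichainSaturated (w + 1) F)
    (hw : HasAntichain w F) {t : ℕ} (ht : t ≤ n / 2) : c (w + 1) t ≤ #(F # t) := by
  obtain ⟨f, h⟩ := exists_unit_flow hF
  refine Nat.decreasingInduction' (P := fun t => c (w + 1) t ≤ #(F # t)) (fun s hs _ ih => ?_) ht ?_
  · obtain ⟨S, hS, heq⟩ := exists_levelFlow_eq hF hw h s
    have h1 := h.levelFlow_le_card s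
    rw [heq] at h1
    have h2 : #((F # (s + 1)) \ S) + #(∂ S) ≤ #(F # s) := by exact_mod_cast h1
    refine (c_le_nu (w + 1) s).trans (le_trans ?_ h2)
    have h3 := card_sdiff_add_card_eq_card hS
    refine nu_colexSeg_le (fun X hX => (mem_slice.1 (hS hX)).2) (ih.trans ?_) (by omega)
    refine (card_le_card (slice_subset_powersetCard F (s + 1))).trans ?_
    rw [card_powersetCard, card_univ, Fintype.card_fin]
  · rw [c_of_le (Nat.div_le_div_right hn)]
    exact le_card_slice_middle hF hw

lemma hasAntichain_of_saturated (hn : ell (w + 1) ≤ n) (hF : IsAntichainSaturated (w + 1) F) :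
    HasAntichain w F := by
  by_cases h : F = univ
  · obtain ⟨A, hA, hAw⟩ := exists_subset_card_eq (s := powersetCard (n / 2) (univ : Finset (Fin n)))
      (n := w) (by
        rw [card_powersetCard, card_univ, Fintype.card_fin]
        exact le_choose_of_ell_le (k := w + 1) hn)
    refine ⟨A, by rw [h]; exact subset_univ _, hAw, ?_⟩
    have : (A : Set (Finset (Fin n))).Sized (n / 2) := fun X hX => (mem_powersetCard.1 (hA hX)).2
    exact this.isAntichain
  · obtain ⟨X, hX⟩ : ∃ X, X ∉ F := by
      by_contra! h'
      exact h (eq_univ_of_forall h')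
    obtain ⟨A, hA, hAw, hanti⟩ := hF.2 X hX
    have h1 : A.erase X ⊆ F := fun Y hY =>
      (mem_insert.1 (hA (mem_of_mem_erase hY))).resolve_left (ne_of_mem_erase hY)
    obtain ⟨B, hB, hBw⟩ := exists_subset_card_eq (s := A.erase X) (n := w) (by
      have := pred_card_le_card_erase (s := A) (a := X)
      omega)
    exact ⟨B, hB.trans h1, hBw, hanti.subset (coe_subset.2 (hB.trans (erase_subset _ _)))⟩

lemma sum_c_eq {k m : ℕ} (h : ell k / 2 ≤ m) (hk : 1 ≤ k) :
    (∑ t ∈ range m, (c k t : ℤ)) = ∑ t ∈ range (ell k / 2 + 1), (c k t : ℤ) +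
      ((k : ℤ) - 1) * ((m : ℤ) - 1 - (ell k / 2 : ℕ)) := by
  obtain ⟨r, rfl⟩ := Nat.exists_eq_add_of_le h
  rw [sum_range_add, sum_range_succ, c_top]
  have : ∀ i ∈ range r, (c k (ell k / 2 + i) : ℤ) = (k : ℤ) - 1 := by
    intro i _
    rw [c_of_le (by omega)]
    omega
  rw [sum_congr rfl this, sum_const, card_range, nsmul_eq_mul]
  push_cast [Nat.cast_sub hk]
  ring

lemma satBound_eq {k : ℕ} (hk : 1 ≤ k) (hn : ell k ≤ n) :
    satBound n k = ∑ t ∈ range (n / 2 + 1), (c k t : ℤ) + ∑ t ∈ range (n - n / 2), (c k t : ℤ) := by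
  have : ell k / 2 ≤ n / 2 := Nat.div_le_div_right hn
  rw [sum_c_eq (by omega) hk, sum_c_eq (m := n - n / 2) (by omega) hk, satBound]
  have h1 : ((n - n / 2 : ℕ) : ℤ) = (n : ℤ) - (n / 2 : ℕ) := by omega
  rw [h1]
  push_cast
  ring

/-- The levels of a family, counted from the bottom up to the middle and from the top down. -/
lemma card_eq_sum_slices (F : Finset (Finset (Fin n))) :
    #F = ∑ t ∈ range (n / 2 + 1), #(F # t) + ∑ t ∈ range (n - n / 2), #((F.image (·ᶜ)) # t) := by
  rw [← sum_card_slice_range F]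
  have e : n + 1 = (n / 2 + 1) + (n - n / 2) := by omega
  rw [e, sum_range_add]
  congr 1
  rw [← sum_range_reflect]
  refine sum_congr rfl fun t ht => ?_
  have := mem_range.1 ht
  rw [card_slice_compl (s := n / 2 + 1 + (n - n / 2 - 1 - t)) (by omega)]

theorem satBound_le_card {k : ℕ} (hk : 1 ≤ k) (hn : ell k ≤ n) (hF : IsAntichainSaturated k F) :
    satBound n k ≤ #F := by
  obtain ⟨w, rfl⟩ := Nat.exists_eq_add_of_le' hk
  have hw := hasAntichain_of_saturated hn hF
  rw [satBound_eq hk hn, card_eq_sum_slices]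
  push_cast
  refine add_le_add (sum_le_sum fun t ht => ?_) (sum_le_sum fun t ht => ?_)
  · have := mem_range.1 ht
    exact_mod_cast c_le_card_slice hn hF hw (by omega)
  · have := mem_range.1 ht
    exact_mod_cast c_le_card_slice hn hF.compl hw.compl (by omega)

end C

/-! ### The bottom levels of an extremal family -/

section Bottom

variable {α : Type*} [DecidableEq α]

/-- Below the middle of the cube over `U`, families are matched into the next level. -/
lemma exists_injOn_upper {T : Finset (Finset α)} {U : Finset α} {j : ℕ}
    (hT : T ⊆ powersetCard j U) (hU : 2 * j + 1 ≤ #U) :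
    ∃ φ : Finset α → Finset α, Set.InjOn φ (T : Set (Finset α)) ∧
      ∀ x ∈ T, φ x ∈ powersetCard (j + 1) U ∧ x ⊆ φ x := by
  obtain ⟨A, hAT, hcard, φ, hinj, hφ⟩ := exists_partial_matching T
    (fun x => {y ∈ powersetCard (j + 1) U | x ⊆ y}) #T (by
      intro S hS
      have h1 := card_le_card_upper (hS.trans hT) hU
      have h2 : {y ∈ powersetCard (j + 1) U | ∃ x ∈ S, x ⊆ y} ⊆
          S.biUnion fun x => {y ∈ powersetCard (j + 1) U | x ⊆ y} := by
        intro y hy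
        obtain ⟨hy1, x, hx, hxy⟩ := mem_filter.1 hy
        exact mem_biUnion.2 ⟨x, hx, mem_filter.2 ⟨hy1, hxy⟩⟩
      have h3 := card_le_card h2
      have h4 := card_sdiff_add_card_eq_card hS
      omega)
  obtain rfl := eq_of_subset_of_card_le hAT hcard
  exact ⟨φ, hinj, fun x hx => mem_filter.1 (hφ x hx)⟩

/-- The families `B 0, …, B s`, where `B j` consists of `j`-subsets of `U`, can serve as the lowest
levels of an antichain saturated family whose level `s` has size `m`: each family embeds into the
next one along inclusions, the size of each is bounded below by a vertex cover of the bipartite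
graph between the next one and its shadow, and bounded above by the shadow matching number of a
colexicographic segment. -/
structure IsBottom (B : ℕ → Finset (Finset α)) (s m : ℕ) (U : Finset α) : Prop where
  subset : ∀ j ≤ s, B j ⊆ powersetCard j U
  card_top : #(B s) = m
  exists_injOn : ∀ j < s, ∃ φ : Finset α → Finset α, Set.InjOn φ (B j : Set (Finset α)) ∧
    ∀ x ∈ B j, φ x ∈ B (j + 1) ∧ x ⊆ φ x
  exists_cover : ∀ j < s, ∃ S ⊆ B (j + 1), #(B (j + 1) \ S) + #(∂ S) ≤ #(B j)
  card_le_nu : ∀ j < s, #(B j) ≤ nu (colexSeg #(B (j + 1)) (j + 1))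

/-- A short top level is placed above the bottom levels of smaller height. -/
lemma IsBottom.lift {B : ℕ → Finset (Finset α)} {s m : ℕ} {U : Finset α}
    (hB : IsBottom B s m U) (hU : 2 * s + 1 ≤ #U) (hm : m ≤ (2 * s + 1).choose (s + 1)) :
    ∃ B', IsBottom B' (s + 1) m U := by
  obtain ⟨φ, hinj, hφ⟩ := exists_injOn_upper (hB.subset s le_rfl) hU
  set C := (B s).image φ with hC
  have hCcard : #C = m := by rw [hC, card_image_of_injOn hinj, hB.card_top]
  refine ⟨fun j => if j ≤ s then B j else C, ?_, ?_, ?_, ?_, ?_⟩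
  · intro j hj
    by_cases h : j ≤ s
    · simpa [h] using hB.subset j h
    · obtain rfl : j = s + 1 := by omega
      intro X hX
      simp only [h, if_false] at hX
      obtain ⟨x, hx, rfl⟩ := mem_image.1 hX
      exact (hφ x hx).1
  · simpa using hCcard
  · intro j hj
    rcases Nat.lt_succ_iff_lt_or_eq.1 hj with h | rfl
    · simpa [h.le, Nat.succ_le_of_lt h] using hB.exists_injOn j h
    · simp only [le_refl, if_true, Nat.not_succ_le_self, if_false]
      exact ⟨φ, hinj, fun x hx => ⟨mem_image_of_mem _ hx, (hφ x hx).2⟩⟩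
  · intro j hj
    rcases Nat.lt_succ_iff_lt_or_eq.1 hj with h | rfl
    · simpa [h.le, Nat.succ_le_of_lt h] using hB.exists_cover j h
    · simp only [le_refl, if_true, Nat.not_succ_le_self, if_false]
      exact ⟨∅, empty_subset _, by simp [hCcard, hB.card_top]⟩
  · intro j hj
    rcases Nat.lt_succ_iff_lt_or_eq.1 hj with h | rfl
    · simpa [h.le, Nat.succ_le_of_lt h] using hB.card_le_nu j h
    · simp only [le_refl, if_true, Nat.not_succ_le_self, if_false]
      rw [hCcard, hB.card_top]
      exact le_nu_colexSeg (by omega) hm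

lemma injOn_insert_of_notMem {u : α} {𝒜 : Finset (Finset α)} (h : ∀ X ∈ 𝒜, u ∉ X) :
    Set.InjOn (insert u) (𝒜 : Set (Finset α)) := by
  intro X hX Y hY hXY
  rw [← erase_insert (h X hX), ← erase_insert (h Y hY)]
  exact congrArg (fun Z : Finset α => Z.erase u) hXY

/-- All subsets of `U` are added to the bottom levels, which are joined with a new element. -/
lemma IsBottom.join {B : ℕ → Finset (Finset α)} {s m : ℕ} {U : Finset α} {u : α}
    (hB : IsBottom B s m U) (hu : u ∉ U) (hU : 2 * s + 1 ≤ #U) :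
    ∃ B', IsBottom B' (s + 1) ((#U).choose (s + 1) + m) (insert u U) := by
  have huB : ∀ j ≤ s, ∀ X ∈ B j, u ∉ X := fun j hj X hX h =>
    hu ((mem_powersetCard.1 (hB.subset j hj hX)).1 h)
  have huP : ∀ j, ∀ X ∈ powersetCard j U, u ∉ X := fun j X hX h =>
    hu ((mem_powersetCard.1 hX).1 h)
  set B' : ℕ → Finset (Finset α) := fun j =>
    powersetCard j U ∪ Nat.casesOn j ∅ fun i => (B i).image (insert u) with hB'
  have hB0 : B' 0 = powersetCard 0 U := union_empty _
  have hBs : ∀ j, B' (j + 1) = powersetCard (j + 1) U ∪ (B j).image (insert u) := fun _ => rfl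
  have hdisj : ∀ i, ∀ 𝒜 : Finset (Finset α), Disjoint (powersetCard i U) (𝒜.image (insert u)) := by
    intro i 𝒜
    rw [disjoint_left]
    intro A hA hA'
    obtain ⟨X, hX, rfl⟩ := mem_image.1 hA'
    exact huP _ _ hA (mem_insert_self u X)
  have hcard0 : #(B' 0) = 1 := by rw [hB0, card_powersetCard, Nat.choose_zero_right]
  have hcard : ∀ j ≤ s, #(B' (j + 1)) = (#U).choose (j + 1) + #(B j) := by
    intro j hj
    rw [hBs, card_union_of_disjoint (hdisj _ _), card_powersetCard,
      card_image_of_injOn (injOn_insert_of_notMem (huB j hj))]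
  refine ⟨B', ?_, ?_, ?_, ?_, ?_⟩
  · rintro (_ | j) hj
    · rw [hB0, powersetCard_zero, powersetCard_zero]
    · rw [hBs]
      refine union_subset (powersetCard_mono (subset_insert u U)) fun A hA => ?_
      obtain ⟨X, hX, rfl⟩ := mem_image.1 hA
      have hX' := mem_powersetCard.1 (hB.subset j (by omega) hX)
      exact mem_powersetCard.2 ⟨insert_subset_insert u hX'.1,
        by rw [card_insert_of_notMem (huB j (by omega) X hX), hX'.2]⟩
  · rw [hcard s le_rfl, hB.card_top]
  · intro j hj
    obtain ⟨ψ, hψinj, hψ⟩ := exists_injOn_upper (subset_refl (powersetCard j U))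
      (by omega : 2 * j + 1 ≤ #U)
    rcases j with _ | j
    · refine ⟨ψ, by rwa [hB0], fun x hx => ?_⟩
      rw [hB0] at hx
      exact ⟨mem_union_left _ (hψ x hx).1, (hψ x hx).2⟩
    · obtain ⟨φ, hφinj, hφ⟩ := hB.exists_injOn j (by omega)
      have hin : ∀ x ∈ B' (j + 1), u ∈ x → x.erase u ∈ B j := by
        intro x hx hux
        rcases mem_union.1 (hBs j ▸ hx) with h | h
        · exact absurd hux (huP _ _ h)
        · obtain ⟨y, hy, rfl⟩ := mem_image.1 h
          rwa [erase_insert (huB j (by omega) y hy)]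
      have hout : ∀ x ∈ B' (j + 1), u ∉ x → x ∈ powersetCard (j + 1) U := by
        intro x hx hux
        rcases mem_union.1 (hBs j ▸ hx) with h | h
        · exact h
        · obtain ⟨y, hy, rfl⟩ := mem_image.1 h
          exact absurd (mem_insert_self u y) hux
      refine ⟨fun x => if u ∈ x then insert u (φ (x.erase u)) else ψ x, ?_, ?_⟩
      · have hψu : ∀ x ∈ B' (j + 1), u ∉ x → u ∉ ψ x := fun x hx hux =>
          huP _ _ (hψ x (hout x hx hux)).1
        intro x hx y hy hxy
        dsimp only at hxy
        by_cases hux : u ∈ x <;> by_cases huy : u ∈ y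
        · rw [if_pos hux, if_pos huy] at hxy
          have hx' := hin x hx hux
          have hy' := hin y hy huy
          have h1 := injOn_insert_of_notMem (huB (j + 1) (by omega)) (mem_coe.2 (hφ _ hx').1)
            (mem_coe.2 (hφ _ hy').1) hxy
          rw [← insert_erase hux, ← insert_erase huy, hφinj (mem_coe.2 hx') (mem_coe.2 hy') h1]
        · rw [if_pos hux, if_neg huy] at hxy
          exact absurd (hxy ▸ mem_insert_self _ _) (hψu y hy huy)
        · rw [if_neg hux, if_pos huy] at hxy
          exact absurd (hxy.symm ▸ mem_insert_self _ _) (hψu x hx hux)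
        · rw [if_neg hux, if_neg huy] at hxy
          exact hψinj (mem_coe.2 (hout x hx hux)) (mem_coe.2 (hout y hy huy)) hxy
      · intro x hx
        dsimp only
        rw [hBs (j + 1)]
        by_cases hux : u ∈ x
        · rw [if_pos hux]
          have h1 := hφ _ (hin x hx hux)
          refine ⟨mem_union_right _ (mem_image_of_mem _ h1.1), ?_⟩
          rw [← insert_erase hux, erase_insert_eq_erase, erase_idem]
          exact insert_subset_insert u h1.2
        · rw [if_neg hux]
          have h1 := hψ _ (hout x hx hux)
          exact ⟨mem_union_left _ h1.1, h1.2⟩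
  · rintro (_ | j) hj
    · refine ⟨B' 1, subset_rfl, ?_⟩
      rw [zero_add, Finset.sdiff_self, hcard0]
      have : ∂ (B' 1) ⊆ {∅} := by
        intro x hx
        obtain ⟨y, hy, -, hc⟩ := mem_shadow_iff_exists_mem_card_add_one.1 hx
        have hy1 : #y = 1 := by
          rcases mem_union.1 (hBs 0 ▸ hy) with h | h
          · exact (mem_powersetCard.1 h).2
          · obtain ⟨z, hz, rfl⟩ := mem_image.1 h
            rw [card_insert_of_notMem (huB 0 (by omega) z hz),
              (mem_powersetCard.1 (hB.subset 0 (by omega) hz)).2]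
        exact mem_singleton.2 (card_eq_zero.1 (by omega))
      simpa using card_le_card this
    · obtain ⟨S, hS, hSle⟩ := hB.exists_cover j (by omega)
      refine ⟨powersetCard (j + 2) U ∪ S.image (insert u), ?_, ?_⟩
      · rw [hBs]
        exact union_subset_union subset_rfl (image_subset_image hS)
      · have h1 : B' (j + 1 + 1) \ (powersetCard (j + 2) U ∪ S.image (insert u)) ⊆
            (B (j + 1) \ S).image (insert u) := by
          intro x hx
          rw [mem_sdiff, hBs, mem_union, mem_union, not_or] at hx
          obtain ⟨y, hy, rfl⟩ := mem_image.1 (hx.1.resolve_left hx.2.1)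
          exact mem_image_of_mem _ (mem_sdiff.2 ⟨hy, fun h => hx.2.2 (mem_image_of_mem _ h)⟩)
        have h2 : ∂ (powersetCard (j + 2) U ∪ S.image (insert u)) ⊆
            powersetCard (j + 1) U ∪ (∂ S).image (insert u) := by
          rw [shadow_union]
          refine union_subset (fun x hx => mem_union_left _ ?_) fun x hx => ?_
          · obtain ⟨y, hy, hxy, hc⟩ := mem_shadow_iff_exists_mem_card_add_one.1 hx
            have hy' := mem_powersetCard.1 hy
            exact mem_powersetCard.2 ⟨hxy.trans hy'.1, by omega⟩
          · obtain ⟨z, hz, a, ha, rfl⟩ := mem_shadow_iff.1 hx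
            obtain ⟨y, hy, rfl⟩ := mem_image.1 hz
            have huy := huB (j + 1) (by omega) y (hS hy)
            by_cases hau : a = u
            · subst hau
              rw [erase_insert huy]
              exact mem_union_left _ (hB.subset (j + 1) (by omega) (hS hy))
            · refine mem_union_right _ (mem_image.2 ⟨y.erase a, erase_mem_shadow hy
                ((mem_insert.1 ha).resolve_left hau), ?_⟩)
              rw [erase_insert_of_ne (Ne.symm hau)]
        have h3 := (card_le_card h1).trans card_image_le
        have h4 := (card_le_card h2).trans (card_union_le _ _)
        have h5 := card_image_le (s := ∂ S) (f := insert u)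
        rw [card_powersetCard] at h4
        have h6 := hcard j (by omega)
        omega
  · intro j hj
    have h1 : #(B j) ≤ (#U).choose j := by
      have := card_le_card (hB.subset j (by omega))
      rwa [card_powersetCard] at this
    have h2 := choose_add_nu_le (N := #U) (m := #(B' (j + 1))) (s := j)
      (by rw [hcard j (by omega)]; omega)
      (by rw [hcard j (by omega), Nat.choose_succ_succ']; omega) (by omega)
    refine le_trans ?_ h2
    rw [show #(B' (j + 1)) - (#U).choose (j + 1) = #(B j) by rw [hcard j (by omega)]; omega]
    rcases j with _ | j
    · rw [hcard0, Nat.choose_zero_right]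
      omega
    · rw [hcard j (by omega)]
      exact Nat.add_le_add_left (hB.card_le_nu j (by omega)) _

/-- Bottom levels exist for every size that fits into `U`. If the top level is small, it is lifted from
the level below. Otherwise it consists of all subsets of the largest possible `V ⊆ U` and of sets
that contain one more element, which are treated by induction. -/
theorem exists_isBottom (s : ℕ) : ∀ (m : ℕ) (U : Finset α), 2 * s ≤ #U + 1 →
    m ≤ (#U).choose s → ∃ B, IsBottom B s m U := by
  induction s with
  | zero =>
    intro m U _ hm
    obtain ⟨C, hC, hCm⟩ := exists_subset_card_eq (s := powersetCard 0 U) (n := m)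
      (by rwa [card_powersetCard])
    refine ⟨fun _ => C, ?_, hCm, ?_, ?_, ?_⟩
    · intro j hj
      obtain rfl : j = 0 := by omega
      exact hC
    all_goals
      intro j hj
      omega
  | succ s ih =>
    intro m U hU hm
    by_cases hlow : m ≤ (2 * s + 1).choose (s + 1)
    · obtain ⟨B, hB⟩ := ih m U (by omega) (hlow.trans (by
        rw [Nat.choose_symm_of_eq_add (show 2 * s + 1 = (s + 1) + s by ring)]
        exact Nat.choose_le_choose s (by omega)))
      exact hB.lift (by omega) hlow
    · -- the largest `N` such that all `s + 1`-subsets of an `N`-set can be used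
      have hex : ∃ M : ℕ, m ≤ M.choose (s + 1) := ⟨_, hm⟩
      set M := Nat.find hex with hM
      have hMm : m ≤ M.choose (s + 1) := Nat.find_spec hex
      have hMU : M ≤ #U := Nat.find_min' hex hm
      have hMs : 2 * s + 1 < M := by
        by_contra h
        exact hlow (hMm.trans (Nat.choose_le_choose _ (not_lt.1 h)))
      obtain ⟨N, hN⟩ : ∃ N, M = N + 1 := ⟨M - 1, by omega⟩
      have hNm : N.choose (s + 1) < m := not_le.1 (Nat.find_min hex (m := N) (by omega))
      obtain ⟨V, hVU, hV⟩ := exists_subset_card_eq hMU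
      obtain ⟨u, hu⟩ := card_pos.1 (by omega : 0 < #V)
      have hVe : #(V.erase u) = N := by rw [card_erase_of_mem hu, hV, hN]; rfl
      rw [hN, Nat.choose_succ_succ'] at hMm
      obtain ⟨B, hB⟩ := ih (m - N.choose (s + 1)) (V.erase u) (by omega) (by rw [hVe]; omega)
      obtain ⟨B', hB'⟩ := hB.join (notMem_erase u V) (by omega)
      rw [hVe, insert_erase hu, Nat.add_sub_cancel' hNm.le] at hB'
      exact ⟨B', fun j hj => (hB'.subset j hj).trans (powersetCard_mono hVU), hB'.card_top,
        hB'.exists_injOn, hB'.exists_cover, hB'.card_le_nu⟩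

/-- The antichains in the bottom levels embed into the highest of these levels. -/
lemma IsBottom.exists_injOn_antichain {B : ℕ → Finset (Finset α)} {s m : ℕ} {U : Finset α}
    (hB : IsBottom B s m U) : ∀ j ≤ s, ∀ A : Finset (Finset α),
    IsAntichain (· ⊆ ·) (A : Set (Finset α)) → (∀ x ∈ A, ∃ i ≤ j, x ∈ B i) →
    ∃ ψ : Finset α → Finset α, Set.InjOn ψ (A : Set (Finset α)) ∧ ∀ x ∈ A, ψ x ∈ B j ∧ x ⊆ ψ x := by
  intro j
  induction j with
  | zero =>
    intro _ A _ hA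
    refine ⟨id, Set.injOn_id _, fun x hx => ⟨?_, subset_rfl⟩⟩
    obtain ⟨i, hi, hx⟩ := hA x hx
    obtain rfl : i = 0 := by omega
    exact hx
  | succ j ih =>
    intro hj A hanti hA
    obtain ⟨φ, hφinj, hφ⟩ := hB.exists_injOn j (by omega)
    obtain ⟨ψ, hψinj, hψ⟩ := ih (by omega) {x ∈ A | x ∉ B (j + 1)}
      (hanti.subset (coe_subset.2 (filter_subset _ _))) (by
        intro x hx
        rw [mem_filter] at hx
        obtain ⟨i, hi, hxi⟩ := hA x hx.1
        refine ⟨i, ?_, hxi⟩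
        by_contra h
        obtain rfl : i = j + 1 := by omega
        exact hx.2 hxi)
    have hlow : ∀ x ∈ A, x ∉ B (j + 1) →
        φ (ψ x) ∈ B (j + 1) ∧ x ⊆ φ (ψ x) := by
      intro x hx hxB
      have h1 := hψ x (mem_filter.2 ⟨hx, hxB⟩)
      have h2 := hφ _ h1.1
      exact ⟨h2.1, h1.2.trans h2.2⟩
    refine ⟨fun x => if x ∈ B (j + 1) then x else φ (ψ x), ?_, ?_⟩
    · intro x hx y hy hxy
      dsimp only at hxy
      split_ifs at hxy with h1 h2 h2
      · exact hxy
      · exact (hanti.eq hy hx (hxy ▸ (hlow y hy h2).2)).symm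
      · exact hanti.eq hx hy (hxy ▸ (hlow x hx h1).2)
      · have hx' : x ∈ ({x ∈ A | x ∉ B (j + 1)} : Finset (Finset α)) := mem_filter.2 ⟨hx, h1⟩
        have hy' : y ∈ ({x ∈ A | x ∉ B (j + 1)} : Finset (Finset α)) := mem_filter.2 ⟨hy, h2⟩
        exact hψinj hx' hy' (hφinj (hψ x hx').1 (hψ y hy').1 hxy)
    · intro x hx
      dsimp only
      split_ifs with h1
      · exact ⟨h1, subset_rfl⟩
      · exact hlow x hx h1

lemma IsBottom.card_antichain_le {B : ℕ → Finset (Finset α)} {s m : ℕ} {U : Finset α}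
    (hB : IsBottom B s m U) {A : Finset (Finset α)}
    (hanti : IsAntichain (· ⊆ ·) (A : Set (Finset α))) (hA : ∀ x ∈ A, ∃ i ≤ s, x ∈ B i) :
    #A ≤ m := by
  obtain ⟨ψ, hinj, hψ⟩ := hB.exists_injOn_antichain s le_rfl A hanti hA
  rw [← hB.card_top, ← card_image_of_injOn hinj]
  exact card_le_card (image_subset_iff.2 fun x hx => (hψ x hx).1)

end Bottom

/-! ### The upper bound -/

section Upper

variable {n w : ℕ} {F : Finset (Finset (Fin n))} {f : Finset (Fin n) → Finset (Fin n) → ℝ}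

/-- If a level of a saturated family has size `w`, then every chain of a flow of value `w` that
starts below this level goes up to it. -/
lemma IsFlow.card_slice_le_levelFlow_of_lt (h : IsFlow F (w : ℝ) (ind F) f) {s t : ℕ}
    (hs : s ≤ n) (hw : #(F # s) = w) (ht : t < s) : (#(F # t) : ℝ) ≤ levelFlow f t := by
  obtain ⟨r, hr⟩ := Nat.exists_eq_add_of_le hs
  have h1 := h.value_le
  rw [sum_ind, ← sum_levelFlow, card_sub_sum_levelFlow F f hr, hw] at h1
  have h2 : ∑ i ∈ range r, (levelFlow f (s + i) - #(F # (s + i + 1)) : ℝ) ≤ 0 :=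
    sum_nonpos fun i _ => sub_nonpos.2 (h.levelFlow_le_card_succ _)
  have h3 : levelFlow f n ≤ 0 := by
    refine (h.levelFlow_le_card_succ n).trans (le_of_eq ?_)
    rw [Nat.cast_eq_zero, card_eq_zero, eq_empty_iff_forall_notMem]
    intro X hX
    have := card_le_univ X
    rw [Fintype.card_fin, (mem_slice.1 hX).2] at this
    omega
  have h4 := single_le_sum (s := range s) (f := fun i => (#(F # i) - levelFlow f i : ℝ))
    (fun i _ => sub_nonneg.2 (h.levelFlow_le_card i)) (mem_range.2 ht)
  linarith

/-- The bottom levels of a saturated family are determined by the bottom families it contains. -/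
lemma IsBottom.slice_eq {B : ℕ → Finset (Finset (Fin n))} {s : ℕ} {U : Finset (Fin n)}
    (hB : IsBottom B s w U) (hs : s ≤ n) (hF : IsAntichainSaturated (w + 1) F)
    (hBF : ∀ j ≤ s, B j ⊆ F) {j : ℕ} (hj : j ≤ s) : F # j = B j := by
  obtain ⟨f, h⟩ := exists_unit_flow hF
  have hsub : ∀ j ≤ s, B j ⊆ F # j := fun j hj X hX =>
    mem_slice.2 ⟨hBF j hj hX, (mem_powersetCard.1 (hB.subset j hj hX)).2⟩
  have htop : F # s = B s := by
    refine (eq_of_subset_of_card_le (hsub s le_rfl) ?_).symm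
    rw [hB.card_top]
    exact card_le_of_not_hasAntichain hF.1 slice_subset (sized_slice (𝒜 := F)).isAntichain
  have hw : #(F # s) = w := by rw [htop, hB.card_top]
  refine Nat.decreasingInduction' (P := fun j => F # j = B j) (fun j hjs _ ih => ?_) hj htop
  obtain ⟨S, hS, hSle⟩ := hB.exists_cover j hjs
  refine (eq_of_subset_of_card_le (hsub j hjs.le) (le_trans ?_ hSle)).symm
  have h1 := h.card_slice_le_levelFlow_of_lt hs hw hjs
  have h2 := h.levelFlow_le_cover j S
  rw [ih] at h2
  have h3 : #(∂ S ∩ F) ≤ #(∂ S) := card_le_card inter_subset_left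
  have h4 : (#(∂ S ∩ F) : ℝ) ≤ #(∂ S) := by exact_mod_cast h3
  have h5 : (#(F # j) : ℝ) ≤ #(B (j + 1) \ S) + #(∂ S) := by linarith
  exact_mod_cast h5

lemma IsBottom.card_slice_le_c {B : ℕ → Finset (Finset (Fin n))} {U : Finset (Fin n)}
    (hn : ell (w + 1) ≤ n) (hB : IsBottom B (ell (w + 1) / 2) w U)
    (hF : IsAntichainSaturated (w + 1) F) (hBF : ∀ j ≤ ell (w + 1) / 2, B j ⊆ F) (t : ℕ) :
    #(F # t) ≤ c (w + 1) t := by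
  by_cases ht : ell (w + 1) / 2 ≤ t
  · rw [c_of_le ht]
    exact card_le_of_not_hasAntichain hF.1 slice_subset (sized_slice (𝒜 := F)).isAntichain
  · have hw := hasAntichain_of_saturated hn hF
    rw [hB.slice_eq (by omega) hF hBF (by omega : t ≤ ell (w + 1) / 2)]
    refine Nat.decreasingInduction' (P := fun t => #(B t) ≤ c (w + 1) t) (fun j hjs _ ih => ?_)
      (by omega : t ≤ ell (w + 1) / 2) ?_
    · rw [c_of_lt _ _ hjs]
      refine (hB.card_le_nu j hjs).trans (nu_colexSeg_mono (N := n) ih ?_)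
      refine (c_le_card_slice hn hF hw (by omega)).trans ?_
      refine (card_le_card (slice_subset_powersetCard F (j + 1))).trans ?_
      rw [card_powersetCard, card_univ, Fintype.card_fin]
    · rw [c_top, hB.card_top]
      rfl

lemma exists_saturated_superset {k : ℕ} (hF : ¬ HasAntichain k F) :
    ∃ G, F ⊆ G ∧ IsAntichainSaturated k G := by
  obtain ⟨G, hFG, hG⟩ := (Set.toFinite {G : Finset (Finset (Fin n)) | ¬ HasAntichain k G}
    ).exists_le_maximal (a := F) hF
  refine ⟨G, hFG, hG.prop, fun X hX => ?_⟩
  by_contra hcon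
  exact hX (hG.le_of_ge hcon (subset_insert X G) (mem_insert_self X G))

/-- Bottom families in `U`, together with complements of bottom families in a disjoint set `V`, span a
saturated family that attains the bound: every set of the former is contained in every set of the
latter, so that antichains stay on one side. -/
theorem exists_saturated_card_le {k : ℕ} (hk : 1 ≤ k) (hn : 2 * ell k ≤ n) :
    ∃ F : Finset (Finset (Fin n)), IsAntichainSaturated k F ∧ (#F : ℤ) ≤ satBound n k := by
  obtain ⟨w, rfl⟩ := Nat.exists_eq_add_of_le' hk
  obtain ⟨U, -, hU⟩ := exists_subset_card_eq (s := (univ : Finset (Fin n))) (n := ell (w + 1))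
    (by rw [card_univ, Fintype.card_fin]; omega)
  obtain ⟨V, hV, hVcard⟩ := exists_subset_card_eq (s := Uᶜ) (n := ell (w + 1))
    (by rw [card_compl, Fintype.card_fin]; omega)
  have hell : w ≤ (ell (w + 1)).choose (ell (w + 1) / 2) := (ell_isLeast (w + 1)).1
  obtain ⟨B, hB⟩ := exists_isBottom (ell (w + 1) / 2) w U (by omega) (by rwa [hU])
  obtain ⟨D, hD⟩ := exists_isBottom (ell (w + 1) / 2) w V (by omega) (by rwa [hVcard])
  set a := ell (w + 1) / 2 with ha
  set low : Finset (Finset (Fin n)) := (range (a + 1)).biUnion B with hlow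
  set high : Finset (Finset (Fin n)) := ((range (a + 1)).biUnion D).image (·ᶜ) with hhigh
  have hmemB : ∀ X ∈ low, ∃ i ≤ a, X ∈ B i := by
    intro X hX
    obtain ⟨i, hi, hXi⟩ := mem_biUnion.1 hX
    exact ⟨i, Nat.lt_succ_iff.1 (mem_range.1 hi), hXi⟩
  have hmemD : ∀ X ∈ high, ∃ i ≤ a, Xᶜ ∈ D i := by
    intro X hX
    obtain ⟨i, hi, hXi⟩ := mem_biUnion.1 (mem_image_compl.1 hX)
    exact ⟨i, Nat.lt_succ_iff.1 (mem_range.1 hi), hXi⟩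
  have hle : ∀ X ∈ low, ∀ Y ∈ high, X ⊆ Y := by
    intro X hX Y hY
    obtain ⟨i, hi, hXi⟩ := hmemB X hX
    obtain ⟨j, hj, hYj⟩ := hmemD Y hY
    have h1 := (mem_powersetCard.1 (hB.subset i hi hXi)).1
    have h2 := (mem_powersetCard.1 (hD.subset j hj hYj)).1
    exact (h1.trans (subset_compl_comm.1 hV)).trans
      (by simpa using compl_subset_compl.2 h2)
  have hno : ¬ HasAntichain (w + 1) (low ∪ high) := by
    rintro ⟨A, hA, hcard, hanti⟩
    by_cases h : A ⊆ low
    · have := hB.card_antichain_le hanti fun x hx => hmemB x (h hx)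
      omega
    · obtain ⟨Y, hYA, hY⟩ := not_subset.1 h
      have hYh := (mem_union.1 (hA hYA)).resolve_left hY
      have hAh : A ⊆ high := by
        intro X hX
        by_contra hXh
        have hXl := (mem_union.1 (hA hX)).resolve_right hXh
        have := hanti.eq hX hYA (hle X hXl Y hYh)
        exact hXh (this ▸ hYh)
      have hanti' : IsAntichain (· ⊆ ·) ((A.image (·ᶜ) : Finset (Finset (Fin n))) :
          Set (Finset (Fin n))) := by
        intro X hX Y hY hne hXY
        rw [mem_coe, mem_image_compl] at hX hY
        exact hanti hY hX (fun h => hne (compl_injective h.symm)) (compl_subset_compl.2 hXY)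
      have := hD.card_antichain_le hanti' fun x hx => by
        simpa using hmemD _ (hAh (mem_image_compl.1 hx))
      rw [card_image_of_injective _ compl_injective] at this
      omega
  obtain ⟨F, hsub, hF⟩ := exists_saturated_superset hno
  refine ⟨F, hF, ?_⟩
  have hBF : ∀ j ≤ a, B j ⊆ F := fun j hj X hX =>
    hsub (mem_union_left _ (mem_biUnion.2 ⟨j, mem_range.2 (by omega), hX⟩))
  have hDF : ∀ j ≤ a, D j ⊆ F.image (·ᶜ) := fun j hj X hX =>
    mem_image_compl.2 (hsub (mem_union_right _ (mem_image_of_mem _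
      (mem_biUnion.2 ⟨j, mem_range.2 (by omega), hX⟩))))
  rw [satBound_eq hk (by omega), card_eq_sum_slices]
  push_cast
  refine add_le_add (sum_le_sum fun t _ => ?_) (sum_le_sum fun t _ => ?_)
  · exact_mod_cast hB.card_slice_le_c (by omega) hF hBF t
  · exact_mod_cast hD.card_slice_le_c (by omega) hF.compl hDF t

lemma satStar_le {k : ℕ} (hF : IsAntichainSaturated k F) : satStar n k ≤ #F :=
  Nat.sInf_le ⟨F, hF, rfl⟩

/-- For small `n` only the whole cube is saturated, by Sperner's theorem. -/
lemma satStar_of_lt_ell {n k : ℕ} (hk : 1 ≤ k) (hn : n < ell k) : satStar n k = 2 ^ n := by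
  obtain ⟨F, hF, hcard⟩ := exists_card_eq_satStar n k hk
  have hlt : n.choose (n / 2) < k - 1 := by
    by_contra h
    exact absurd ((ell_isLeast k).2 (not_lt.1 h)) (not_le.2 hn)
  have huniv : F = univ := by
    refine eq_univ_of_forall fun X => ?_
    by_contra hX
    obtain ⟨A, -, hA, hanti⟩ := hF.2 X hX
    have := hanti.sperner
    rw [Fintype.card_fin] at this
    omega
  rw [← hcard, huniv, card_univ, Fintype.card_finset, Fintype.card_fin]

end Upper

end AntichainSat

theorem theorem1p3 (n k : ℕ) (hn : 4 ≤ n) (hk : 4 ≤ k) :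
    (n < AntichainSat.ell k → AntichainSat.satStar n k = 2 ^ n) ∧
    (AntichainSat.ell k ≤ n →
      AntichainSat.satBound n k ≤ (AntichainSat.satStar n k : ℤ)) ∧
    (2 * AntichainSat.ell k + 1 ≤ n →
      (AntichainSat.satStar n k : ℤ) = AntichainSat.satBound n k) := by
  have hlower : AntichainSat.ell k ≤ n →
      AntichainSat.satBound n k ≤ (AntichainSat.satStar n k : ℤ) := by
    intro h
    obtain ⟨F, hF, hcard⟩ := AntichainSat.exists_card_eq_satStar n k (by omega)
    rw [← hcard]
    exact AntichainSat.satBound_le_card (by omega) h hF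
  refine ⟨AntichainSat.satStar_of_lt_ell (by omega), hlower, fun h => ?_⟩
  refine le_antisymm ?_ (hlower (by omega))
  obtain ⟨F, hF, hcard⟩ := AntichainSat.exists_saturated_card_le (n := n) (k := k)
    (by omega) (by omega)
  exact le_trans (by exact_mod_cast AntichainSat.satStar_le hF) hcard
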